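/- Let $p>1$ be an odd integer, $c_0=\frac{2(p+1)}{(p-1)^2}$ (so that $\chi_T(t)=c_0^{1/(p-1)}(T-t)^{-2/(p-1)}$ is the fundamental self-similar solution of $\chi_{tt}-\Delta\chi=\chi^p$), and let $k\ge 1$ be an integer. Let $\mathcal H=L^2(0,1)\times L^2(0,1)$ (complex valued), and $$\mathcal H^{2k}=\{\mathbf u\in H^{2k}(0,1)\times H^{2k}(0,1):\ u_1^{(2j)}(0)=u_2^{(2j+1)}(0)=0,\ 0\le j<k\},\qquad \|\mathbf u\|_{\mathcal H^{2k}}^2=\|\mathbf u\|_{\mathcal H}^2+\|\mathbf u^{(2k)}\|_{\mathcal H}^2 .$$ Let $L_0$ be the closure in $\mathcal H$ of $\tilde L_0\mathbf u=(-\rho u_1'+u_2',\,u_1'-\rho u_2')$, with domain $\{\mathbf u\in C^1[0,1]^2: u_1(0)=0\}$, let $L'\mathbf u=(pc_0\int_0^\rho u_2(\xi)\,d\xi,\,0)$ and $L=L_0+L'$. Put $\lambda_j^+=1+\frac2{p-1}-2j$, $\lambda_j^-=-\frac{2p}{p-1}-2j$ for $0\le j<k$, and $\omega=\frac12+pc_0-2k$.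 Then $\tilde L_0$ is closable, $L$ generates a unique strongly continuous semigroup $S$ on $\mathcal H$, and $S(\tau)\mathcal H^{2k}\subset\mathcal H^{2k}$ for all $\tau\ge0$. For each $0\le j<k$ and each sign, $L$ has an eigenfunction with eigenvalue $\lambda_j^\pm$ that is analytic on $[0,1]$, lies in $\mathcal H^{2k}$, has $\mathcal H^{2k}$-norm $1$, and is of the form $(\rho q'+(\lambda_j^\pm-1)q,\ q')$ with an odd polynomial $q$. Moreover, for every choice of eigenfunctions $\mathbf u(\cdot,\lambda_j^\pm)\in\mathcal H^{2k}$ of $L$ that are analytic on $[0,1]$ and of $\mathcal H^{2k}$-norm $1$: (1) Assume $p\ne5$ or $k\le 3$. There is $C>0$ such that for every $\mathbf u\in\mathcal H^{2k}$ there are $c_0^\pm,\dots,c_{k-1}^\pm\in\mathbb C$ and $\mathbf g\in\mathcal H^{2k}$ with $$\mathbf u=\sum_{j=0}^{k-1}\big(c_j^+\mathbf u(\cdot,\lambda_j^+)+c_j^-\mathbf u(\cdot,\lambda_j^-)\big)+\mathbf g,\qquad \|S(\tau)\mathbf g\|_{\mathcal H^{2k}}\le Ce^{\omega\tau}\|\mathbf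 g\|_{\mathcal H^{2k}}\quad(\tau\ge0),$$ and in particular $$\|S(\tau)\mathbf u\|_{\mathcal H^{2k}}\le C\Big(\sum_{j=0}^{k-1}\big(|c_j^+|e^{\lambda_j^+\tau}+|c_j^-|e^{\lambda_j^-\tau}\big)+e^{\omega\tau}\|\mathbf u\|_{\mathcal H^{2k}}\Big)\quad(\tau\ge0).$$ (2) Assume that $k$ is so large that $\omega\le-\frac{p-3}{p-1}$. There is $C>0$ such that for every $\mathbf u\in\mathcal H^{2k}$ there is $c\in\mathbb C$ with $\|S(\tau)(\mathbf u-c\,\mathbf u(\cdot,\lambda_0^+))\|_{\mathcal H^{2k}}\le Ce^{-\frac{p-3}{p-1}\tau}\|\mathbf u\|_{\mathcal H^{2k}}$ for all $\tau\ge0$. Likewise, there is $C>0$ such that, whenever $\mathbf u\in\mathcal H^{2k}$ has an expansion $\mathbf u=\sum_{j=0}^{k-1}(c_j^+\mathbf u(\cdot,\lambda_j^+)+c_j^-\mathbf u(\cdot,\lambda_j^-))+\mathbf g$ with $\mathbf g\in\mathcal H^{2k}$, $\|S(\tau)\mathbf g\|_{\mathcal H^{2k}}\le C'e^{\omega\tau}\|\mathbf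 g\|_{\mathcal H^{2k}}$ for all $\tau\ge0$ and some constant $C'$ (which may depend on $\mathbf u$ and $\mathbf g$), and $c_0^+=0$ (no gauge mode), then $\|S(\tau)\mathbf u\|_{\mathcal H^{2k}}\le Ce^{-\frac{p-3}{p-1}\tau}\|\mathbf u\|_{\mathcal H^{2k}}$ for all $\tau\ge0$. The rate is sharp: there is $\mathbf u\ne0$ in $\mathcal H^{2k}$ with such an expansion, $c_0^+=0$, and $\|S(\tau)\mathbf u\|_{\mathcal H^{2k}}=e^{-\frac{p-3}{p-1}\tau}\|\mathbf u\|_{\mathcal H^{2k}}$ for all $\tau\ge0$. -/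

import Mathlib

open MeasureTheory Filter Topology Set
open scoped NNReal ContDiff

noncomputable section

namespace AnalyticModes

/-! ### The energy space and the higher Sobolev spaces -/

/-- Lebesgue measure on the interval `(0, 1)`. -/
abbrev μ01 : Measure ℝ := volume.restrict (Ioo (0 : ℝ) 1)

/-- Complex-valued `L²(0, 1)`. -/
abbrev L2 : Type := Lp ℂ 2 μ01

/-- The Hilbert space `L²(0, 1) × L²(0, 1)` with `‖u‖² = ‖u₁‖² + ‖u₂‖²`. -/
abbrev Energy : Type := WithLp 2 (L2 × L2)

/-- `g` is the weak derivative of order `n` of `f` on `(0, 1)`: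
`∫ φ⁽ⁿ⁾ f = (-1)ⁿ ∫ φ g` for all test functions `φ ∈ C_c^∞(0, 1)`. -/
def HasWeakDeriv (n : ℕ) (f g : L2) : Prop :=
  ∀ φ : ℝ → ℝ, ContDiff ℝ ∞ φ → HasCompactSupport φ → tsupport φ ⊆ Ioo (0 : ℝ) 1 →
    ∫ x, ((iteratedDeriv n φ x : ℝ) : ℂ) * f x ∂μ01 = (-1) ^ n * ∫ x, (φ x : ℂ) * g x ∂μ01

open scoped Classical in
/-- The weak derivative of order `n` of `f` in `L²(0, 1)` (it is unique if it exists;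
the value is `0` if it does not exist). -/
def weakDeriv (n : ℕ) (f : L2) : L2 :=
  if h : ∃ g, HasWeakDeriv n f g then h.choose else 0

/-- Membership in the Sobolev space `H^m(0, 1)`: all weak derivatives of order at most `m` exist
in `L²(0, 1)`. -/
def MemSobolev (m : ℕ) (f : L2) : Prop :=
  ∀ n ≤ m, ∃ g, HasWeakDeriv n f g

/-- `f` has a representative that is continuous on `[0, 1]` and vanishes at `0`. -/
def VanishesAtZero (f : L2) : Prop :=
  ∃ F : ℝ → ℂ, ContinuousOn F (Icc 0 1) ∧ f =ᵐ[μ01] F ∧ F 0 = 0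

/-- The space `𝓗^{2k}` of all `u ∈ H^{2k}(0, 1) × H^{2k}(0, 1)` such that
`u₁⁽²ʲ⁾(0) = u₂⁽²ʲ⁺¹⁾(0) = 0` for all `j < k`. The derivatives that occur have order less than
`2k`, hence they lie in `H¹(0, 1)` and are evaluated at `0` through the continuous
representative. -/
def H2k (k : ℕ) : Set Energy :=
  {u | MemSobolev (2 * k) u.fst ∧ MemSobolev (2 * k) u.snd ∧
    ∀ j < k, VanishesAtZero (weakDeriv (2 * j) u.fst) ∧
      VanishesAtZero (weakDeriv (2 * j + 1) u.snd)}

/-- The operator `D^{2k}`: the weak derivative of order `2k`, componentwise. -/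
def D2k (k : ℕ) (u : Energy) : Energy :=
  WithLp.toLp 2 (weakDeriv (2 * k) u.fst, weakDeriv (2 * k) u.snd)

/-- The norm of `𝓗^{2k}`, given by `‖u‖² + ‖D^{2k} u‖²` (norms of the energy space) and a square
root. It is only used for elements of `𝓗^{2k}`. -/
def normH2k (k : ℕ) (u : Energy) : ℝ :=
  Real.sqrt (‖u‖ ^ 2 + ‖D2k k u‖ ^ 2)

/-! ### The operator `L = L₀ + L'` -/

/-- The graph of the operator `L̃₀ u = (-ρ u₁' + u₂', u₁' - ρ u₂')` with domain
`{u ∈ C¹[0, 1] × C¹[0, 1] : u₁(0) = 0}`, as a subspace of the square of the energy space. -/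
def freeGraph : Submodule ℂ (Energy × Energy) where
  carrier := {w | ∃ f₁ f₂ : ℝ → ℂ,
    ContDiffOn ℝ 1 f₁ (Icc 0 1) ∧ ContDiffOn ℝ 1 f₂ (Icc 0 1) ∧ f₁ 0 = 0 ∧
    w.1.fst =ᵐ[μ01] f₁ ∧ w.1.snd =ᵐ[μ01] f₂ ∧
    w.2.fst =ᵐ[μ01] (fun ρ => -(ρ : ℂ) * deriv f₁ ρ + deriv f₂ ρ) ∧
    w.2.snd =ᵐ[μ01] (fun ρ => deriv f₁ ρ - (ρ : ℂ) * deriv f₂ ρ)}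
  add_mem' := by
    rintro v w ⟨f₁, f₂, hf₁, hf₂, h0, h1, h2, h3, h4⟩ ⟨g₁, g₂, hg₁, hg₂, k0, k1, k2, k3, k4⟩
    have hd : ∀ f : ℝ → ℂ, ContDiffOn ℝ 1 f (Icc 0 1) → ∀ x ∈ Ioo (0 : ℝ) 1,
        DifferentiableAt ℝ f x := fun f hf x hx =>
      (hf.differentiableOn one_ne_zero).differentiableAt (Icc_mem_nhds hx.1 hx.2)
    have hmem : ∀ᵐ x ∂μ01, x ∈ Ioo (0 : ℝ) 1 := ae_restrict_mem measurableSet_Ioo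
    refine ⟨f₁ + g₁, f₂ + g₂, hf₁.add hg₁, hf₂.add hg₂, by simp [h0, k0], ?_, ?_, ?_, ?_⟩
    · exact (Lp.coeFn_add _ _).trans (h1.add k1)
    · exact (Lp.coeFn_add _ _).trans (h2.add k2)
    · refine (Lp.coeFn_add _ _).trans ?_
      filter_upwards [h3, k3, hmem] with x hx hy hm
      refine (congrArg₂ (· + ·) hx hy).trans ?_
      rw [deriv_add (hd _ hf₁ x hm) (hd _ hg₁ x hm),
        deriv_add (hd _ hf₂ x hm) (hd _ hg₂ x hm)]
      ring
    · refine (Lp.coeFn_add _ _).trans ?_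
      filter_upwards [h4, k4, hmem] with x hx hy hm
      refine (congrArg₂ (· + ·) hx hy).trans ?_
      rw [deriv_add (hd _ hf₁ x hm) (hd _ hg₁ x hm),
        deriv_add (hd _ hf₂ x hm) (hd _ hg₂ x hm)]
      ring
  zero_mem' := by
    refine ⟨0, 0, contDiffOn_const, contDiffOn_const, rfl, Lp.coeFn_zero _ _ _,
      Lp.coeFn_zero _ _ _, ?_, ?_⟩
    · refine (Lp.coeFn_zero _ _ _).trans ?_
      filter_upwards with x
      simp
    · refine (Lp.coeFn_zero _ _ _).trans ?_
      filter_upwards with x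
      simp
  smul_mem' := by
    rintro c w ⟨g₁, g₂, hg₁, hg₂, k0, k1, k2, k3, k4⟩
    refine ⟨fun x => c * g₁ x, fun x => c * g₂ x, contDiffOn_const.mul hg₁,
      contDiffOn_const.mul hg₂, by simp [k0], ?_, ?_, ?_, ?_⟩
    · exact (Lp.coeFn_smul c _).trans (k1.const_smul c)
    · exact (Lp.coeFn_smul c _).trans (k2.const_smul c)
    · refine (Lp.coeFn_smul c _).trans ?_
      filter_upwards [k3] with x hy
      refine (congrArg (c • ·) hy).trans ?_
      simp only [deriv_const_mul_field, smul_eq_mul]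
      ring
    · refine (Lp.coeFn_smul c _).trans ?_
      filter_upwards [k4] with x hy
      refine (congrArg (c • ·) hy).trans ?_
      simp only [deriv_const_mul_field, smul_eq_mul]
      ring

/-- `freeGraph` is the graph of an operator. -/
theorem freeGraph_functional (w : Energy × Energy) (hw : w ∈ freeGraph) (h0 : w.1 = 0) :
    w.2 = 0 := by
  obtain ⟨f₁, f₂, hf₁, hf₂, -, h1, h2, h3, h4⟩ := hw
  have key : ∀ f : ℝ → ℂ, ContDiffOn ℝ 1 f (Icc 0 1) → (0 : ℝ → ℂ) =ᵐ[μ01] f →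
      ∀ᵐ x ∂μ01, deriv f x = 0 := by
    intro f hf h
    have he : EqOn (0 : ℝ → ℂ) f (Ioo 0 1) :=
      Measure.eqOn_open_of_ae_eq h isOpen_Ioo continuousOn_const
        (hf.continuousOn.mono Ioo_subset_Icc_self)
    filter_upwards [ae_restrict_mem measurableSet_Ioo] with x hx
    have : f =ᶠ[𝓝 x] fun _ => 0 :=
      (he.symm.eventuallyEq_of_mem (isOpen_Ioo.mem_nhds hx))
    rw [this.deriv_eq, deriv_const]
  have z1 : (0 : ℝ → ℂ) =ᵐ[μ01] f₁ := by
    rw [h0] at h1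
    exact (Lp.coeFn_zero ℂ 2 μ01).symm.trans h1
  have z2 : (0 : ℝ → ℂ) =ᵐ[μ01] f₂ := by
    rw [h0] at h2
    exact (Lp.coeFn_zero ℂ 2 μ01).symm.trans h2
  have e1 : w.2.fst = 0 := by
    refine Lp.ext (h3.trans ?_)
    filter_upwards [key _ hf₁ z1, key _ hf₂ z2, Lp.coeFn_zero ℂ 2 μ01] with x a b c
    rw [a, b, c]
    simp
  have e2 : w.2.snd = 0 := by
    refine Lp.ext (h4.trans ?_)
    filter_upwards [key _ hf₁ z1, key _ hf₂ z2, Lp.coeFn_zero ℂ 2 μ01] with x a b c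
    rw [a, b, c]
    simp
  exact (WithLp.ofLp_injective 2) (Prod.ext e1 e2)

/-- The operator `L̃₀`. -/
def Ltilde0 : Energy →ₗ.[ℂ] Energy := freeGraph.toLinearPMap

/-- The graph of `L̃₀` is `freeGraph`. -/
theorem Ltilde0_graph : Ltilde0.graph = freeGraph :=
  Submodule.toLinearPMap_graph_eq _ freeGraph_functional

/-- The operator `L₀`, the closure of `L̃₀`. -/
def L0 : Energy →ₗ.[ℂ] Energy := Ltilde0.closure

/-- An element of `L²(0, 1)`, restricted to a subinterval of `[0, 1]`, is integrable. -/
theorem L2_intervalIntegrable (f : L2) (x : ℝ) (hx : x ∈ Icc (0 : ℝ) 1) :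
    IntervalIntegrable f volume 0 x := by
  have h : Integrable f μ01 := (Lp.memLp f).integrable (by norm_num)
  have h1 : IntegrableOn f (Ioc 0 1) volume := (integrableOn_Ioc_iff_integrableOn_Ioo).2 h
  rw [intervalIntegrable_iff_integrableOn_Ioc_of_le hx.1]
  exact h1.mono_set (Ioc_subset_Ioc_right hx.2)

/-- The primitive of an `L²` function is in `L²(0, 1)`. -/
theorem memLp_primitive (f : L2) :
    MemLp (fun ρ : ℝ => ∫ ξ in (0 : ℝ)..ρ, f ξ) 2 μ01 := by
  have hI := L2_intervalIntegrable f 1 (by simp)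
  have hc : ContinuousOn (fun ρ : ℝ => ∫ ξ in (0 : ℝ)..ρ, f ξ) (Icc 0 1) := by
    have := intervalIntegral.continuousOn_primitive_interval (μ := volume) (a := 0) (b := 1)
      (f := f) (by
        rw [uIcc_of_le zero_le_one, integrableOn_Icc_iff_integrableOn_Ioc]
        exact (intervalIntegrable_iff_integrableOn_Ioc_of_le zero_le_one).1 hI)
    rwa [uIcc_of_le zero_le_one] at this
  obtain ⟨C, hC⟩ := isCompact_Icc.exists_bound_of_continuousOn hc
  refine MemLp.of_bound
    ((hc.mono Ioo_subset_Icc_self).aestronglyMeasurable measurableSet_Ioo) C ?_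
  filter_upwards [ae_restrict_mem measurableSet_Ioo] with x hx
  exact hC x (Ioo_subset_Icc_self hx)

/-- The Volterra operator `f ↦ ∫₀^ρ f(ξ) dξ` on `L²(0, 1)`. -/
def volterra : L2 →ₗ[ℂ] L2 where
  toFun f := (memLp_primitive f).toLp _
  map_add' f g := by
    refine Lp.ext ((memLp_primitive _).coeFn_toLp.trans
      (EventuallyEq.trans ?_ (Lp.coeFn_add _ _).symm))
    filter_upwards [(memLp_primitive f).coeFn_toLp, (memLp_primitive g).coeFn_toLp,
      ae_restrict_mem measurableSet_Ioo] with x h1 h2 hx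
    have hx' := Ioo_subset_Icc_self hx
    rw [Pi.add_apply, h1, h2, ← intervalIntegral.integral_add
      (L2_intervalIntegrable f x hx') (L2_intervalIntegrable g x hx')]
    refine intervalIntegral.integral_congr_ae ?_
    have := (ae_restrict_iff' (measurableSet_Ioo)).1 (Lp.coeFn_add f g)
    filter_upwards [this] with y hy hm
    rw [uIoc_of_le hx'.1] at hm
    exact hy ⟨hm.1, hm.2.trans_lt hx.2⟩
  map_smul' c f := by
    refine Lp.ext ((memLp_primitive _).coeFn_toLp.trans
      (EventuallyEq.trans ?_ (Lp.coeFn_smul _ _).symm))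
    filter_upwards [(memLp_primitive f).coeFn_toLp,
      ae_restrict_mem measurableSet_Ioo] with x h1 hx
    have hx' := Ioo_subset_Icc_self hx
    rw [Pi.smul_apply, RingHom.id_apply, h1, ← intervalIntegral.integral_smul]
    refine intervalIntegral.integral_congr_ae ?_
    have := (ae_restrict_iff' (measurableSet_Ioo)).1 (Lp.coeFn_smul c f)
    filter_upwards [this] with y hy hm
    rw [uIoc_of_le hx'.1] at hm
    exact hy ⟨hm.1, hm.2.trans_lt hx.2⟩

/-- The constant `c₀` of the fundamental self-similar solution
`χ_T(t) = c₀^{1/(p-1)} (T - t)^{-2/(p-1)}` of `χ'' = χ^p`, for which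
`p χ_T^{p-1} = p c₀ (T - t)^{-2}`. -/
def c0 (p : ℕ) : ℝ := 2 * ((p : ℝ) + 1) / ((p : ℝ) - 1) ^ 2

/-- The operator `L' u = (p c₀ ∫₀^ρ u₂(ξ) dξ, 0)`. -/
def Lprime (p : ℕ) : Energy →ₗ[ℂ] Energy where
  toFun u := WithLp.toLp 2 (((p * c0 p : ℝ) : ℂ) • volterra u.snd, 0)
  map_add' u v := by
    refine (WithLp.ofLp_injective 2) (Prod.ext ?_ ?_)
    · simp
    · simp
  map_smul' c u := by
    refine (WithLp.ofLp_injective 2) (Prod.ext ?_ ?_)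
    · simp [smul_comm c]
    · simp

/-- The operator `L = L₀ + L'` with domain `𝓓(L₀)`. -/
def L (p : ℕ) : Energy →ₗ.[ℂ] Energy := Lprime p +ᵥ L0

/-! ### Semigroups -/

/-- Strongly continuous one-parameter semigroups of bounded operators. -/
structure IsC0Semigroup (S : ℝ≥0 → Energy →L[ℂ] Energy) : Prop where
  map_zero : S 0 = ContinuousLinearMap.id ℂ Energy
  map_add : ∀ s t, S (s + t) = (S s).comp (S t)
  strongly_continuous : ∀ u, Continuous fun t => S t u

/-- The (unbounded) operator `A` is the generator of `S`: `u ∈ 𝓓(A)` and `A u = v` if and only if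
`(S(t) u - u) / t → v` for `t → 0+`. -/
def IsGenerator (A : Energy →ₗ.[ℂ] Energy) (S : ℝ≥0 → Energy →L[ℂ] Energy) : Prop :=
  ∀ u v : Energy, (u, v) ∈ A.graph ↔
    Tendsto (fun t : ℝ≥0 => (((t : ℝ) : ℂ)⁻¹) • (S t u - u)) (𝓝[>] 0) (𝓝 v)

/-- `S` is a strongly continuous semigroup with generator `A`. -/
def Generates (A : Energy →ₗ.[ℂ] Energy) (S : ℝ≥0 → Energy →L[ℂ] Energy) : Prop :=
  IsC0Semigroup S ∧ IsGenerator A S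

/-! ### Analytic modes and mode expansions -/

/-- `λ⁺_j = 1 + 2 / (p - 1) - 2 j`. -/
def lamPlus (p j : ℕ) : ℝ := 1 + 2 / ((p : ℝ) - 1) - 2 * j

/-- `λ⁻_j = -2 p / (p - 1) - 2 j`. -/
def lamMinus (p j : ℕ) : ℝ := -(2 * (p : ℝ)) / ((p : ℝ) - 1) - 2 * j

/-- The exponent `1/2 + p c₀ - 2k` in the remainder estimate. -/
def remainderRate (p k : ℕ) : ℝ := 1 / 2 + p * c0 p - 2 * k

/-- `e` is an eigenfunction of `L` with eigenvalue `lam` that lies in `𝓗^{2k}`, has norm `1`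
there (in particular `e ≠ 0`), and is analytic on `[0, 1]`. -/
structure IsAnalyticMode (p k : ℕ) (lam : ℝ) (e : Energy) : Prop where
  mem : e ∈ H2k k
  normalized : normH2k k e = 1
  eigen : (e, (lam : ℂ) • e) ∈ (L p).graph
  analytic : ∃ f₁ f₂ : ℝ → ℂ, AnalyticOnNhd ℝ f₁ (Icc 0 1) ∧ AnalyticOnNhd ℝ f₂ (Icc 0 1) ∧
    e.fst =ᵐ[μ01] f₁ ∧ e.snd =ᵐ[μ01] f₂

/-- `e = (ρ q' + (lam - 1) q, q')` for an odd polynomial `q`. -/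
def IsOddPolynomialMode (lam : ℝ) (e : Energy) : Prop :=
  ∃ q : Polynomial ℂ, q.comp (-Polynomial.X) = -q ∧
    e.fst =ᵐ[μ01] (fun ρ : ℝ => (ρ : ℂ) * q.derivative.eval (ρ : ℂ) +
      ((lam : ℂ) - 1) * q.eval (ρ : ℂ)) ∧
    e.snd =ᵐ[μ01] (fun ρ : ℝ => q.derivative.eval (ρ : ℂ))

/-- `u = ∑_{j<k} (c⁺_j e⁺_j + c⁻_j e⁻_j) + g` with a remainder `g ∈ 𝓗^{2k}` such that
`‖S(τ) g‖ ≤ C e^{(1/2 + p c₀ - 2k) τ} ‖g‖` in `𝓗^{2k}` for all `τ ≥ 0`. -/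
structure IsModeExpansion (p k : ℕ) (S : ℝ≥0 → Energy →L[ℂ] Energy) (eP eM : ℕ → Energy)
    (C : ℝ) (u : Energy) (cP cM : ℕ → ℂ) (g : Energy) : Prop where
  mem : g ∈ H2k k
  eq : u = ∑ j ∈ Finset.range k, (cP j • eP j + cM j • eM j) + g
  decay : ∀ τ : ℝ≥0, normH2k k (S τ g) ≤
    C * Real.exp (remainderRate p k * τ) * normH2k k g

end AnalyticModes

end

noncomputable section

namespace AnalyticModes

/-! ### Strongly continuous semigroups on Banach spaces -/

section Semigroup

variable {E F : Type*} [NormedAddCommGroup E] [NormedSpace ℂ E]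
  [NormedAddCommGroup F] [NormedSpace ℂ F]

/-- Strongly continuous semigroups that are locally bounded, in the form of joint continuity. -/
structure IsSemigroup (T : ℝ≥0 → E →L[ℂ] E) : Prop where
  map_zero : T 0 = ContinuousLinearMap.id ℂ E
  map_add : ∀ s t, T (s + t) = (T s).comp (T t)
  continuous : Continuous fun z : ℝ≥0 × E => T z.1 z.2

/-- `u` is in the domain of the generator of `T`, with image `v`. -/
def InGenerator (T : ℝ≥0 → E →L[ℂ] E) (u v : E) : Prop :=
  Tendsto (fun t : ℝ≥0 => (((t : ℝ) : ℂ)⁻¹) • (T t u - u)) (𝓝[>] 0) (𝓝 v)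

theorem continuous_uncurry_of_bound {T : ℝ≥0 → E →L[ℂ] E} {M : ℝ → ℝ} (hM : Continuous M)
    (hb : ∀ t : ℝ≥0, ‖T t‖ ≤ M t) (hc : ∀ u, Continuous fun t => T t u) :
    Continuous fun z : ℝ≥0 × E => T z.1 z.2 := by
  rw [continuous_iff_continuousAt]
  rintro ⟨t₀, x₀⟩
  have h1 : Tendsto (fun z : ℝ≥0 × E => M z.1 * ‖z.2 - x₀‖ + ‖T z.1 x₀ - T t₀ x₀‖)
      (𝓝 (t₀, x₀)) (𝓝 (M t₀ * ‖x₀ - x₀‖ + ‖T t₀ x₀ - T t₀ x₀‖)) := by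
    have h2 : Continuous fun z : ℝ≥0 × E => T z.1 x₀ := (hc x₀).comp continuous_fst
    have h3 : Continuous fun z : ℝ≥0 × E => M z.1 := hM.comp (by fun_prop)
    exact Continuous.tendsto (by fun_prop) (t₀, x₀)
  simp only [sub_self, norm_zero, mul_zero, add_zero] at h1
  refine tendsto_iff_norm_sub_tendsto_zero.2 (squeeze_zero (fun _ => norm_nonneg _) ?_ h1)
  rintro ⟨t, x⟩
  calc ‖T t x - T t₀ x₀‖ = ‖T t (x - x₀) + (T t x₀ - T t₀ x₀)‖ := by simp
    _ ≤ ‖T t (x - x₀)‖ + ‖T t x₀ - T t₀ x₀‖ := norm_add_le _ _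
    _ ≤ M t * ‖x - x₀‖ + ‖T t x₀ - T t₀ x₀‖ := by
        gcongr
        exact (T t).le_of_opNorm_le (hb t) _

namespace IsSemigroup

variable {T : ℝ≥0 → E →L[ℂ] E}

theorem apply_zero (hT : IsSemigroup T) (u : E) : T 0 u = u := by simp [hT.map_zero]

theorem apply_add (hT : IsSemigroup T) (s t : ℝ≥0) (u : E) : T (s + t) u = T s (T t u) := by
  simp [hT.map_add]

theorem commute (hT : IsSemigroup T) (s t : ℝ≥0) (u : E) : T s (T t u) = T t (T s u) := by
  rw [← hT.apply_add, ← hT.apply_add, add_comm]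

theorem continuous_apply (hT : IsSemigroup T) (u : E) : Continuous fun t => T t u :=
  hT.continuous.comp (by fun_prop : Continuous fun t : ℝ≥0 => (t, u))

theorem inGenerator_apply (hT : IsSemigroup T) {u v : E} (h : InGenerator T u v) (s : ℝ≥0) :
    InGenerator T (T s u) (T s v) := by
  have := ((T s).continuous.tendsto v).comp h
  refine this.congr fun t => ?_
  simp [hT.commute s t]

theorem tendsto_shift (s : ℝ) :
    Tendsto (fun z : ℝ => (z - s).toNNReal) (𝓝[>] s) (𝓝[>] 0) := by
  refine tendsto_nhdsWithin_iff.2 ⟨?_, ?_⟩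
  · have : Continuous fun z : ℝ => (z - s).toNNReal := by fun_prop
    have h := this.tendsto s
    simp only [sub_self, Real.toNNReal_zero] at h
    exact h.mono_left nhdsWithin_le_nhds
  · filter_upwards [self_mem_nhdsWithin] with z hz
    simpa using hz

theorem hasDerivWithinAt (hT : IsSemigroup T) {u v : E} (h : InGenerator T u v) {s : ℝ}
    (hs : 0 ≤ s) :
    HasDerivWithinAt (fun r : ℝ => T r.toNNReal u) (T s.toNNReal v) (Ici s) s := by
  rw [← hasDerivWithinAt_Ioi_iff_Ici, hasDerivWithinAt_iff_tendsto_slope' (by simp)]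
  refine ((hT.inGenerator_apply h s.toNNReal).comp (tendsto_shift s)).congr' ?_
  filter_upwards [self_mem_nhdsWithin] with z hz
  have hz' : 0 ≤ z - s := sub_nonneg.2 (le_of_lt hz)
  have e : z.toNNReal = (z - s).toNNReal + s.toNNReal := by
    rw [← Real.toNNReal_add hz' hs]; simp
  simp only [Function.comp_apply, slope_def_module, e, hT.apply_add, Real.coe_toNNReal _ hz']
  rw [← Complex.ofReal_inv, Complex.coe_smul]

/-- Duhamel's principle for curves `y` in the domain of the generator, modulo the kernel
of `Q`. -/
theorem duhamel (hT : IsSemigroup T) (Q : E →L[ℂ] F) (t : ℝ≥0) (y y' a : ℝ → E)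
    (hy : ContinuousOn y (Icc 0 t))
    (hder : ∀ s ∈ Ico (0 : ℝ) t, HasDerivWithinAt y (y' s) (Ici s) s)
    (hgen : ∀ s ∈ Ico (0 : ℝ) t, InGenerator T (y s) (a s))
    (hQ : ∀ s ∈ Ico (0 : ℝ) t, ∀ r, Q (T r (y' s - a s)) = 0) :
    Q (y t) = Q (T t (y 0)) := by
  set f : ℝ → F := fun s => Q (T ((t : ℝ) - s).toNNReal (y s)) with hf
  have hcont : ContinuousOn f (Icc 0 t) := by
    have h1 : ContinuousOn (fun s : ℝ => (((t : ℝ) - s).toNNReal, y s)) (Icc 0 t) :=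
      ContinuousOn.prodMk (by fun_prop) hy
    exact Q.continuous.comp_continuousOn (hT.continuous.comp_continuousOn h1)
  have hd : ∀ s ∈ Ico (0 : ℝ) t, HasDerivWithinAt f 0 (Ici s) s := by
    intro s hs
    rw [← hasDerivWithinAt_Ioi_iff_Ici, hasDerivWithinAt_iff_tendsto_slope' (by simp)]
    have h1 := hder s hs
    rw [← hasDerivWithinAt_Ioi_iff_Ici, hasDerivWithinAt_iff_tendsto_slope' (by simp)] at h1
    have h2 := h1.sub ((hgen s hs).comp (tendsto_shift s))
    have h3 : Tendsto (fun z : ℝ => ((t : ℝ) - z).toNNReal) (𝓝[>] s)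
        (𝓝 ((t : ℝ) - s).toNNReal) :=
      (Continuous.tendsto (by fun_prop) s).mono_left nhdsWithin_le_nhds
    have h4 := (Q.continuous.tendsto _).comp
      ((hT.continuous.tendsto (((t : ℝ) - s).toNNReal, y' s - a s)).comp (h3.prodMk_nhds h2))
    simp only [hQ s hs] at h4
    refine h4.congr' ?_
    filter_upwards [Ioo_mem_nhdsGT hs.2] with z hz
    have hz' : 0 ≤ z - s := sub_nonneg.2 hz.1.le
    have hz2 : 0 ≤ t - z := sub_nonneg.2 hz.2.le
    have e : ((t : ℝ) - s).toNNReal = ((t : ℝ) - z).toNNReal + (z - s).toNNReal := by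
      rw [← Real.toNNReal_add hz2 hz']; simp
    simp only [Function.comp_apply, slope_def_module, hf, e, hT.apply_add,
      Real.coe_toNNReal _ hz']
    rw [← Complex.ofReal_inv, Complex.coe_smul, ← smul_sub,
      ContinuousLinearMap.map_smul_of_tower, ContinuousLinearMap.map_smul_of_tower]
    simp
  have := constant_of_has_deriv_right_zero hcont hd t ⟨t.2, le_rfl⟩
  simpa [hf, hT.map_zero] using this

/-- A semigroup whose generator extends the generator of `T` coincides with `T`. -/
theorem eq_of_inGenerator (hT : IsSemigroup T) {S : ℝ≥0 → E →L[ℂ] E} (hS0 : S 0 = .id ℂ E)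
    (hSadd : ∀ s t, S (s + t) = (S s).comp (S t)) (hSc : ∀ u, Continuous fun t => S t u)
    (hST : ∀ u v, InGenerator S u v → InGenerator T u v) {u v : E} (h : InGenerator S u v)
    (t : ℝ≥0) : S t u = T t u := by
  have hcomm : ∀ s t u, S s (S t u) = S t (S s u) := fun s t u => by
    rw [← ContinuousLinearMap.comp_apply, ← hSadd, add_comm, hSadd]; rfl
  have hg : ∀ s, InGenerator S (S s u) (S s v) := fun s => by
    refine (((S s).continuous.tendsto v).comp h).congr fun t => ?_
    simp [hcomm s t]
  have := hT.duhamel (.id ℂ E) t (fun s => S s.toNNReal u) (fun s => S s.toNNReal v)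
    (fun s => S s.toNNReal v) ((hSc u).comp (by fun_prop)).continuousOn ?_ ?_ ?_
  · simpa [hS0] using this
  · intro s hs
    rw [← hasDerivWithinAt_Ioi_iff_Ici, hasDerivWithinAt_iff_tendsto_slope' (by simp)]
    refine ((hg s.toNNReal).comp (tendsto_shift s)).congr' ?_
    filter_upwards [self_mem_nhdsWithin] with z hz
    have hz' : 0 ≤ z - s := sub_nonneg.2 (le_of_lt hz)
    have e : z.toNNReal = (z - s).toNNReal + s.toNNReal := by
      rw [← Real.toNNReal_add hz' hs.1]; simp
    simp only [Function.comp_apply, slope_def_module, e, hSadd, Real.coe_toNNReal _ hz']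
    rw [← Complex.ofReal_inv, Complex.coe_smul]
    rfl
  · exact fun s _ => hST _ _ (hg _)
  · simp

/-- Eigenvectors of the generator are eigenvectors of the semigroup. -/
theorem apply_eigenvector (hT : IsSemigroup T) {u : E} {lam : ℝ}
    (h : InGenerator T u ((lam : ℂ) • u)) (t : ℝ≥0) :
    T t u = ((Real.exp (lam * t) : ℝ) : ℂ) • u := by
  have := hT.duhamel (.id ℂ E) t (fun s => Real.exp (lam * s) • u)
    (fun s => (Real.exp (lam * s) * lam) • u) (fun s => (Real.exp (lam * s) * lam) • u)
    (by fun_prop) ?_ ?_ ?_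
  · rw [Complex.coe_smul]; simpa using this.symm
  · intro s _
    have : HasDerivAt (fun s : ℝ => Real.exp (lam * s)) (Real.exp (lam * s) * lam) s := by
      simpa using ((hasDerivAt_id s).const_mul lam).exp
    exact (this.smul_const u).hasDerivWithinAt
  · intro s _
    refine (h.const_smul (Real.exp (lam * s))).congr' ?_ |>.trans (le_of_eq ?_)
    · filter_upwards with r
      rw [ContinuousLinearMap.map_smul_of_tower, ← smul_sub, smul_comm]
    · rw [Complex.coe_smul, smul_smul]
  · simp

theorem integral_apply_of_inGenerator [CompleteSpace E] (hT : IsSemigroup T) {u v : E}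
    (h : InGenerator T u v) (t : ℝ≥0) :
    ∫ s in (0 : ℝ)..t, T s.toNNReal v = T t u - u := by
  have hc : ∀ w, Continuous fun s : ℝ => T s.toNNReal w := fun w =>
    (hT.continuous_apply w).comp (by fun_prop)
  have := intervalIntegral.integral_eq_sub_of_hasDeriv_right (a := 0) (b := (t : ℝ))
    (f := fun s : ℝ => T s.toNNReal u) (f' := fun s : ℝ => T s.toNNReal v)
    (hc u).continuousOn
    (fun s hs => (hT.hasDerivWithinAt h
      (by simpa using hs.1.le : (0 : ℝ) ≤ s)).mono Ioi_subset_Ici_self)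
    ((hc v).intervalIntegrable _ _)
  simpa [hT.map_zero] using this

theorem tendsto_average [CompleteSpace E] {f : ℝ≥0 × ℝ → E} (hf : Continuous f) :
    Tendsto (fun t : ℝ≥0 => (((t : ℝ) : ℂ)⁻¹) • ∫ s in (0 : ℝ)..t, f (t, s)) (𝓝[>] 0)
      (𝓝 (f (0, 0))) := by
  rw [Metric.tendsto_nhds]
  intro ε hε
  have h0 := Metric.tendsto_nhds.1 (hf.tendsto (0, 0)) (ε / 2) (half_pos hε)
  obtain ⟨δ, hδ, hball⟩ := Metric.eventually_nhds_iff.1 h0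
  have hsmall : ∀ᶠ t : ℝ≥0 in 𝓝[>] 0, (t : ℝ) < δ := by
    refine nhdsWithin_le_nhds ?_
    have : Tendsto (fun t : ℝ≥0 => (t : ℝ)) (𝓝 0) (𝓝 0) :=
      NNReal.continuous_coe.tendsto 0
    exact this.eventually (gt_mem_nhds hδ)
  filter_upwards [hsmall, self_mem_nhdsWithin] with t ht htpos
  have htpos' : (0 : ℝ) < t := htpos
  have hne : ((t : ℝ) : ℂ) ≠ 0 := by exact_mod_cast htpos'.ne'
  have e : (((t : ℝ) : ℂ)⁻¹) • (∫ s in (0 : ℝ)..t, f (t, s)) - f (0, 0) =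
      (((t : ℝ) : ℂ)⁻¹) • ∫ s in (0 : ℝ)..t, (f (t, s) - f (0, 0)) := by
    have hi : Continuous fun s : ℝ => f (t, s) := hf.comp (by fun_prop)
    rw [intervalIntegral.integral_sub (hi.intervalIntegrable _ _)
      (continuous_const.intervalIntegrable _ _), smul_sub]
    congr 1
    rw [intervalIntegral.integral_const, sub_zero, ← Complex.coe_smul, smul_smul,
      inv_mul_cancel₀ hne, one_smul]
  have hb : ‖∫ s in (0 : ℝ)..t, (f (t, s) - f (0, 0))‖ ≤ ε / 2 * |(t : ℝ) - 0| := by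
    refine intervalIntegral.norm_integral_le_of_norm_le_const fun s hs => ?_
    rw [uIoc_of_le t.coe_nonneg] at hs
    rw [← dist_eq_norm]
    refine (hball ?_).le
    rw [Prod.dist_eq, max_lt_iff, NNReal.dist_eq, Real.dist_eq]
    simp only [NNReal.coe_zero, sub_zero]
    exact ⟨by rwa [abs_of_pos htpos'], by rw [abs_of_pos hs.1]; exact hs.2.trans_lt ht⟩
  rw [dist_eq_norm, e, norm_smul, norm_inv, Complex.norm_real, Real.norm_of_nonneg t.coe_nonneg]
  rw [sub_zero, abs_of_pos htpos'] at hb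
  calc (t : ℝ)⁻¹ * _ ≤ (t : ℝ)⁻¹ * (ε / 2 * t) := by gcongr
    _ = ε / 2 := by field_simp
    _ < ε := half_lt_self hε

/-- The generator is closed. -/
theorem isClosed_generator [CompleteSpace E] (hT : IsSemigroup T) :
    IsClosed {w : E × E | InGenerator T w.1 w.2} := by
  have e : {w : E × E | InGenerator T w.1 w.2} =
      ⋂ t : ℝ≥0, {w : E × E | ∫ s in (0 : ℝ)..t, T s.toNNReal w.2 = T t w.1 - w.1} := by
    ext w
    simp only [mem_ofPred_eq, mem_iInter]
    refine ⟨fun h t => hT.integral_apply_of_inGenerator h t, fun h => ?_⟩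
    have h1 := tendsto_average (f := fun z : ℝ≥0 × ℝ => T z.2.toNNReal w.2)
      ((hT.continuous_apply w.2).comp (by fun_prop))
    simp only [h, Real.toNNReal_zero, hT.apply_zero] at h1
    exact h1
  rw [e]
  refine isClosed_iInter fun t => isClosed_eq ?_ (by fun_prop)
  refine intervalIntegral.continuous_parametric_intervalIntegral_of_continuous'
    (f := fun (w : E × E) (s : ℝ) => T s.toNNReal w.2) (μ := volume) ?_ 0 t
  exact hT.continuous.comp (by fun_prop : Continuous fun z : (E × E) × ℝ =>
    (z.2.toNNReal, z.1.2))

/-- Bound for the inverse of the generator of an exponentially stable semigroup. -/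
theorem norm_le_of_inGenerator {κ : ℝ} (hb : ∀ t : ℝ≥0, ‖T t‖ ≤ Real.exp (-κ * t))
    {u v : E} (h : InGenerator T u v) : κ * ‖u‖ ≤ ‖v‖ := by
  have h1 : Tendsto (fun t : ℝ≥0 => ((t : ℝ)⁻¹ * (1 - Real.exp (-κ * t))) * ‖u‖) (𝓝[>] 0)
      (𝓝 (κ * ‖u‖)) := by
    refine Tendsto.mul_const _ ?_
    have hd : HasDerivAt (fun s : ℝ => - Real.exp (-κ * s)) κ 0 := by
      have : HasDerivAt (fun s : ℝ => Real.exp (-κ * s)) (Real.exp (-κ * 0) * (-κ)) 0 := by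
        simpa using ((hasDerivAt_id (0 : ℝ)).const_mul (-κ)).exp
      simpa [Pi.neg_def] using this.neg
    have h2 := hd.tendsto_slope_zero_right
    have h3 : Tendsto (fun t : ℝ≥0 => (t : ℝ)) (𝓝[>] 0) (𝓝[>] 0) := by
      refine tendsto_nhdsWithin_iff.2
        ⟨(NNReal.continuous_coe.tendsto 0).mono_left nhdsWithin_le_nhds, ?_⟩
      filter_upwards [self_mem_nhdsWithin] with z hz
      exact hz
    refine (h2.comp h3).congr fun t => ?_
    simp
    left; ring
  refine le_of_tendsto_of_tendsto h1 h.norm ?_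
  filter_upwards [self_mem_nhdsWithin] with t ht
  rw [norm_smul, norm_inv, Complex.norm_real, Real.norm_of_nonneg t.coe_nonneg, mul_assoc]
  refine mul_le_mul_of_nonneg_left ?_ (by positivity)
  have h4 := (T t).le_of_opNorm_le (hb t) u
  have h5 : ‖u‖ - ‖T t u‖ ≤ ‖T t u - u‖ := by
    rw [norm_sub_rev]; exact norm_sub_norm_le _ _
  linarith

end IsSemigroup

/-- Rescaling of a semigroup. -/
theorem InGenerator.rescale {T : ℝ≥0 → E →L[ℂ] E} (hT : IsSemigroup T) (a : ℝ) {u v : E}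
    (h : InGenerator T u v) :
    InGenerator (fun t => ((Real.exp (a * t) : ℝ) : ℂ) • T t) u (v + (a : ℂ) • u) := by
  have h3 : Tendsto (fun t : ℝ≥0 => (t : ℝ)) (𝓝[>] 0) (𝓝[>] 0) := by
    refine tendsto_nhdsWithin_iff.2
      ⟨(NNReal.continuous_coe.tendsto 0).mono_left nhdsWithin_le_nhds, ?_⟩
    filter_upwards [self_mem_nhdsWithin] with z hz
    exact hz
  have hd : HasDerivAt (fun s : ℝ => Real.exp (a * s)) a 0 := by
    simpa using ((hasDerivAt_id (0 : ℝ)).const_mul a).exp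
  have h1 : Tendsto (fun t : ℝ≥0 => (t : ℝ)⁻¹ * (Real.exp (a * t) - 1)) (𝓝[>] 0) (𝓝 a) := by
    simpa [Function.comp_def] using hd.tendsto_slope_zero_right.comp h3
  have h2 : Tendsto (fun t : ℝ≥0 => T t u) (𝓝[>] 0) (𝓝 u) := by
    have := (hT.continuous_apply u).tendsto 0
    rw [hT.apply_zero] at this
    exact this.mono_left nhdsWithin_le_nhds
  have h4 := h.add (((Complex.continuous_ofReal.tendsto a).comp h1).smul h2)
  refine h4.congr fun t => ?_
  simp only [Function.comp_apply, smul_apply, Complex.ofReal_mul,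
    Complex.ofReal_inv, Complex.ofReal_sub, Complex.ofReal_one, mul_smul, ← smul_add, sub_smul,
    one_smul]
  congr 1
  abel

theorem IsSemigroup.rescale {T : ℝ≥0 → E →L[ℂ] E} (hT : IsSemigroup T) (a : ℝ) :
    IsSemigroup (fun t => ((Real.exp (a * t) : ℝ) : ℂ) • T t) where
  map_zero := by simp [hT.map_zero]
  map_add s t := by
    ext u
    simp only [smul_apply, ContinuousLinearMap.comp_apply, hT.apply_add,
      map_smul, smul_smul, NNReal.coe_add, mul_add, Real.exp_add, Complex.ofReal_mul]
    congr 1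
    ring
  continuous := by
    have := hT.continuous
    simp only [smul_apply]
    exact Continuous.smul (by fun_prop) this

end Semigroup

/-! ### Bounded perturbations of exponentially stable semigroups -/

section Perturbation

open BoundedContinuousFunction

variable {E : Type*} [NormedAddCommGroup E] [NormedSpace ℂ E]
  {R : ℝ≥0 → E →L[ℂ] E} {κ : ℝ}

theorem continuous_convolution_integrand (hR : IsSemigroup R) (B : E →L[ℂ] E) (y : ℝ≥0 →ᵇ E) :
    Continuous fun z : ℝ≥0 × ℝ => R ((z.1 : ℝ) - z.2).toNNReal (B (y z.2.toNNReal)) :=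
  hR.continuous.comp (by fun_prop :
    Continuous fun z : ℝ≥0 × ℝ => (((z.1 : ℝ) - z.2).toNNReal, B (y z.2.toNNReal)))

theorem norm_convolution_le (hκ : 0 < κ) (hb : ∀ t : ℝ≥0, ‖R t‖ ≤ Real.exp (-κ * t))
    (B : E →L[ℂ] E) (y : ℝ≥0 →ᵇ E) (t : ℝ≥0) :
    ‖∫ s in (0 : ℝ)..t, R ((t : ℝ) - s).toNNReal (B (y s.toNNReal))‖ ≤ ‖B‖ / κ * ‖y‖ := by
  have h1 : ‖∫ s in (0 : ℝ)..t, R ((t : ℝ) - s).toNNReal (B (y s.toNNReal))‖ ≤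
      ∫ s in (0 : ℝ)..t, Real.exp (-κ * (t - s)) * (‖B‖ * ‖y‖) := by
    refine intervalIntegral.norm_integral_le_of_norm_le t.coe_nonneg ?_
      (Continuous.intervalIntegrable (by fun_prop) _ _)
    refine Eventually.of_forall fun s hs => ?_
    have h2 := hb ((t : ℝ) - s).toNNReal
    rw [Real.coe_toNNReal _ (sub_nonneg.2 hs.2)] at h2
    refine ((R _).le_of_opNorm_le h2 _).trans ?_
    gcongr
    exact (B.le_opNorm _).trans (by gcongr; exact y.norm_coe_le_norm _)
  refine h1.trans ?_
  have h3 : ∫ s in (0 : ℝ)..t, Real.exp (-κ * (t - s)) = (1 - Real.exp (-κ * t)) / κ := by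
    have hd : ∀ s ∈ uIcc (0 : ℝ) t, HasDerivAt (fun s : ℝ => Real.exp (-κ * (t - s)) / κ)
        (Real.exp (-κ * (t - s))) s := by
      intro s _
      have h4 : HasDerivAt (fun s : ℝ => -κ * (t - s)) κ s := by
        simpa using ((hasDerivAt_id s).const_sub (t : ℝ)).const_mul (-κ)
      have h5 := h4.exp.div_const κ
      rwa [mul_div_cancel_right₀ _ hκ.ne'] at h5
    rw [intervalIntegral.integral_eq_sub_of_hasDerivAt hd
      (Continuous.intervalIntegrable (by fun_prop) _ _)]
    simp [sub_div]
  rw [intervalIntegral.integral_mul_const, h3]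
  calc (1 - Real.exp (-κ * t)) / κ * (‖B‖ * ‖y‖) ≤ 1 / κ * (‖B‖ * ‖y‖) := by
        gcongr
        linarith [Real.exp_pos (-κ * t)]
    _ = ‖B‖ / κ * ‖y‖ := by ring

/-- Convolution of the semigroup `R` with `B y`, as an operator on bounded curves `y`. -/
noncomputable def convolution (hR : IsSemigroup R) (hκ : 0 < κ)
    (hb : ∀ t : ℝ≥0, ‖R t‖ ≤ Real.exp (-κ * t)) (B : E →L[ℂ] E) :
    (ℝ≥0 →ᵇ E) →L[ℂ] (ℝ≥0 →ᵇ E) :=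
  LinearMap.mkContinuous
    { toFun := fun y => BoundedContinuousFunction.ofNormedAddCommGroup
        (fun t : ℝ≥0 => ∫ s in (0 : ℝ)..t, R ((t : ℝ) - s).toNNReal (B (y s.toNNReal)))
        (intervalIntegral.continuous_parametric_intervalIntegral_of_continuous
          (f := fun (t : ℝ≥0) (s : ℝ) => R ((t : ℝ) - s).toNNReal (B (y s.toNNReal)))
          (continuous_convolution_integrand hR B y) NNReal.continuous_coe)
        _ (norm_convolution_le hκ hb B y)
      map_add' := fun y z => by
        ext t
        have hy : ∀ y : ℝ≥0 →ᵇ E, Continuous fun s : ℝ =>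
            R ((t : ℝ) - s).toNNReal (B (y s.toNNReal)) := fun y =>
          (continuous_convolution_integrand hR B y).comp (by fun_prop : Continuous fun s => (t, s))
        simp only [coe_ofNormedAddCommGroup, BoundedContinuousFunction.coe_add, Pi.add_apply,
          map_add]
        exact intervalIntegral.integral_add ((hy y).intervalIntegrable _ _)
          ((hy z).intervalIntegrable _ _)
      map_smul' := fun c y => by
        ext t
        simp only [coe_ofNormedAddCommGroup, BoundedContinuousFunction.coe_smul, map_smul,
          RingHom.id_apply]
        exact intervalIntegral.integral_smul _ _ }
    (‖B‖ / κ) fun y => by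
      refine (norm_le (by positivity)).2 fun t => norm_convolution_le hκ hb B y t

/-- The orbit map of `R`. -/
noncomputable def orbit (hR : IsSemigroup R) (hκ : 0 < κ)
    (hb : ∀ t : ℝ≥0, ‖R t‖ ≤ Real.exp (-κ * t)) : E →L[ℂ] (ℝ≥0 →ᵇ E) :=
  have h : ∀ u t, ‖R t u‖ ≤ 1 * ‖u‖ := fun u t => by
    refine (R t).le_of_opNorm_le ((hb t).trans ?_) u
    rw [Real.exp_le_one_iff]
    nlinarith [t.coe_nonneg]
  LinearMap.mkContinuous
    { toFun := fun u => BoundedContinuousFunction.ofNormedAddCommGroup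
        (fun t : ℝ≥0 => R t u) (hR.continuous_apply u) _ (h u)
      map_add' := fun u v => by ext t; simp
      map_smul' := fun c u => by ext t; simp }
    1 fun u => (norm_le (by positivity)).2 fun t => h u t

/-- Bounded perturbation theorem. -/
theorem exists_perturbed_semigroup [CompleteSpace E] (hR : IsSemigroup R) (hκ : 0 < κ)
    (hb : ∀ t : ℝ≥0, ‖R t‖ ≤ Real.exp (-κ * t)) (B : E →L[ℂ] E) (hB : ‖B‖ < κ) :
    ∃ T : ℝ≥0 → E →L[ℂ] E, IsSemigroup T ∧ (∃ M, ∀ t, ‖T t‖ ≤ M) ∧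
      ∀ u v, InGenerator T u (v + B u) ↔ InGenerator R u v := by
  set K := convolution hR hκ hb B with hK
  set Y := orbit hR hκ hb with hY
  have hK1 : ‖K‖ < 1 := by
    refine (LinearMap.mkContinuous_norm_le _ (by positivity) _).trans_lt ?_
    rwa [div_lt_one hκ]
  obtain ⟨U, hU⟩ := isUnit_one_sub_of_norm_lt_one hK1
  set J : (ℝ≥0 →ᵇ E) →L[ℂ] (ℝ≥0 →ᵇ E) := (U⁻¹ : Units _).val with hJ
  have hJ1 : ∀ z, J z - K (J z) = z := fun z => by
    have : (U.val * J) z = z := by rw [hJ, Units.mul_inv]; rfl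
    rw [hU] at this
    simpa using this
  have hJ2 : ∀ z, J (z - K z) = z := fun z => by
    have : (J * U.val) z = z := by rw [hJ, Units.inv_mul]; rfl
    rw [hU] at this
    simpa using this
  set y : E → (ℝ≥0 →ᵇ E) := fun u => J (Y u) with hy
  have heq : ∀ u t, y u t = R t u +
      ∫ s in (0 : ℝ)..t, R ((t : ℝ) - s).toNNReal (B (y u s.toNNReal)) := fun u t => by
    have := congrArg (fun f : ℝ≥0 →ᵇ E => f t) (hJ1 (Y u))
    simp only [BoundedContinuousFunction.coe_sub, Pi.sub_apply] at this
    exact sub_eq_iff_eq_add.1 this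
  have huniq : ∀ (u : E) (z : ℝ≥0 →ᵇ E), (∀ t, z t = R t u +
      ∫ s in (0 : ℝ)..t, R ((t : ℝ) - s).toNNReal (B (z s.toNNReal))) → z = y u := by
    intro u z hz
    have : z - K z = Y u := by
      ext t
      exact sub_eq_iff_eq_add.2 (hz t)
    simp only [hy, ← this, hJ2]
  have hci : ∀ (z : ℝ≥0 →ᵇ E) (t : ℝ), Continuous fun s : ℝ =>
      R (t - s).toNNReal (B (z s.toNNReal)) := fun z t =>
    hR.continuous.comp (by fun_prop :
      Continuous fun s : ℝ => ((t - s).toNNReal, B (z s.toNNReal)))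
  have hshift : ∀ u s t, y u (t + s) = y (y u s) t := by
    intro u s t
    set z : ℝ≥0 →ᵇ E := (y u).compContinuous ⟨fun t => t + s, by fun_prop⟩ with hz
    suffices z = y (y u s) by rw [← this]; rfl
    refine huniq _ _ fun t => ?_
    have e1 : z t = y u (t + s) := rfl
    have hii : ∀ a b : ℝ, IntervalIntegrable (fun r : ℝ =>
      R (((t + s : ℝ≥0) : ℝ) - r).toNNReal (B (y u r.toNNReal))) volume a b := fun a b =>
        (hci (y u) _).intervalIntegrable a b
    rw [e1, heq u (t + s), heq u s, map_add, add_comm t s, hR.apply_add, hR.commute,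
      add_assoc, add_comm s t]
    congr 1
    rw [← intervalIntegral.integral_add_adjacent_intervals (hii 0 s) (hii s _)]
    congr 1
    · rw [← ContinuousLinearMap.intervalIntegral_comp_comm _ ((hci (y u) s).intervalIntegrable _ _)]
      refine intervalIntegral.integral_congr fun r hr => ?_
      rw [uIcc_of_le s.coe_nonneg] at hr
      simp only [← hR.apply_add]
      congr 2
      rw [NNReal.coe_add, add_sub_assoc, Real.toNNReal_add t.coe_nonneg (sub_nonneg.2 hr.2),
        Real.toNNReal_coe]
    · have := intervalIntegral.integral_comp_add_right (a := 0) (b := (t : ℝ)) (fun r : ℝ =>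
        R (((t + s : ℝ≥0) : ℝ) - r).toNNReal (B (y u r.toNNReal))) (s : ℝ)
      rw [zero_add, ← NNReal.coe_add] at this
      rw [← this]
      refine intervalIntegral.integral_congr fun r hr => ?_
      rw [uIcc_of_le t.coe_nonneg] at hr
      simp only [hz]
      have e2 : (r + (s : ℝ)).toNNReal = r.toNNReal + s := by
        rw [Real.toNNReal_add hr.1 s.coe_nonneg, Real.toNNReal_coe]
      rw [e2, NNReal.coe_add, add_sub_add_right_eq_sub]
      rfl
  refine ⟨fun t => (evalCLM ℂ t).comp (J.comp Y), ⟨?_, ?_, ?_⟩, ⟨‖J‖ * ‖Y‖, ?_⟩, ?_⟩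
  · ext u
    have := heq u 0
    simpa [hR.map_zero] using this
  · intro s t
    ext u
    exact (hshift u t s)
  · have : Continuous fun z : ℝ≥0 × E => y z.2 z.1 := by
      have h1 : Continuous fun z : ℝ≥0 × E => y z.2 :=
        (J.continuous.comp Y.continuous).comp continuous_snd
      exact continuous_eval.comp (h1.prodMk continuous_fst)
    exact this
  · intro t
    refine ContinuousLinearMap.opNorm_le_bound _ (by positivity) fun u => ?_
    calc ‖y u t‖ ≤ ‖y u‖ := (y u).norm_coe_le_norm t
      _ ≤ ‖J‖ * ‖Y u‖ := J.le_opNorm _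
      _ ≤ ‖J‖ * (‖Y‖ * ‖u‖) := by gcongr; exact Y.le_opNorm _
      _ = _ := by ring
  · intro u v
    have h0 : y u 0 = u := by
      have := heq u 0
      simpa [hR.map_zero] using this
    have hav := IsSemigroup.tendsto_average (continuous_convolution_integrand hR B (y u))
    simp only [NNReal.coe_zero, sub_zero, Real.toNNReal_zero, hR.apply_zero, h0] at hav
    have key : ∀ t : ℝ≥0, (((t : ℝ) : ℂ)⁻¹) • (y u t - u) = (((t : ℝ) : ℂ)⁻¹) • (R t u - u) +
        (((t : ℝ) : ℂ)⁻¹) • ∫ s in (0 : ℝ)..t, R ((t : ℝ) - s).toNNReal (B (y u s.toNNReal)) := by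
      intro t
      rw [heq u t, ← smul_add]
      congr 1
      abel
    constructor
    · intro h
      have := Tendsto.sub (show Tendsto (fun t : ℝ≥0 => (((t : ℝ) : ℂ)⁻¹) • (y u t - u))
        (𝓝[>] 0) (𝓝 (v + B u)) from h) hav
      simpa [key, InGenerator] using this
    · intro h
      have := Tendsto.add h hav
      simp only [← key] at this
      exact this

end Perturbation

section Core

variable {E : Type*} [NormedAddCommGroup E] [NormedSpace ℂ E] [CompleteSpace E]
  {R : ℝ≥0 → E →L[ℂ] E} {κ : ℝ}

/-- A part `C` of the generator with dense range is a core. -/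
theorem generator_eq_closure (hR : IsSemigroup R) (hκ : 0 < κ)
    (hb : ∀ t : ℝ≥0, ‖R t‖ ≤ Real.exp (-κ * t)) (C : Submodule ℂ (E × E))
    (hC : ∀ w ∈ C, InGenerator R w.1 w.2) (hd : Dense {v | ∃ u, (u, v) ∈ C}) (w : E × E) :
    w ∈ C.topologicalClosure ↔ InGenerator R w.1 w.2 := by
  constructor
  · intro h
    exact closure_minimal (s := (C : Set (E × E))) hC hR.isClosed_generator h
  · intro h
    refine Metric.mem_closure_iff.2 fun ε hε => ?_
    obtain ⟨v, hv, u, huv⟩ := Metric.dense_iff.1 hd w.2 (min ε (κ * ε)) (by positivity)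
    refine ⟨(u, v), huv, ?_⟩
    rw [Metric.mem_ball, dist_comm] at hv
    have h1 : InGenerator R (w.1 - u) (w.2 - v) := by
      refine (h.sub (hC _ huv)).congr fun t => ?_
      rw [← smul_sub]
      congr 1
      rw [map_sub]
      abel
    have h2 := IsSemigroup.norm_le_of_inGenerator hb h1
    rw [← dist_eq_norm, ← dist_eq_norm] at h2
    rw [Prod.dist_eq]
    refine max_lt ?_ (hv.trans_le (min_le_left _ _))
    have h3 := hv.trans_le (min_le_right _ _)
    exact lt_of_mul_lt_mul_left (h2.trans_lt h3) hκ.le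

end Core

open Polynomial (X C)

/-! ### Tools in `L²(0, 1)` -/

theorem ae_mem_Ioo : ∀ᵐ x ∂μ01, x ∈ Ioo (0 : ℝ) 1 := ae_restrict_mem measurableSet_Ioo

theorem memLp_of_continuousOn {f : ℝ → ℂ} (hf : ContinuousOn f (Icc 0 1)) : MemLp f 2 μ01 := by
  obtain ⟨M, hM⟩ := isCompact_Icc.exists_bound_of_continuousOn hf
  refine MemLp.of_bound
    ((hf.mono Ioo_subset_Icc_self).aestronglyMeasurable measurableSet_Ioo) M ?_
  filter_upwards [ae_mem_Ioo] with x hx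
  exact hM x (Ioo_subset_Icc_self hx)

theorem memLp_poly (p : Polynomial ℂ) : MemLp (fun ρ : ℝ => p.eval (ρ : ℂ)) 2 μ01 :=
  memLp_of_continuousOn (by fun_prop)

/-- The element of `L²(0, 1)` given by a polynomial. -/
def polyL2 : Polynomial ℂ →ₗ[ℂ] L2 where
  toFun p := (memLp_poly p).toLp _
  map_add' p q := by
    rw [← MemLp.toLp_add (memLp_poly p) (memLp_poly q)]
    congr 1
    ext ρ
    simp
  map_smul' c p := by
    rw [RingHom.id_apply, ← MemLp.toLp_const_smul c (memLp_poly p)]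
    congr 1
    ext ρ
    simp

theorem polyL2_coe (p : Polynomial ℂ) : polyL2 p =ᵐ[μ01] fun ρ : ℝ => p.eval (ρ : ℂ) :=
  (memLp_poly p).coeFn_toLp

theorem polyL2_eq_of_ae {p : Polynomial ℂ} {f : L2}
    (h : f =ᵐ[μ01] fun ρ : ℝ => p.eval (ρ : ℂ)) : f = polyL2 p :=
  Lp.ext (h.trans (polyL2_coe p).symm)

theorem hasDerivAt_poly (p : Polynomial ℂ) (x : ℝ) :
    HasDerivAt (fun ρ : ℝ => p.eval (ρ : ℂ)) (p.derivative.eval (x : ℂ)) x :=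
  (p.hasDerivAt (x : ℂ)).comp_ofReal

theorem polyL2_injective : Function.Injective polyL2 := by
  rw [injective_iff_map_eq_zero]
  intro p hp
  have h1 : (fun ρ : ℝ => p.eval (ρ : ℂ)) =ᵐ[μ01] fun _ => 0 := by
    refine (polyL2_coe p).symm.trans ?_
    rw [hp]
    exact Lp.coeFn_zero _ _ _
  have h2 : EqOn (fun ρ : ℝ => p.eval (ρ : ℂ)) (fun _ => 0) (Ioo (0 : ℝ) 1) :=
    Measure.eqOn_open_of_ae_eq h1 isOpen_Ioo (by fun_prop) (by fun_prop)
  refine Polynomial.eq_zero_of_infinite_isRoot p ?_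
  refine ((Ioo_infinite (zero_lt_one (α := ℝ))).image
    (Complex.ofReal_injective.injOn)).mono ?_
  rintro _ ⟨x, hx, rfl⟩
  exact h2 hx

theorem norm_sq_L2 (f : L2) : ‖f‖ ^ 2 = ∫ x, ‖f x‖ ^ 2 ∂μ01 := by
  have h := L2.inner_def (𝕜 := ℂ) f f
  rw [inner_self_eq_norm_sq_to_K] at h
  have h2 : ∫ x, inner ℂ (f x) (f x) ∂μ01 = ((∫ x, ‖f x‖ ^ 2 ∂μ01 : ℝ) : ℂ) := by
    rw [← integral_complex_ofReal]
    refine integral_congr_ae (Eventually.of_forall fun x => ?_)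
    simp only [inner_self_eq_norm_sq_to_K]
    simp
  rw [h2] at h
  exact Complex.ofReal_injective (by rw [← h]; push_cast; rfl)

theorem norm_primitive_sq_le (f : L2) {x : ℝ} (hx : x ∈ Icc (0 : ℝ) 1) :
    ‖∫ ξ in (0 : ℝ)..x, f ξ‖ ^ 2 ≤ x * ‖f‖ ^ 2 := by
  have hms : μ01 (Ioo 0 x) ≠ ⊤ := measure_ne_top _ _
  have h1 := L2.inner_indicatorConstLp_one (𝕜 := ℂ) (μ := μ01) (measurableSet_Ioo (a := 0) (b := x))
    hms f
  have h2 : ∫ ξ in Ioo 0 x, f ξ ∂μ01 = ∫ ξ in (0 : ℝ)..x, f ξ := by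
    rw [intervalIntegral.integral_of_le hx.1, integral_Ioc_eq_integral_Ioo,
      Measure.restrict_restrict measurableSet_Ioo, inter_eq_left.2 (Ioo_subset_Ioo_right hx.2)]
  have h3 := norm_inner_le_norm (𝕜 := ℂ) (indicatorConstLp 2 (measurableSet_Ioo (a := 0) (b := x))
    hms (1 : ℂ)) f
  rw [h1, h2, norm_indicatorConstLp (by norm_num) (by norm_num)] at h3
  have h4 : μ01.real (Ioo 0 x) ≤ x := by
    rw [measureReal_restrict_apply measurableSet_Ioo, inter_eq_left.2 (Ioo_subset_Ioo_right hx.2)]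
    simp [hx.1]
  calc ‖∫ ξ in (0 : ℝ)..x, f ξ‖ ^ 2
      ≤ (‖(1 : ℂ)‖ * μ01.real (Ioo 0 x) ^ (1 / (2 : ENNReal).toReal) * ‖f‖) ^ 2 := by gcongr
    _ = μ01.real (Ioo 0 x) * ‖f‖ ^ 2 := by
        rw [mul_pow, norm_one, one_mul, ← Real.rpow_natCast (_ ^ _),
          ← Real.rpow_mul (by positivity)]
        norm_num
    _ ≤ x * ‖f‖ ^ 2 := by gcongr

theorem volterra_coe (f : L2) : volterra f =ᵐ[μ01] fun ρ : ℝ => ∫ ξ in (0 : ℝ)..ρ, f ξ :=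
  (memLp_primitive f).coeFn_toLp

theorem norm_volterra_sq_le (f : L2) : ‖volterra f‖ ^ 2 ≤ 1 / 2 * ‖f‖ ^ 2 := by
  have hint : Integrable (fun x : ℝ => x * ‖f‖ ^ 2) μ01 :=
    (Continuous.integrableOn_Icc (by fun_prop)).mono_set Ioo_subset_Icc_self
  calc ‖volterra f‖ ^ 2 = ∫ x, ‖volterra f x‖ ^ 2 ∂μ01 := norm_sq_L2 _
    _ ≤ ∫ x, x * ‖f‖ ^ 2 ∂μ01 := by
        refine integral_mono_of_nonneg (Eventually.of_forall fun x => by positivity) hint ?_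
        filter_upwards [volterra_coe f, ae_mem_Ioo] with x hx hm
        simp only [hx]
        exact norm_primitive_sq_le f (Ioo_subset_Icc_self hm)
    _ = 1 / 2 * ‖f‖ ^ 2 := by
        rw [integral_mul_const, ← integral_Ioc_eq_integral_Ioo,
          ← intervalIntegral.integral_of_le zero_le_one, integral_id]
        norm_num

theorem norm_volterra_le (f : L2) : ‖volterra f‖ ≤ Real.sqrt (1 / 2) * ‖f‖ := by
  have h := Real.sqrt_le_sqrt (norm_volterra_sq_le f)
  rwa [Real.sqrt_sq (norm_nonneg _), Real.sqrt_mul (by norm_num), Real.sqrt_sq (norm_nonneg _)] at h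

/-- The Volterra operator as a bounded operator. -/
def volterraL : L2 →L[ℂ] L2 := volterra.mkContinuous _ norm_volterra_le

theorem volterraL_apply (f : L2) : volterraL f = volterra f := rfl

theorem volterra_of_hasDerivAt {f : L2} {F G : ℝ → ℂ} (hf : f =ᵐ[μ01] F)
    (hF : ContinuousOn F (Icc 0 1)) (hG : ∀ x ∈ Icc (0 : ℝ) 1, HasDerivAt G (F x) x)
    (h0 : G 0 = 0) : volterra f =ᵐ[μ01] G := by
  filter_upwards [volterra_coe f, ae_mem_Ioo] with x hx hm
  rw [hx]
  have hsub : uIcc 0 x ⊆ Icc (0 : ℝ) 1 := by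
    rw [uIcc_of_le hm.1.le]
    exact Icc_subset_Icc_right hm.2.le
  have h1 : ∫ ξ in (0 : ℝ)..x, f ξ = ∫ ξ in (0 : ℝ)..x, F ξ := by
    refine intervalIntegral.integral_congr_ae ?_
    have := (ae_restrict_iff' (measurableSet_Ioo)).1 hf
    filter_upwards [this] with y hy hm'
    rw [uIoc_of_le hm.1.le] at hm'
    exact hy ⟨hm'.1, hm'.2.trans_lt hm.2⟩
  rw [h1, intervalIntegral.integral_eq_sub_of_hasDerivAt (fun y hy => hG y (hsub hy))
    (hF.mono hsub).intervalIntegrable, h0, sub_zero]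

theorem volterra_polyL2 (p : Polynomial ℂ) :
    volterra (polyL2 p.derivative) = polyL2 (p - C (p.eval 0)) := by
  refine polyL2_eq_of_ae (volterra_of_hasDerivAt (polyL2_coe _) (by fun_prop) (fun x _ => ?_)
    (by simp))
  simpa using hasDerivAt_poly (p - C (p.eval 0)) x

/-! ### Completeness of even and of odd monomials -/

theorem integrable_L2 (f : L2) : Integrable f μ01 := (Lp.memLp f).integrable (by norm_num)

theorem integrable_mul_L2 {g : ℝ → ℂ} (hg : ContinuousOn g (Icc 0 1)) (f : L2) :
    Integrable (fun x => g x * f x) μ01 := by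
  obtain ⟨M, hM⟩ := isCompact_Icc.exists_bound_of_continuousOn hg
  refine (integrable_L2 f).bdd_mul (c := M)
    ((hg.mono Ioo_subset_Icc_self).aestronglyMeasurable measurableSet_Ioo) ?_
  filter_upwards [ae_mem_Ioo] with x hx
  exact hM x (Ioo_subset_Icc_self hx)

theorem eq_zero_of_integral_test_eq_zero {f : ℝ → ℂ} (hf : Integrable f μ01)
    (h : ∀ φ : ℝ → ℝ, ContDiff ℝ ∞ φ → HasCompactSupport φ → tsupport φ ⊆ Ioo (0 : ℝ) 1 →
      ∫ x, (φ x : ℂ) * f x ∂μ01 = 0) : f =ᵐ[μ01] 0 := by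
  have h1 : ∀ᵐ x ∂volume, x ∈ Ioo (0 : ℝ) 1 → f x = 0 := by
    refine isOpen_Ioo.ae_eq_zero_of_integral_contDiff_smul_eq_zero
      (IntegrableOn.locallyIntegrableOn hf) fun φ h1 h2 h3 => ?_
    rw [← h φ h1 h2 h3, setIntegral_eq_integral_of_forall_compl_eq_zero]
    · simp
    · intro x hx
      rw [image_eq_zero_of_notMem_tsupport (fun hh => hx (h3 hh))]
      simp
  exact (ae_restrict_iff' measurableSet_Ioo).2 h1

theorem eq_zero_of_integral_even_eq_zero {f : ℝ → ℂ} (hf : Integrable f μ01)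
    (h : ∀ n : ℕ, ∫ x, (x : ℂ) ^ (2 * n) * f x ∂μ01 = 0) : f =ᵐ[μ01] 0 := by
  have hpow : ∀ g : ℝ → ℂ, ContinuousOn g (Icc 0 1) → Integrable (fun x => g x * f x) μ01 := by
    intro g hg
    obtain ⟨M, hM⟩ := isCompact_Icc.exists_bound_of_continuousOn hg
    refine hf.bdd_mul (c := M)
      ((hg.mono Ioo_subset_Icc_self).aestronglyMeasurable measurableSet_Ioo) ?_
    filter_upwards [ae_mem_Ioo] with x hx
    exact hM x (Ioo_subset_Icc_self hx)
  have hpoly : ∀ P : Polynomial ℂ, ∫ x, P.eval ((x : ℂ) ^ 2) * f x ∂μ01 = 0 := by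
    intro P
    induction P using Polynomial.induction_on' with
    | add p q hp hq =>
      simp only [Polynomial.eval_add, add_mul]
      rw [integral_add (hpow _ (by fun_prop)) (hpow _ (by fun_prop)), hp, hq, add_zero]
    | monomial n a =>
      simp only [Polynomial.eval_monomial, mul_assoc, ← pow_mul]
      rw [integral_const_mul, h, mul_zero]
  refine eq_zero_of_integral_test_eq_zero hf fun φ hφ _ _ => ?_
  have hφc := hφ.continuous
  refine norm_le_zero_iff.1 (le_of_forall_pos_le_add fun ε hε => ?_)
  set M := ∫ x, ‖f x‖ ∂μ01 with hMdef
  have hM : 0 ≤ M := integral_nonneg fun _ => norm_nonneg _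
  obtain ⟨P, hP⟩ := exists_polynomial_near_of_continuousOn 0 1 (fun y => φ (Real.sqrt y))
    (by fun_prop) (ε / (M + 1)) (by positivity)
  set Q : Polynomial ℂ := P.map (algebraMap ℝ ℂ) with hQ
  have hQe : ∀ x : ℝ, Q.eval ((x : ℂ) ^ 2) = ((P.eval (x ^ 2) : ℝ) : ℂ) := by
    intro x
    have := Polynomial.eval_map_algebraMap (B := ℂ) P ((x : ℂ) ^ 2)
    rw [hQ, this, ← Complex.ofReal_pow]
    exact Polynomial.aeval_algebraMap_apply_eq_algebraMap_eval _ _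
  have e : ∫ x, (φ x : ℂ) * f x ∂μ01 =
      ∫ x, ((φ x : ℂ) - Q.eval ((x : ℂ) ^ 2)) * f x ∂μ01 := by
    simp only [sub_mul]
    rw [integral_sub (hpow _ (by fun_prop)) (hpow _ (by fun_prop)), hpoly, sub_zero]
  rw [e]
  calc ‖∫ x, ((φ x : ℂ) - Q.eval ((x : ℂ) ^ 2)) * f x ∂μ01‖
      ≤ ∫ x, ε / (M + 1) * ‖f x‖ ∂μ01 := by
        refine norm_integral_le_of_norm_le (hf.norm.const_mul _) ?_
        filter_upwards [ae_mem_Ioo] with x hx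
        rw [norm_mul]
        gcongr
        rw [hQe, ← Complex.ofReal_sub, Complex.norm_real, Real.norm_eq_abs, abs_sub_comm]
        have := hP (x ^ 2) ⟨by positivity, pow_le_one₀ hx.1.le hx.2.le⟩
        rw [Real.sqrt_sq hx.1.le] at this
        exact this.le
    _ = ε / (M + 1) * M := integral_const_mul _ _
    _ ≤ 0 + ε := by
        rw [zero_add, div_mul_eq_mul_div, div_le_iff₀ (by positivity)]
        nlinarith

theorem L2_eq_zero_of_even {f : L2} (h : ∀ n : ℕ, ∫ x, (x : ℂ) ^ (2 * n) * f x ∂μ01 = 0) :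
    f = 0 :=
  (Lp.eq_zero_iff_ae_eq_zero).2 (eq_zero_of_integral_even_eq_zero (integrable_L2 f) h)

theorem L2_eq_zero_of_odd {f : L2} (h : ∀ n : ℕ, ∫ x, (x : ℂ) ^ (2 * n + 1) * f x ∂μ01 = 0) :
    f = 0 := by
  refine (Lp.eq_zero_iff_ae_eq_zero).2 ?_
  have := eq_zero_of_integral_even_eq_zero
    (integrable_mul_L2 (g := fun x : ℝ => (x : ℂ)) (by fun_prop) f) fun n => by
      rw [← h n]
      congr 1
      ext x
      ring
  filter_upwards [this, ae_mem_Ioo] with x hx hm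
  have hx0 : (x : ℂ) ≠ 0 := by exact_mod_cast hm.1.ne'
  exact (mul_eq_zero.1 hx).resolve_left hx0

/-! ### The core of polynomials -/

/-- Reflection `w ↦ w(-X)`. -/
def reflect : Polynomial ℂ →ₗ[ℂ] Polynomial ℂ := (Polynomial.aeval (-X)).toLinearMap

theorem reflect_apply (w : Polynomial ℂ) : reflect w = w.comp (-X) :=
  (Polynomial.comp_eq_aeval).symm

/-- The odd part of a polynomial. -/
def oddPart : Polynomial ℂ →ₗ[ℂ] Polynomial ℂ := (1 / 2 : ℂ) • (LinearMap.id - reflect)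

/-- The even part of a polynomial. -/
def evenPart : Polynomial ℂ →ₗ[ℂ] Polynomial ℂ := (1 / 2 : ℂ) • (LinearMap.id + reflect)

theorem oddPart_apply (w : Polynomial ℂ) : oddPart w = (1 / 2 : ℂ) • (w - w.comp (-X)) := by
  simp [oddPart, reflect_apply]

theorem evenPart_apply (w : Polynomial ℂ) : evenPart w = (1 / 2 : ℂ) • (w + w.comp (-X)) := by
  simp [evenPart, reflect_apply]

theorem derivative_oddPart (w : Polynomial ℂ) :
    (oddPart w).derivative = evenPart w.derivative := by
  simp [oddPart_apply, evenPart_apply, Polynomial.derivative_comp]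

theorem derivative_evenPart (w : Polynomial ℂ) :
    (evenPart w).derivative = oddPart w.derivative := by
  simp [oddPart_apply, evenPart_apply, Polynomial.derivative_comp, sub_eq_add_neg]

theorem oddPart_X_mul (w : Polynomial ℂ) : oddPart (X * w) = X * evenPart w := by
  simp [oddPart_apply, evenPart_apply, mul_add]

theorem evenPart_X_mul (w : Polynomial ℂ) : evenPart (X * w) = X * oddPart w := by
  simp [oddPart_apply, evenPart_apply, sub_eq_add_neg, mul_add]

theorem oddPart_of_odd {w : Polynomial ℂ} (h : w.comp (-X) = -w) : oddPart w = w := by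
  rw [oddPart_apply, h, sub_neg_eq_add, ← two_smul ℂ w, smul_smul]
  norm_num

theorem oddPart_of_even {w : Polynomial ℂ} (h : w.comp (-X) = w) : oddPart w = 0 := by
  rw [oddPart_apply, h, sub_self, smul_zero]

theorem evenPart_of_odd {w : Polynomial ℂ} (h : w.comp (-X) = -w) : evenPart w = 0 := by
  rw [evenPart_apply, h, add_neg_cancel, smul_zero]

theorem evenPart_of_even {w : Polynomial ℂ} (h : w.comp (-X) = w) : evenPart w = w := by
  rw [evenPart_apply, h, ← two_smul ℂ w, smul_smul]
  norm_num

/-- The pair of the odd part and the even part of a polynomial. -/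
def parityPair : Polynomial ℂ →ₗ[ℂ] Energy :=
  (WithLp.linearEquiv 2 ℂ (L2 × L2)).symm.toLinearMap ∘ₗ
    (polyL2 ∘ₗ oddPart).prod (polyL2 ∘ₗ evenPart)

theorem parityPair_fst (w : Polynomial ℂ) : (parityPair w).fst = polyL2 (oddPart w) := rfl

theorem parityPair_snd (w : Polynomial ℂ) : (parityPair w).snd = polyL2 (evenPart w) := rfl

theorem Energy.ext {u v : Energy} (h1 : u.fst = v.fst) (h2 : u.snd = v.snd) : u = v :=
  (WithLp.ofLp_injective 2) (Prod.ext h1 h2)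

theorem parityPair_injective : Function.Injective parityPair := by
  rw [injective_iff_map_eq_zero]
  intro w hw
  have h1 : oddPart w = 0 := polyL2_injective (by
    rw [← parityPair_fst, hw, map_zero]; rfl)
  have h2 : evenPart w = 0 := polyL2_injective (by
    rw [← parityPair_snd, hw, map_zero]; rfl)
  have : oddPart w + evenPart w = w := by
    rw [oddPart_apply, evenPart_apply, ← smul_add]
    rw [sub_add_add_cancel, ← two_smul ℂ w, smul_smul]
    norm_num
  rw [← this, h1, h2, add_zero]

theorem inner_polyL2 (p : Polynomial ℂ) (f : L2) :
    inner ℂ (polyL2 p) f = ∫ x : ℝ, (starRingEnd ℂ) (p.eval (x : ℂ)) * f x ∂μ01 := by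
  rw [L2.inner_def]
  refine integral_congr_ae ?_
  filter_upwards [polyL2_coe p] with x hx
  rw [hx, RCLike.inner_apply, mul_comm]

theorem denseRange_parityPair : DenseRange parityPair := by
  have : (LinearMap.range parityPair).topologicalClosure = ⊤ := by
    rw [Submodule.topologicalClosure_eq_top_iff, Submodule.eq_bot_iff]
    intro u hu
    rw [Submodule.mem_orthogonal] at hu
    have h : ∀ w, inner ℂ (parityPair w) u = 0 := fun w => hu _ ⟨w, rfl⟩
    have h' : ∀ w, inner ℂ (polyL2 (oddPart w)) u.fst + inner ℂ (polyL2 (evenPart w)) u.snd = 0 :=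
      fun w => by
        have := h w
        rwa [WithLp.prod_inner_apply] at this
    refine Energy.ext (L2_eq_zero_of_odd fun n => ?_) (L2_eq_zero_of_even fun n => ?_)
    · have hodd : ((X : Polynomial ℂ) ^ (2 * n + 1)).comp (-X) = -X ^ (2 * n + 1) := by
        simp [pow_succ, pow_mul]
      have := h' (X ^ (2 * n + 1))
      rw [oddPart_of_odd hodd, evenPart_of_odd hodd, map_zero, inner_zero_left, add_zero,
        inner_polyL2] at this
      simpa using this
    · have heven : ((X : Polynomial ℂ) ^ (2 * n)).comp (-X) = X ^ (2 * n) := by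
        simp [pow_mul]
      have := h' (X ^ (2 * n))
      rw [oddPart_of_even heven, evenPart_of_even heven, map_zero, inner_zero_left, zero_add,
        inner_polyL2] at this
      simpa using this
  rw [DenseRange, ← LinearMap.coe_range, Submodule.dense_iff_topologicalClosure_eq_top]
  exact this

theorem parityPair_mem_freeGraph (w : Polynomial ℂ) :
    (parityPair w, parityPair ((1 - X) * w.derivative)) ∈ freeGraph := by
  have hcd : ∀ p : Polynomial ℂ, ContDiff ℝ 1 (fun ρ : ℝ => p.eval (ρ : ℂ)) := fun p => by
    simp only [Polynomial.eval_eq_sum, Polynomial.sum]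
    exact ContDiff.sum fun i _ => contDiff_const.mul (Complex.ofRealCLM.contDiff.pow i)
  refine ⟨fun ρ => (oddPart w).eval (ρ : ℂ), fun ρ => (evenPart w).eval (ρ : ℂ),
    (hcd _).contDiffOn, (hcd _).contDiffOn, ?_, polyL2_coe _, polyL2_coe _, ?_, ?_⟩
  · simp [oddPart_apply]
  · refine (polyL2_coe _).trans (Eventually.of_forall fun x => ?_)
    simp only [(hasDerivAt_poly _ x).deriv]
    rw [sub_mul, one_mul, map_sub, oddPart_X_mul, derivative_oddPart, derivative_evenPart]
    simp
    ring
  · refine (polyL2_coe _).trans (Eventually.of_forall fun x => ?_)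
    simp only [(hasDerivAt_poly _ x).deriv]
    rw [sub_mul, one_mul, map_sub, evenPart_X_mul, derivative_oddPart, derivative_evenPart]
    simp

/-! ### Dissipativity of `L̃₀` -/

theorem real_inner_eq_re (a b : ℂ) : inner ℝ a b = (inner ℂ a b).re := by
  simp [Complex.inner]

theorem re_inner_L2 (f g : L2) : (inner ℂ f g).re = ∫ x, inner ℝ (f x) (g x) ∂μ01 := by
  rw [L2.inner_def]
  have := integral_re (𝕜 := ℂ) (L2.integrable_inner (𝕜 := ℂ) f g)
  refine Eq.trans this.symm (integral_congr_ae (Eventually.of_forall fun x => ?_))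
  exact (real_inner_eq_re _ _).symm

theorem integrable_real_inner_L2 (f g : L2) :
    Integrable (fun x => inner ℝ (f x) (g x)) μ01 := by
  refine (L2.integrable_inner (𝕜 := ℂ) f g).re.congr (Eventually.of_forall fun x => ?_)
  exact (real_inner_eq_re _ _).symm

theorem freeGraph_dissipative {w : Energy × Energy} (hw : w ∈ freeGraph) :
    (inner ℂ w.2 w.1).re ≤ 1 / 2 * ‖w.1‖ ^ 2 := by
  obtain ⟨f₁, f₂, hf₁, hf₂, h0, h1, h2, h3, h4⟩ := hw
  have hd : ∀ f : ℝ → ℂ, ContDiffOn ℝ 1 f (Icc 0 1) → ∀ x ∈ Ioo (0 : ℝ) 1,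
      HasDerivAt f (deriv f x) x := fun f hf x hx =>
    ((hf.differentiableOn one_ne_zero).differentiableAt (Icc_mem_nhds hx.1 hx.2)).hasDerivAt
  set G : ℝ → ℝ := fun x => -(1 / 2) * (x * (‖f₁ x‖ ^ 2 + ‖f₂ x‖ ^ 2)) + inner ℝ (f₁ x) (f₂ x)
    with hG
  set g : ℝ → ℝ := fun x =>
    (inner ℝ (-(x : ℂ) * deriv f₁ x + deriv f₂ x) (f₁ x) +
      inner ℝ (deriv f₁ x - (x : ℂ) * deriv f₂ x) (f₂ x)) -
    1 / 2 * (‖f₁ x‖ ^ 2 + ‖f₂ x‖ ^ 2) with hg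
  have hGd : ∀ x ∈ Ioo (0 : ℝ) 1, HasDerivAt G (g x) x := by
    intro x hx
    have e1 := (hd f₁ hf₁ x hx)
    have e2 := (hd f₂ hf₂ x hx)
    have := (((hasDerivAt_id x).mul (e1.norm_sq.add e2.norm_sq)).const_mul (-(1 / 2))).add
      (e1.inner ℝ e2)
    convert! this using 1
    simp only [hg, inner_add_left, inner_sub_left]
    have e3 : ∀ a b : ℂ, inner ℝ (-(x : ℂ) * a) b = -(x * inner ℝ b a) := fun a b => by
      rw [neg_mul, inner_neg_left, ← smul_eq_mul, Complex.coe_smul, real_inner_smul_left,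
        real_inner_comm]
    have e4 : ∀ a b : ℂ, inner ℝ ((x : ℂ) * a) b = x * inner ℝ b a := fun a b => by
      rw [← smul_eq_mul, Complex.coe_smul, real_inner_smul_left, real_inner_comm]
    rw [e3, e4, real_inner_comm (f₁ x) (deriv f₂ x)]
    simp only [id, Pi.add_apply]
    ring
  have hGc : ContinuousOn G (Icc 0 1) := by
    have c1 := hf₁.continuousOn
    have c2 := hf₂.continuousOn
    exact (continuousOn_const.mul (continuousOn_id.mul
      ((c1.norm.pow 2).add (c2.norm.pow 2)))).add (c1.inner c2)
  have hgi : ∀ᵐ x ∂μ01, (inner ℝ (w.2.fst x) (w.1.fst x) + inner ℝ (w.2.snd x) (w.1.snd x)) -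
      1 / 2 * (inner ℝ (w.1.fst x) (w.1.fst x) + inner ℝ (w.1.snd x) (w.1.snd x)) = g x := by
    filter_upwards [h1, h2, h3, h4] with x a b c d
    rw [a, b, c, d]
    simp only [hg, real_inner_self_eq_norm_sq]
  have i1 := integrable_real_inner_L2 w.2.fst w.1.fst
  have i2 := integrable_real_inner_L2 w.2.snd w.1.snd
  have i3 := integrable_real_inner_L2 w.1.fst w.1.fst
  have i4 := integrable_real_inner_L2 w.1.snd w.1.snd
  have hint : Integrable g μ01 :=
    ((i1.add i2).sub ((i3.add i4).const_mul (1 / 2))).congr hgi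
  have hI : ∫ x, g x ∂μ01 = G 1 - G 0 := by
    rw [← intervalIntegral.integral_eq_sub_of_hasDerivAt_of_le zero_le_one hGc hGd
      ((intervalIntegrable_iff_integrableOn_Ioo_of_le zero_le_one).2 hint),
      intervalIntegral.integral_of_le zero_le_one, integral_Ioc_eq_integral_Ioo]
  have hval : ∫ x, g x ∂μ01 = (inner ℂ w.2 w.1).re - 1 / 2 * ‖w.1‖ ^ 2 := by
    have s1 := integral_sub (i1.add i2) ((i3.add i4).const_mul (1 / 2))
    simp only [Pi.add_apply] at s1
    rw [← integral_congr_ae hgi, s1,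
      integral_add i1 i2, integral_const_mul, integral_add i3 i4, ← re_inner_L2, ← re_inner_L2,
      ← re_inner_L2, ← re_inner_L2, WithLp.prod_inner_apply, WithLp.prod_norm_sq_eq_of_L2]
    have : ∀ f : L2, (inner ℂ f f).re = ‖f‖ ^ 2 := fun f => by
      rw [← inner_self_eq_norm_sq (𝕜 := ℂ)]; rfl
    rw [this, this, Complex.add_re]
    rfl
  have hG0 : G 0 = 0 := by simp [hG, h0]
  have hG1 : G 1 ≤ 0 := by
    have := norm_sub_sq_real (f₁ 1) (f₂ 1)
    simp only [hG]
    nlinarith [sq_nonneg ‖f₁ 1 - f₂ 1‖]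
  linarith

theorem norm_le_of_mem_freeGraph {w : Energy × Energy} (hw : w ∈ freeGraph) (a : ℝ) :
    (a - 1 / 2) * ‖w.1‖ ≤ ‖w.2 - (a : ℂ) • w.1‖ := by
  rcases eq_or_ne w.1 0 with h | h
  · simp [h]
  have hpos : 0 < ‖w.1‖ := norm_pos_iff.2 h
  refine le_of_mul_le_mul_right ?_ hpos
  have h1 := freeGraph_dissipative hw
  have h2 : (inner ℂ (w.2 - (a : ℂ) • w.1) w.1).re = (inner ℂ w.2 w.1).re - a * ‖w.1‖ ^ 2 := by
    rw [inner_sub_left, inner_smul_left, inner_self_eq_norm_sq_to_K, Complex.sub_re]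
    congr 1
    rw [Complex.conj_ofReal]
    rw [← RCLike.ofReal_pow, Complex.re_ofReal_mul]
    rfl
  have h3 := (Complex.abs_re_le_norm _).trans
    (norm_inner_le_norm (𝕜 := ℂ) (w.2 - (a : ℂ) • w.1) w.1)
  have h4 := neg_abs_le (inner ℂ (w.2 - (a : ℂ) • w.1) w.1).re
  nlinarith

/-! ### The free semigroup on the core -/

/-- The pair associated with the polynomial `v(1 - X)`; the monomials are mapped to eigenfunctions
of `L̃₀`. -/
def corePair : Polynomial ℂ →ₗ[ℂ] Energy := parityPair ∘ₗ (Polynomial.aeval (1 - X)).toLinearMap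

theorem corePair_apply (v : Polynomial ℂ) : corePair v = parityPair (v.comp (1 - X)) := by
  rw [Polynomial.comp_eq_aeval]; rfl

theorem denseRange_corePair : DenseRange corePair := by
  refine denseRange_parityPair.mono ?_
  rintro _ ⟨w, rfl⟩
  refine ⟨w.comp (1 - X), ?_⟩
  rw [corePair_apply, Polynomial.comp_assoc]
  simp

theorem corePair_mem_freeGraph (v : Polynomial ℂ) :
    (corePair v, corePair (-(X * v.derivative))) ∈ freeGraph := by
  have := parityPair_mem_freeGraph (v.comp (1 - X))
  rw [corePair_apply, corePair_apply]
  convert this using 3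
  simp [Polynomial.derivative_comp]

/-- Dilation of polynomials by `e^{-t}`. -/
def dilate (t : ℝ) : Polynomial ℂ →ₗ[ℂ] Polynomial ℂ :=
  (Polynomial.aeval (C ((Real.exp (-t) : ℝ) : ℂ) * X)).toLinearMap

theorem dilate_monomial (t : ℝ) (n : ℕ) (a : ℂ) :
    dilate t (Polynomial.monomial n a) =
      ((Real.exp (-(n * t)) : ℝ) : ℂ) • Polynomial.monomial n a := by
  rw [dilate, AlgHom.toLinearMap_apply, Polynomial.aeval_monomial, mul_pow, ← Polynomial.C_pow,
    ← Polynomial.C_mul_X_pow_eq_monomial, Polynomial.smul_eq_C_mul, Polynomial.algebraMap_eq,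
    ← Complex.ofReal_pow, ← Real.exp_nat_mul]
  rw [mul_neg]
  ring

theorem dilate_zero (v : Polynomial ℂ) : dilate 0 v = v := by
  simp [dilate]

theorem dilate_add (s t : ℝ) (v : Polynomial ℂ) : dilate (s + t) v = dilate s (dilate t v) := by
  induction v using Polynomial.induction_on' with
  | add p q hp hq => simp only [map_add, hp, hq]
  | monomial n a =>
    simp only [dilate_monomial, map_smul, smul_smul]
    rw [← Complex.ofReal_mul, ← Real.exp_add]
    congr 3
    ring

theorem hasDerivAt_corePair_dilate (v : Polynomial ℂ) (t : ℝ) :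
    HasDerivAt (fun t => corePair (dilate t v))
      (corePair (-(X * (dilate t v).derivative))) t := by
  induction v using Polynomial.induction_on' with
  | add p q hp hq =>
    simp only [map_add, mul_add, neg_add]
    exact hp.add hq
  | monomial n a =>
    have h1 : HasDerivAt (fun t : ℝ => Real.exp (-(n * t))) (Real.exp (-(n * t)) * (-n)) t := by
      have : HasDerivAt (fun t : ℝ => -(n * t)) (-(n : ℝ)) t := by
        simpa [Pi.neg_def] using ((hasDerivAt_id t).const_mul (n : ℝ)).neg
      exact this.exp
    have h2 : -(X * (Polynomial.monomial n a).derivative) =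
        ((-(n : ℝ) : ℝ) : ℂ) • Polynomial.monomial n a := by
      rcases n with _ | n
      · simp
      · rw [Polynomial.derivative_monomial, Nat.add_sub_cancel, Polynomial.X_mul_monomial,
          Polynomial.smul_monomial, ← Polynomial.monomial_neg]
        congr 1
        push_cast
        rw [smul_eq_mul]
        ring
    have h3 := h1.smul_const (corePair (Polynomial.monomial n a))
    rw [dilate_monomial, Polynomial.derivative_smul, mul_smul_comm, ← smul_neg, h2, map_smul,
      map_smul, smul_smul, ← Complex.ofReal_mul, Complex.coe_smul]
    simp only [dilate_monomial, map_smul]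
    exact h3

theorem norm_corePair_dilate_le (v : Polynomial ℂ) {t : ℝ} (ht : 0 ≤ t) :
    ‖corePair (dilate t v)‖ ≤ Real.exp (t / 2) * ‖corePair v‖ := by
  set g : ℝ → Energy := fun t => corePair (dilate t v) with hg
  have hd : ∀ t, HasDerivAt (fun t => ‖g t‖ ^ 2 * Real.exp (-t))
      ((2 * (inner ℂ (corePair (-(X * (dilate t v).derivative))) (g t)).re - ‖g t‖ ^ 2) *
        Real.exp (-t)) t := by
    intro t
    have h1 : HasDerivAt (fun t => ‖g t‖ ^ 2)
        (2 * (inner ℂ (corePair (-(X * (dilate t v).derivative))) (g t)).re) t := by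
      have h2 := hasDerivAt_corePair_dilate v t
      have h3 := (Complex.reCLM.hasFDerivAt.comp_hasDerivAt t (h2.inner ℂ h2))
      convert! h3 using 1
      · ext s
        simp only [Function.comp_apply, Complex.reCLM_apply]
        exact (inner_self_eq_norm_sq (𝕜 := ℂ) _).symm
      · simp only [Complex.reCLM_apply, Complex.add_re, hg]
        rw [two_mul]
        congr 1
        rw [← inner_conj_symm, Complex.conj_re]
    have h4 : HasDerivAt (fun t : ℝ => Real.exp (-t)) (-Real.exp (-t)) t := by
      simpa using (hasDerivAt_id t).neg.exp
    convert! h1.mul h4 using 1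
    ring
  have hanti : Antitone fun t => ‖g t‖ ^ 2 * Real.exp (-t) := by
    refine antitone_of_deriv_nonpos (fun t => (hd t).differentiableAt) fun t => ?_
    rw [(hd t).deriv]
    have := freeGraph_dissipative (corePair_mem_freeGraph (dilate t v))
    refine mul_nonpos_of_nonpos_of_nonneg ?_ (Real.exp_pos _).le
    simp only [hg]
    linarith
  have h1 := hanti ht
  simp only [hg, dilate_zero, neg_zero, Real.exp_zero, mul_one] at h1
  refine le_of_sq_le_sq ?_ (by positivity)
  rw [mul_pow, ← Real.exp_nat_mul]
  have h2 : Real.exp ((2 : ℕ) * (t / 2)) * Real.exp (-t) = 1 := by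
    rw [← Real.exp_add]
    simp
    ring
  calc ‖corePair (dilate t v)‖ ^ 2
      = Real.exp ((2 : ℕ) * (t / 2)) * (‖corePair (dilate t v)‖ ^ 2 * Real.exp (-t)) := by
        linear_combination -(‖corePair (dilate t v)‖ ^ 2) * h2
    _ ≤ _ := by gcongr

/-- The semigroup generated by `L₀ - (κ + 1/2)`. -/
def freeSemigroup (κ : ℝ) (t : ℝ≥0) : Energy →L[ℂ] Energy :=
  (((Real.exp (-(κ + 1 / 2) * t) : ℝ) : ℂ) • (corePair ∘ₗ dilate t)).extendOfNorm corePair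

theorem freeSemigroup_bound (κ : ℝ) (t : ℝ≥0) (v : Polynomial ℂ) :
    ‖(((Real.exp (-(κ + 1 / 2) * t) : ℝ) : ℂ) • (corePair ∘ₗ dilate t)) v‖ ≤
      Real.exp (-κ * t) * ‖corePair v‖ := by
  rw [LinearMap.smul_apply, norm_smul, Complex.norm_real, Real.norm_of_nonneg (Real.exp_pos _).le]
  calc Real.exp (-(κ + 1 / 2) * t) * ‖corePair (dilate t v)‖
      ≤ Real.exp (-(κ + 1 / 2) * t) * (Real.exp (t / 2) * ‖corePair v‖) := by
        gcongr
        exact norm_corePair_dilate_le v t.coe_nonneg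
    _ = _ := by
        rw [← mul_assoc, ← Real.exp_add]
        congr 2
        ring

theorem freeSemigroup_corePair (κ : ℝ) (t : ℝ≥0) (v : Polynomial ℂ) :
    freeSemigroup κ t (corePair v) =
      ((Real.exp (-(κ + 1 / 2) * t) : ℝ) : ℂ) • corePair (dilate t v) :=
  LinearMap.extendOfNorm_eq denseRange_corePair ⟨_, freeSemigroup_bound κ t⟩ v

theorem norm_freeSemigroup_le (κ : ℝ) (t : ℝ≥0) : ‖freeSemigroup κ t‖ ≤ Real.exp (-κ * t) :=
  LinearMap.opNorm_extendOfNorm_le denseRange_corePair (Real.exp_pos _).le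
    (freeSemigroup_bound κ t)

theorem ext_on_corePair {S T : Energy →L[ℂ] Energy}
    (h : ∀ v, S (corePair v) = T (corePair v)) : S = T := by
  ext1 u
  exact congrFun (denseRange_corePair.equalizer S.continuous T.continuous (funext h)) u

theorem isSemigroup_freeSemigroup {κ : ℝ} (hκ : 0 < κ) : IsSemigroup (freeSemigroup κ) := by
  have hb1 : ∀ t, ‖freeSemigroup κ t‖ ≤ 1 := fun t => by
    refine (norm_freeSemigroup_le κ t).trans ?_
    rw [Real.exp_le_one_iff]
    nlinarith [t.coe_nonneg]
  refine ⟨?_, ?_, ?_⟩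
  · refine ext_on_corePair fun v => ?_
    simp [freeSemigroup_corePair, dilate_zero]
  · intro s t
    refine ext_on_corePair fun v => ?_
    rw [ContinuousLinearMap.comp_apply, freeSemigroup_corePair, freeSemigroup_corePair, map_smul,
      freeSemigroup_corePair, NNReal.coe_add, dilate_add, smul_smul, ← Complex.ofReal_mul,
      ← Real.exp_add]
    congr 3
    ring
  · refine continuous_uncurry_of_bound (M := fun _ => 1) continuous_const hb1 fun u => ?_
    refine continuous_of_uniform_approx_of_continuous fun U hU => ?_
    obtain ⟨ε, hε, hεU⟩ := Metric.mem_uniformity_dist.1 hU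
    obtain ⟨_, hv, v, rfl⟩ := Metric.dense_iff.1 denseRange_corePair u ε hε
    refine ⟨fun t => freeSemigroup κ t (corePair v), ?_, fun t => hεU ?_⟩
    · simp only [freeSemigroup_corePair]
      have h1 : Continuous fun t => corePair (dilate t v) :=
        continuous_iff_continuousAt.2 fun t => (hasDerivAt_corePair_dilate v t).continuousAt
      have h2 : Continuous fun t : ℝ≥0 => ((Real.exp (-(κ + 1 / 2) * t) : ℝ) : ℂ) := by fun_prop
      exact h2.smul (h1.comp NNReal.continuous_coe)
    · rw [dist_eq_norm, ← map_sub]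
      refine ((freeSemigroup κ t).le_of_opNorm_le (hb1 t) _).trans_lt ?_
      rw [one_mul, ← dist_eq_norm, dist_comm]
      exact hv

theorem inGenerator_freeSemigroup_corePair (κ : ℝ) (v : Polynomial ℂ) :
    InGenerator (freeSemigroup κ) (corePair v)
      (corePair (-(X * v.derivative)) - ((κ + 1 / 2 : ℝ) : ℂ) • corePair v) := by
  have h3 : Tendsto (fun t : ℝ≥0 => (t : ℝ)) (𝓝[>] 0) (𝓝[>] 0) := by
    refine tendsto_nhdsWithin_iff.2
      ⟨(NNReal.continuous_coe.tendsto 0).mono_left nhdsWithin_le_nhds, ?_⟩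
    filter_upwards [self_mem_nhdsWithin] with z hz
    exact hz
  have h4 : HasDerivAt (fun t : ℝ => Real.exp (-(κ + 1 / 2) * t)) (-(κ + 1 / 2)) 0 := by
    simpa using ((hasDerivAt_id (0 : ℝ)).const_mul (-(κ + 1 / 2))).exp
  have h5 := (h4.smul (hasDerivAt_corePair_dilate v 0)).tendsto_slope_zero_right.comp h3
  simp only [dilate_zero, mul_zero, Real.exp_zero, one_smul] at h5
  rw [neg_smul] at h5
  rw [sub_eq_add_neg, Complex.coe_smul]
  refine h5.congr fun t => ?_
  simp only [Function.comp_apply, Pi.smul_apply', zero_add, dilate_zero, mul_zero, Real.exp_zero,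
    one_smul, freeSemigroup_corePair, Complex.coe_smul, ← Complex.ofReal_inv]
  rfl

/-- The shift `(u, v) ↦ (u, v - a u)` of graphs. -/
def shear (a : ℂ) : (Energy × Energy) ≃L[ℂ] (Energy × Energy) :=
  ContinuousLinearEquiv.equivOfInverse
    ((ContinuousLinearMap.fst ℂ Energy Energy).prod
      (ContinuousLinearMap.snd ℂ Energy Energy - a • ContinuousLinearMap.fst ℂ Energy Energy))
    ((ContinuousLinearMap.fst ℂ Energy Energy).prod
      (ContinuousLinearMap.snd ℂ Energy Energy + a • ContinuousLinearMap.fst ℂ Energy Energy))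
    (fun w => by simp) (fun w => by simp)

/-- The graph of `L̃₀` on the core. -/
def coreGraph : Submodule ℂ (Energy × Energy) :=
  LinearMap.range (corePair.prod (corePair ∘ₗ
    (-(LinearMap.mulLeft ℂ X ∘ₗ Polynomial.derivative))))

theorem mem_coreGraph {w : Energy × Energy} :
    w ∈ coreGraph ↔ ∃ v, (corePair v, corePair (-(X * v.derivative))) = w := Iff.rfl

theorem coreGraph_le_freeGraph : coreGraph ≤ freeGraph := by
  rintro _ ⟨v, rfl⟩
  exact corePair_mem_freeGraph v

theorem dense_range_core_sub {a : ℝ} (ha : 0 < a) :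
    Dense {z | ∃ w ∈ coreGraph, w.2 - (a : ℂ) • w.1 = z} := by
  refine denseRange_corePair.mono ?_
  rintro _ ⟨q, rfl⟩
  have h : ∃ v : Polynomial ℂ, -(X * v.derivative) - (a : ℂ) • v = q := by
    induction q using Polynomial.induction_on' with
    | add p q hp hq =>
      obtain ⟨v, rfl⟩ := hp
      obtain ⟨w, rfl⟩ := hq
      refine ⟨v + w, ?_⟩
      simp only [map_add, mul_add, smul_add]
      abel
    | monomial n b =>
      have hne : -(n : ℂ) - a ≠ 0 := by
        have : (-(n : ℝ) - a : ℝ) ≠ 0 := by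
          have : (0 : ℝ) ≤ n := Nat.cast_nonneg n
          linarith
        exact_mod_cast this
      refine ⟨Polynomial.monomial n (b / (-(n : ℂ) - a)), ?_⟩
      rcases n with _ | n
      · simp only [Polynomial.derivative_monomial, CharP.cast_eq_zero, mul_zero, map_zero,
          neg_zero, zero_sub, Polynomial.smul_monomial, smul_eq_mul, ← Polynomial.monomial_neg]
        congr 1
        have ha' : (a : ℂ) ≠ 0 := by exact_mod_cast ha.ne'
        field_simp
      · rw [Polynomial.derivative_monomial, Nat.add_sub_cancel, Polynomial.X_mul_monomial,
          Polynomial.smul_monomial, ← Polynomial.monomial_neg, ← map_sub]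
        congr 1
        rw [smul_eq_mul]
        field_simp
  obtain ⟨v, hv⟩ := h
  refine ⟨_, mem_coreGraph.2 ⟨v, rfl⟩, ?_⟩
  rw [← hv, map_sub, map_smul]

theorem freeGraph_le_closure_coreGraph : freeGraph ≤ coreGraph.topologicalClosure := by
  intro w hw
  refine Metric.mem_closure_iff.2 fun ε hε => ?_
  obtain ⟨z, hz, w', hw', rfl⟩ := Metric.dense_iff.1
    (dense_range_core_sub (a := 3 / 2) (by norm_num)) (w.2 - ((3 / 2 : ℝ) : ℂ) • w.1) (ε / 3)
    (by positivity)
  refine ⟨w', hw', ?_⟩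
  rw [Metric.mem_ball, dist_comm, dist_eq_norm] at hz
  have hsub : w - w' ∈ freeGraph := sub_mem hw (coreGraph_le_freeGraph hw')
  have h1 := norm_le_of_mem_freeGraph hsub (3 / 2)
  have e : w.2 - ((3 / 2 : ℝ) : ℂ) • w.1 - (w'.2 - ((3 / 2 : ℝ) : ℂ) • w'.1) =
      (w - w').2 - ((3 / 2 : ℝ) : ℂ) • (w - w').1 := by
    simp only [Prod.snd_sub, Prod.fst_sub, smul_sub]
    abel
  rw [e] at hz
  have h2 : ‖(w - w').1‖ < ε / 3 := by linarith
  have h3 : ‖(w - w').2‖ ≤ ‖(w - w').2 - ((3 / 2 : ℝ) : ℂ) • (w - w').1‖ +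
      ‖((3 / 2 : ℝ) : ℂ) • (w - w').1‖ := by
    simpa using norm_add_le ((w - w').2 - ((3 / 2 : ℝ) : ℂ) • (w - w').1)
      (((3 / 2 : ℝ) : ℂ) • (w - w').1)
  rw [norm_smul, Complex.norm_real, Real.norm_of_nonneg (by norm_num)] at h3
  rw [dist_eq_norm, Prod.norm_def]
  exact max_lt (by linarith) (by linarith)

theorem closure_coreGraph : coreGraph.topologicalClosure = freeGraph.topologicalClosure :=
  le_antisymm (Submodule.topologicalClosure_mono coreGraph_le_freeGraph)
    (Submodule.topologicalClosure_minimal _ freeGraph_le_closure_coreGraph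
      coreGraph.isClosed_topologicalClosure)

theorem mem_closure_freeGraph_iff {κ : ℝ} (hκ : 0 < κ) (u v : Energy) :
    (u, v) ∈ freeGraph.topologicalClosure ↔
      InGenerator (freeSemigroup κ) u (v - ((κ + 1 / 2 : ℝ) : ℂ) • u) := by
  set a : ℂ := ((κ + 1 / 2 : ℝ) : ℂ) with ha
  have h1 := generator_eq_closure (isSemigroup_freeSemigroup hκ) hκ (norm_freeSemigroup_le κ)
    (coreGraph.map (shear a).toLinearMap) ?_ ?_ (u, v - a • u)
  · rw [← h1, ← closure_coreGraph]
    have h2 : (coreGraph.map (shear a).toLinearMap).topologicalClosure =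
        coreGraph.topologicalClosure.map (shear a).toLinearMap := by
      apply SetLike.coe_injective
      rw [Submodule.topologicalClosure_coe, Submodule.map_coe, Submodule.map_coe,
        Submodule.topologicalClosure_coe]
      exact ((shear a).toHomeomorph.image_closure _).symm
    rw [h2, Submodule.mem_map]
    constructor
    · exact fun h => ⟨_, h, rfl⟩
    · rintro ⟨w, hw, he⟩
      have : w = (u, v) := (shear a).injective (he.trans rfl)
      rwa [← this]
  · rintro _ ⟨_, ⟨v, rfl⟩, rfl⟩
    exact inGenerator_freeSemigroup_corePair κ v
  · refine (dense_range_core_sub (a := κ + 1 / 2) (by positivity)).mono ?_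
    rintro _ ⟨w, hw, rfl⟩
    exact ⟨w.1, w, hw, rfl⟩

theorem Ltilde0_isClosable : Ltilde0.IsClosable := by
  refine ⟨freeGraph.topologicalClosure.toLinearPMap, ?_⟩
  rw [Ltilde0_graph]
  refine (Submodule.toLinearPMap_graph_eq _ fun w hw h0 => ?_).symm
  have h := (mem_closure_freeGraph_iff one_pos w.1 w.2).1 hw
  rw [h0, smul_zero, sub_zero] at h
  have h2 : InGenerator (freeSemigroup 1) 0 0 := by simp [InGenerator]
  exact tendsto_nhds_unique h h2

theorem mem_L0_graph (w : Energy × Energy) : w ∈ L0.graph ↔ w ∈ freeGraph.topologicalClosure := by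
  rw [L0, ← Ltilde0_isClosable.graph_closure_eq_closure_graph, Ltilde0_graph]

theorem mem_L_graph (p : ℕ) (u v : Energy) :
    (u, v) ∈ (L p).graph ↔ (u, v - Lprime p u) ∈ freeGraph.topologicalClosure := by
  rw [← mem_L0_graph, LinearPMap.mem_graph_iff, LinearPMap.mem_graph_iff]
  constructor
  · rintro ⟨y, hy, hv⟩
    refine ⟨y, hy, ?_⟩
    simp only at hy hv ⊢
    rw [← hv, ← hy]
    exact (add_sub_cancel_left (Lprime p y) (L0 y)).symm
  · rintro ⟨y, hy, hv⟩
    refine ⟨y, hy, ?_⟩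
    simp only at hy hv ⊢
    rw [← hy] at hv
    have : L p y = Lprime p y + L0 y := rfl
    rw [this, hv]
    abel

/-! ### The semigroup generated by `L` -/

theorem Lprime_fst (p : ℕ) (u : Energy) :
    (Lprime p u).fst = ((p * c0 p : ℝ) : ℂ) • volterra u.snd := rfl

theorem Lprime_snd (p : ℕ) (u : Energy) : (Lprime p u).snd = 0 := rfl

theorem norm_snd_le (u : Energy) : ‖u.snd‖ ≤ ‖u‖ := by
  refine le_of_sq_le_sq ?_ (norm_nonneg _)
  rw [WithLp.prod_norm_sq_eq_of_L2]
  exact le_add_of_nonneg_left (sq_nonneg _)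

theorem norm_Lprime_le {p : ℕ} (hc : 0 < p * c0 p) (u : Energy) :
    ‖Lprime p u‖ ≤ p * c0 p * Real.sqrt (1 / 2) * ‖u‖ := by
  have h : ‖Lprime p u‖ = ‖(Lprime p u).fst‖ := by
    have := WithLp.prod_norm_sq_eq_of_L2 (Lprime p u)
    rw [Lprime_snd, norm_zero, zero_pow two_ne_zero, add_zero] at this
    exact (pow_left_inj₀ (norm_nonneg _) (norm_nonneg _) two_ne_zero).1 this
  rw [h, Lprime_fst, norm_smul, Complex.norm_real, Real.norm_of_nonneg hc.le,
    mul_assoc (p * c0 p)]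
  exact mul_le_mul_of_nonneg_left ((norm_volterra_le _).trans
    (mul_le_mul_of_nonneg_left (norm_snd_le u) (Real.sqrt_nonneg _))) hc.le

/-- The operator `L'` as a bounded operator. -/
def LprimeL {p : ℕ} (hc : 0 < p * c0 p) : Energy →L[ℂ] Energy :=
  (Lprime p).mkContinuous _ (norm_Lprime_le hc)

/-- A semigroup generated by `L` that satisfies the growth bound. -/
structure IsWaveSemigroup (p : ℕ) (S : ℝ≥0 → Energy →L[ℂ] Energy) : Prop where
  isSemigroup : IsSemigroup S
  bound : ∃ M, ∀ t : ℝ≥0, ‖S t‖ ≤ M * Real.exp ((1 / 2 + p * c0 p) * t)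
  generator : ∀ u v, (u, v) ∈ (L p).graph ↔ InGenerator S u v

theorem exists_isWaveSemigroup {p : ℕ} (hc : 0 < p * c0 p) : ∃ S, IsWaveSemigroup p S := by
  set κ := p * c0 p with hκ
  have hB : ‖LprimeL hc‖ < κ := by
    refine (LinearMap.mkContinuous_norm_le _ (by positivity) _).trans_lt ?_
    have : Real.sqrt (1 / 2) < 1 := by
      rw [Real.sqrt_lt' one_pos]; norm_num
    nlinarith
  obtain ⟨T, hT, ⟨M, hM⟩, hgen⟩ := exists_perturbed_semigroup (isSemigroup_freeSemigroup hc) hc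
    (norm_freeSemigroup_le κ) (LprimeL hc) hB
  refine ⟨fun t => ((Real.exp ((κ + 1 / 2) * t) : ℝ) : ℂ) • T t, hT.rescale _, ⟨M, fun t => ?_⟩,
    fun u v => ?_⟩
  · rw [norm_smul, Complex.norm_real, Real.norm_of_nonneg (Real.exp_pos _).le, mul_comm,
      add_comm (1 / 2)]
    gcongr
    exact hM t
  · set a : ℂ := ((κ + 1 / 2 : ℝ) : ℂ) with ha
    have h1 := hgen u (v - Lprime p u - a • u)
    have h2 : v - Lprime p u - a • u + LprimeL hc u = v - a • u := by
      change v - Lprime p u - a • u + Lprime p u = v - a • u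
      abel
    rw [h2] at h1
    rw [mem_L_graph, mem_closure_freeGraph_iff hc, ← h1]
    constructor
    · intro h
      have := h.rescale hT (κ + 1 / 2)
      rwa [sub_add_cancel] at this
    · intro h
      have := h.rescale (hT.rescale _) (-(κ + 1 / 2))
      have e : (fun t : ℝ≥0 => ((Real.exp (-(κ + 1 / 2) * t) : ℝ) : ℂ) •
          (((Real.exp ((κ + 1 / 2) * t) : ℝ) : ℂ) • T t)) = T := by
        funext t
        rw [smul_smul, ← Complex.ofReal_mul, ← Real.exp_add, neg_mul, neg_add_cancel]
        simp
      rw [e] at this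
      rw [Complex.ofReal_neg, neg_smul, ← sub_eq_add_neg] at this
      exact this

theorem corePair_mem_L_graph (p : ℕ) (v : Polynomial ℂ) :
    (corePair v, corePair (-(X * v.derivative)) + Lprime p (corePair v)) ∈ (L p).graph := by
  rw [mem_L_graph, add_sub_cancel_right]
  exact Submodule.le_topologicalClosure _ (corePair_mem_freeGraph v)

theorem IsWaveSemigroup.generates {p : ℕ} {S : ℝ≥0 → Energy →L[ℂ] Energy}
    (hS : IsWaveSemigroup p S) : Generates (L p) S :=
  ⟨⟨hS.isSemigroup.map_zero, hS.isSemigroup.map_add, hS.isSemigroup.continuous_apply⟩,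
    hS.generator⟩

theorem IsWaveSemigroup.eq_of_generates {p : ℕ} {S T : ℝ≥0 → Energy →L[ℂ] Energy}
    (hS : IsWaveSemigroup p S) (hT : Generates (L p) T) : T = S := by
  funext t
  refine ext_on_corePair fun v => ?_
  refine hS.isSemigroup.eq_of_inGenerator hT.1.map_zero hT.1.map_add hT.1.strongly_continuous
    (fun u v h => (hS.generator u v).1 ((hT.2 u v).2 h))
    ((hT.2 _ _).1 (corePair_mem_L_graph p v)) t

theorem isWaveSemigroup_of_generates {p : ℕ} (hc : 0 < p * c0 p)
    {T : ℝ≥0 → Energy →L[ℂ] Energy} (hT : Generates (L p) T) : IsWaveSemigroup p T := by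
  obtain ⟨S, hS⟩ := exists_isWaveSemigroup hc
  rwa [hS.eq_of_generates hT]

/-! ### Polynomial eigenfunctions -/

theorem volterra_polyL2_derivative {q : Polynomial ℂ} (h0 : q.eval 0 = 0) :
    volterra (polyL2 q.derivative) = polyL2 q := by
  rw [volterra_polyL2, h0, map_zero, sub_zero]

theorem eval_zero_of_odd {q : Polynomial ℂ} (hq : q.comp (-X) = -q) : q.eval 0 = 0 := by
  have := congrArg (Polynomial.eval 0) hq
  simp only [Polynomial.eval_comp, Polynomial.eval_neg, Polynomial.eval_X, neg_zero] at this
  exact self_eq_neg.1 this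

theorem derivative_even_of_odd {q : Polynomial ℂ} (hq : q.comp (-X) = -q) :
    q.derivative.comp (-X) = q.derivative := by
  have := congrArg Polynomial.derivative hq
  simpa [Polynomial.derivative_comp] using this

/-- The polynomial `ρ q' + (λ - 1) q + q'`, whose odd and even parts are the components of a
mode. -/
def modePoly (lam : ℂ) (q : Polynomial ℂ) : Polynomial ℂ :=
  X * q.derivative + (lam - 1) • q + q.derivative

theorem oddPart_modePoly (lam : ℂ) {q : Polynomial ℂ} (hq : q.comp (-X) = -q) :
    oddPart (modePoly lam q) = X * q.derivative + (lam - 1) • q := by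
  have h := derivative_even_of_odd hq
  rw [modePoly, map_add, map_add, oddPart_X_mul, map_smul, oddPart_of_odd hq, oddPart_of_even h,
    evenPart_of_even h, add_zero]

theorem evenPart_modePoly (lam : ℂ) {q : Polynomial ℂ} (hq : q.comp (-X) = -q) :
    evenPart (modePoly lam q) = q.derivative := by
  have h := derivative_even_of_odd hq
  rw [modePoly, map_add, map_add, evenPart_X_mul, map_smul, evenPart_of_odd hq,
    oddPart_of_even h, evenPart_of_even h, mul_zero, smul_zero, add_zero, zero_add]

theorem Lprime_modePoly (p : ℕ) (lam : ℂ) {q : Polynomial ℂ} (hq : q.comp (-X) = -q) :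
    Lprime p (parityPair (modePoly lam q)) = ((p * c0 p : ℝ) : ℂ) • parityPair q := by
  refine Energy.ext ?_ ?_
  · rw [Lprime_fst, parityPair_snd, evenPart_modePoly lam hq,
      volterra_polyL2_derivative (eval_zero_of_odd hq)]
    change _ = ((p * c0 p : ℝ) : ℂ) • (parityPair q).fst
    rw [parityPair_fst, oddPart_of_odd hq]
  · rw [Lprime_snd]
    change _ = ((p * c0 p : ℝ) : ℂ) • (parityPair q).snd
    rw [parityPair_snd, evenPart_of_odd hq, map_zero, smul_zero]

theorem modePoly_mem_L_graph (p : ℕ) (lam : ℂ) {q : Polynomial ℂ} (hq : q.comp (-X) = -q)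
    (hode : (1 - X ^ 2) * q.derivative.derivative - (2 * lam) • (X * q.derivative) -
      (lam * (lam - 1) - ((p * c0 p : ℝ) : ℂ)) • q = 0) :
    (parityPair (modePoly lam q), lam • parityPair (modePoly lam q)) ∈ (L p).graph := by
  rw [mem_L_graph, Lprime_modePoly p lam hq]
  refine Submodule.le_topologicalClosure _ ?_
  convert parityPair_mem_freeGraph (modePoly lam q) using 2
  rw [← map_smul, ← map_smul, ← map_sub]
  congr 1
  simp only [modePoly, Polynomial.smul_eq_C_mul, map_sub, map_mul, map_one,
    Polynomial.derivative_add, Polynomial.derivative_mul, Polynomial.derivative_X,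
    Polynomial.derivative_C, Polynomial.derivative_one] at hode ⊢
  simp only [Polynomial.C_ofNat] at hode
  linear_combination -hode

/-! ### Twofold integration -/

/-- Twofold integration of both components. -/
def twofold : Energy →L[ℂ] Energy :=
  (WithLp.prodContinuousLinearEquiv 2 ℂ L2 L2).symm.toContinuousLinearMap.comp
    (((volterraL.comp volterraL).prodMap (volterraL.comp volterraL)).comp
      (WithLp.prodContinuousLinearEquiv 2 ℂ L2 L2).toContinuousLinearMap)

theorem twofold_fst (u : Energy) : (twofold u).fst = volterra (volterra u.fst) := rfl

theorem twofold_snd (u : Energy) : (twofold u).snd = volterra (volterra u.snd) := rfl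

theorem twofold_Lprime (p : ℕ) (u : Energy) :
    twofold (Lprime p u) = Lprime p (twofold u) := by
  refine Energy.ext ?_ ?_
  · rw [twofold_fst, Lprime_fst, Lprime_fst, twofold_snd, map_smul, map_smul]
  · rw [twofold_snd, Lprime_snd, Lprime_snd, map_zero, map_zero]

theorem twofold_parityPair (w : Polynomial ℂ) :
    twofold (parityPair w.derivative.derivative) =
      parityPair (w - C (w.eval 0) - (w.derivative.eval 0) • X) := by
  have h0 : (oddPart w).eval 0 = 0 := by simp [oddPart_apply]
  have h1 : ∀ v : Polynomial ℂ, (evenPart v).eval 0 = v.eval 0 := fun v => by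
    simp [evenPart_apply]
    ring
  have hX : oddPart X = X := oddPart_of_odd (by simp)
  have hX' : evenPart X = 0 := evenPart_of_odd (by simp)
  have hC : ∀ a, oddPart (C a) = 0 := fun a => oddPart_of_even (by simp)
  have hC' : ∀ a, evenPart (C a) = C a := fun a => evenPart_of_even (by simp)
  have hV : ∀ v : Polynomial ℂ, volterra (volterra (polyL2 v.derivative.derivative)) =
      polyL2 (v - C (v.eval 0) - (v.derivative.eval 0) • X) := by
    intro v
    have h2 : v.derivative - C (v.derivative.eval 0) =
        (v - (v.derivative.eval 0) • X).derivative := by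
      simp [Polynomial.smul_eq_C_mul]
    rw [volterra_polyL2, h2, volterra_polyL2]
    congr 1
    simp
    ring
  refine Energy.ext ?_ ?_
  · rw [twofold_fst, parityPair_fst, ← derivative_evenPart, ← derivative_oddPart, hV, h0,
      parityPair_fst, map_sub oddPart, map_sub oddPart, hC, map_smul, hX, derivative_oddPart, h1]
    simp
  · rw [twofold_snd, parityPair_snd, ← derivative_oddPart, ← derivative_evenPart, hV, h1,
      parityPair_snd, map_sub evenPart, map_sub evenPart, hC', map_smul, hX', derivative_evenPart]
    congr 2
    rw [show (oddPart w.derivative).eval 0 = 0 by simp [oddPart_apply]]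
    simp

/-- The functional `(u, v) ↦ ∫ (u₁ + u₂ - v₁ - v₂)`, which takes the value `u₂(0)` on the graph
of `L̃₀`. -/
def traceZero : (Energy × Energy) →L[ℂ] ℂ :=
  (innerSL ℂ (polyL2 1)).comp
    ((WithLp.fstL 2 ℂ L2 L2 + WithLp.sndL 2 ℂ L2 L2).comp
      (ContinuousLinearMap.fst ℂ Energy Energy - ContinuousLinearMap.snd ℂ Energy Energy))

theorem exists_eq_derivative (w : Polynomial ℂ) : ∃ v : Polynomial ℂ, v.derivative = w := by
  induction w using Polynomial.induction_on' with
  | add p q hp hq =>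
    obtain ⟨v, rfl⟩ := hp
    obtain ⟨w, rfl⟩ := hq
    exact ⟨v + w, map_add _ _ _⟩
  | monomial n a =>
    refine ⟨Polynomial.monomial (n + 1) (a / (n + 1)), ?_⟩
    rw [Polynomial.derivative_monomial, Nat.add_sub_cancel]
    congr 1
    push_cast
    exact div_mul_cancel₀ _ (Nat.cast_add_one_ne_zero n)

theorem oddPart_add_evenPart (w : Polynomial ℂ) : oddPart w + evenPart w = w := by
  rw [oddPart_apply, evenPart_apply, ← smul_add, sub_add_add_cancel, ← two_smul ℂ w, smul_smul]
  norm_num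

theorem traceZero_parityPair (w : Polynomial ℂ) :
    traceZero (parityPair w, parityPair ((1 - X) * w.derivative)) = w.eval 0 := by
  set v : Polynomial ℂ := w - (1 - X) * w.derivative with hv
  have h1 : traceZero (parityPair w, parityPair ((1 - X) * w.derivative)) =
      inner ℂ (polyL2 1) ((parityPair w - parityPair ((1 - X) * w.derivative)).fst +
        (parityPair w - parityPair ((1 - X) * w.derivative)).snd) := rfl
  rw [h1, ← map_sub, ← hv, parityPair_fst, parityPair_snd, ← map_add, oddPart_add_evenPart,
    inner_polyL2]
  have h2 : ∫ x : ℝ, (starRingEnd ℂ) ((1 : Polynomial ℂ).eval (x : ℂ)) * polyL2 v x ∂μ01 =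
      ∫ x : ℝ, v.eval (x : ℂ) ∂μ01 := by
    refine integral_congr_ae ?_
    filter_upwards [polyL2_coe v] with x hx
    simp [hx]
  have h3 : ∀ x ∈ uIcc (0 : ℝ) 1, HasDerivAt (fun ρ : ℝ => ((X - 1) * w).eval (ρ : ℂ))
      (v.eval (x : ℂ)) x := fun x _ => by
    have := hasDerivAt_poly ((X - 1) * w) x
    convert! this using 1
    simp [hv]
    ring
  rw [h2, ← integral_Ioc_eq_integral_Ioo, ← intervalIntegral.integral_of_le zero_le_one,
    intervalIntegral.integral_eq_sub_of_hasDerivAt h3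
      (Continuous.intervalIntegrable (by fun_prop) _ _)]
  simp

theorem twofold_mem_freeGraph (z : Polynomial ℂ) :
    (twofold (parityPair z), twofold (parityPair ((1 - X) * z.derivative) -
      (2 : ℂ) • parityPair z) + z.eval 0 • parityPair X) ∈ freeGraph := by
  obtain ⟨z₁, rfl⟩ := exists_eq_derivative z
  obtain ⟨y, rfl⟩ := exists_eq_derivative z₁
  have h1 : (1 - X) * y.derivative.derivative.derivative - (2 : ℂ) • y.derivative.derivative =
      ((1 - X) * y.derivative).derivative.derivative := by
    have : (C 2 : Polynomial ℂ) = 2 := map_ofNat C 2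
    simp [Polynomial.smul_eq_C_mul, this]
    ring
  have h2 : ((1 - X) * y.derivative - C (((1 - X) * y.derivative).eval 0) -
      (((1 - X) * y.derivative).derivative.eval 0) • X + y.derivative.derivative.eval 0 • X) =
      (1 - X) * (y - C (y.eval 0) - (y.derivative.eval 0) • X).derivative := by
    simp [Polynomial.smul_eq_C_mul]
    ring
  rw [← map_smul, ← map_sub, h1, twofold_parityPair, twofold_parityPair, ← map_smul, ← map_add, h2]
  exact parityPair_mem_freeGraph _

/-- The map `(u, v) ↦ (W u, W (v - 2 u) + u₂(0) (ρ, 0))` for the twofold integration `W`. -/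
def twofoldGraphMap : (Energy × Energy) →L[ℂ] (Energy × Energy) :=
  (twofold.comp (.fst ℂ Energy Energy)).prod
    (twofold.comp (.snd ℂ Energy Energy - (2 : ℂ) • .fst ℂ Energy Energy) +
      traceZero.smulRight (parityPair X))

theorem twofoldGraphMap_apply (w : Energy × Energy) : twofoldGraphMap w =
    (twofold w.1, twofold (w.2 - (2 : ℂ) • w.1) + traceZero w • parityPair X) := rfl

theorem twofold_mem_closure {w : Energy × Energy} (hw : w ∈ freeGraph.topologicalClosure) :
    (twofold w.1, twofold (w.2 - (2 : ℂ) • w.1) + traceZero w • parityPair X) ∈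
      freeGraph.topologicalClosure := by
  rw [← twofoldGraphMap_apply]
  have hmaps : MapsTo twofoldGraphMap coreGraph freeGraph := by
    rintro _ ⟨v, rfl⟩
    have e : corePair (-(X * v.derivative)) =
        parityPair ((1 - X) * (v.comp (1 - X)).derivative) := by
      rw [corePair_apply]
      congr 1
      simp [Polynomial.derivative_comp]
    have h := twofold_mem_freeGraph (v.comp (1 - X))
    rw [← traceZero_parityPair, ← e, ← corePair_apply] at h
    exact h
  rw [← closure_coreGraph] at hw
  exact hmaps.closure twofoldGraphMap.continuous hw

theorem twofold_mem_L_graph {p : ℕ} {x z : Energy} (h : (x, z) ∈ (L p).graph) :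
    ∃ m : ℂ, (twofold x, twofold z - (2 : ℂ) • twofold x + m • parityPair X) ∈ (L p).graph := by
  rw [mem_L_graph] at h
  have h1 := twofold_mem_closure h
  refine ⟨traceZero (x, z - Lprime p x), ?_⟩
  rw [mem_L_graph, ← twofold_Lprime]
  convert h1 using 2
  simp only [map_sub, map_smul]
  abel

/-! ### Weak derivatives and primitives -/

theorem denseRange_polyL2 : DenseRange polyL2 := by
  have : (LinearMap.range polyL2).topologicalClosure = ⊤ := by
    rw [Submodule.topologicalClosure_eq_top_iff, Submodule.eq_bot_iff]
    intro f hf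
    rw [Submodule.mem_orthogonal] at hf
    refine L2_eq_zero_of_even fun n => ?_
    have := hf _ ⟨X ^ (2 * n), rfl⟩
    rw [inner_polyL2] at this
    simpa using this
  rw [DenseRange, ← LinearMap.coe_range, Submodule.dense_iff_topologicalClosure_eq_top]
  exact this

/-- The functional `f ↦ ∫ ψ f` for a continuous function `ψ`. -/
theorem exists_pairing {ψ : ℝ → ℝ} (hψ : Continuous ψ) :
    ∃ ℓ : L2 →L[ℂ] ℂ, ∀ f, ℓ f = ∫ x, (ψ x : ℂ) * f x ∂μ01 := by
  have h : MemLp (fun x => (ψ x : ℂ)) 2 μ01 := memLp_of_continuousOn (by fun_prop)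
  refine ⟨innerSL ℂ (h.toLp _), fun f => ?_⟩
  rw [innerSL_apply_apply, L2.inner_def]
  refine integral_congr_ae ?_
  filter_upwards [h.coeFn_toLp] with x hx
  rw [hx, RCLike.inner_apply, mul_comm]
  simp

theorem integral_deriv_mul_primitive {ψ : ℝ → ℝ} (hψ : ContDiff ℝ 1 ψ) (h0 : ψ 0 = 0)
    (h1 : ψ 1 = 0) (f : L2) (a : ℂ) :
    ∫ x, ((deriv ψ x : ℝ) : ℂ) * (volterra f + a • polyL2 1) x ∂μ01 =
      -∫ x, (ψ x : ℂ) * f x ∂μ01 := by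
  obtain ⟨ℓ, hℓ⟩ := exists_pairing (hψ.continuous_deriv le_rfl)
  obtain ⟨m, hm⟩ := exists_pairing hψ.continuous
  rw [← hℓ, ← hm]
  suffices h : (fun f => ℓ (volterraL f + a • polyL2 1)) = fun f => -m f from congrFun h f
  refine denseRange_polyL2.equalizer (by fun_prop) (by fun_prop) (funext fun p => ?_)
  obtain ⟨q, rfl⟩ := exists_eq_derivative p
  simp only [Function.comp_apply]
  rw [volterraL_apply, volterra_polyL2, ← map_smul, ← map_add, hℓ, hm]
  set r := q - C (q.eval 0) + a • 1 with hr
  have e1 : ∫ x, ((deriv ψ x : ℝ) : ℂ) * polyL2 r x ∂μ01 =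
      ∫ x in (0 : ℝ)..1, ((deriv ψ x : ℝ) : ℂ) * r.eval (x : ℂ) := by
    rw [intervalIntegral.integral_of_le zero_le_one, integral_Ioc_eq_integral_Ioo]
    refine integral_congr_ae ?_
    filter_upwards [polyL2_coe r] with x hx
    rw [hx]
  have e2 : ∫ x, (ψ x : ℂ) * polyL2 q.derivative x ∂μ01 =
      ∫ x in (0 : ℝ)..1, (ψ x : ℂ) * r.derivative.eval (x : ℂ) := by
    rw [intervalIntegral.integral_of_le zero_le_one, integral_Ioc_eq_integral_Ioo]
    refine integral_congr_ae ?_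
    filter_upwards [polyL2_coe q.derivative] with x hx
    rw [hx]
    simp [hr]
  have hd : ∀ x ∈ uIcc (0 : ℝ) 1, HasDerivAt (fun x : ℝ => (ψ x : ℂ)) ((deriv ψ x : ℝ) : ℂ) x :=
    fun x _ => ((hψ.differentiable one_ne_zero) x).hasDerivAt.ofReal_comp
  have hdc : Continuous (deriv ψ) := hψ.continuous_deriv le_rfl
  have hψc := hψ.continuous
  have := intervalIntegral.integral_deriv_mul_eq_sub hd
    (fun x _ => hasDerivAt_poly r x) (Continuous.intervalIntegrable (by fun_prop) _ _)
    (Continuous.intervalIntegrable (by fun_prop) _ _)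
  rw [intervalIntegral.integral_add (Continuous.intervalIntegrable (by fun_prop) _ _)
    (Continuous.intervalIntegrable (by fun_prop) _ _), h0, h1]
    at this
  rw [e1, e2, eq_neg_iff_add_eq_zero, this]
  simp

theorem iteratedDeriv_eq_zero_of_notMem {φ : ℝ → ℝ} {n : ℕ} {x : ℝ} (hx : x ∉ tsupport φ) :
    iteratedDeriv n φ x = 0 := by
  have h : φ =ᶠ[𝓝 x] fun _ => 0 := notMem_tsupport_iff_eventuallyEq.1 hx
  rw [h.iteratedDeriv_eq]
  simp

theorem hasWeakDeriv_succ_primitive (n : ℕ) (f : L2) (a : ℂ) :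
    HasWeakDeriv (n + 1) (volterra f + a • polyL2 1) = HasWeakDeriv n f := by
  funext g
  unfold HasWeakDeriv
  refine forall_congr fun φ => propext (forall_congr' fun h1 => forall_congr' fun h2 =>
    forall_congr' fun h3 => ?_)
  have hψ : ContDiff ℝ 1 (iteratedDeriv n φ) := by
    refine ContDiff.iterate_deriv' 1 n (f := φ) ?_ |> (iteratedDeriv_eq_iterate (f := φ) ▸ ·)
    exact h1.of_le (by exact_mod_cast le_top)
  have := integral_deriv_mul_primitive hψ
    (iteratedDeriv_eq_zero_of_notMem fun h => lt_irrefl _ (h3 h).1)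
    (iteratedDeriv_eq_zero_of_notMem fun h => lt_irrefl _ (h3 h).2) f a
  rw [iteratedDeriv_succ, this, pow_succ, mul_neg_one, neg_mul, neg_inj]

theorem weakDeriv_congr {m n : ℕ} {f g : L2} (h : HasWeakDeriv m f = HasWeakDeriv n g) :
    weakDeriv m f = weakDeriv n g := by
  unfold weakDeriv
  generalize HasWeakDeriv m f = P at h ⊢
  subst h
  rfl

theorem weakDeriv_succ_primitive (n : ℕ) (f : L2) (a : ℂ) :
    weakDeriv (n + 1) (volterra f + a • polyL2 1) = weakDeriv n f :=
  weakDeriv_congr (hasWeakDeriv_succ_primitive n f a)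

theorem HasWeakDeriv.unique {n : ℕ} {f g h : L2} (hg : HasWeakDeriv n f g)
    (hh : HasWeakDeriv n f h) : g = h := by
  rw [← sub_eq_zero]
  refine (Lp.eq_zero_iff_ae_eq_zero).2 (eq_zero_of_integral_test_eq_zero (integrable_L2 _)
    fun φ h1 h2 h3 => ?_)
  obtain ⟨ℓ, hℓ⟩ := exists_pairing h1.continuous
  have h4 := hg φ h1 h2 h3
  rw [hh φ h1 h2 h3] at h4
  have h5 := mul_left_cancel₀ (pow_ne_zero n (neg_ne_zero.2 one_ne_zero)) h4
  rw [← hℓ, map_sub, hℓ, hℓ, h5, sub_self]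

theorem hasWeakDeriv_zero (f : L2) : HasWeakDeriv 0 f f := by
  intro φ _ _ _
  simp

theorem weakDeriv_eq {n : ℕ} {f g : L2} (h : HasWeakDeriv n f g) : weakDeriv n f = g := by
  have he : ∃ g, HasWeakDeriv n f g := ⟨g, h⟩
  rw [weakDeriv, dif_pos he]
  exact he.choose_spec.unique h

theorem weakDeriv_zero (f : L2) : weakDeriv 0 f = f := weakDeriv_eq (hasWeakDeriv_zero f)

theorem exists_test_primitive {θ : ℝ → ℝ} (h1 : ContDiff ℝ ∞ θ) (h2 : HasCompactSupport θ)
    (h3 : tsupport θ ⊆ Ioo (0 : ℝ) 1) (h4 : ∫ x in (0 : ℝ)..1, θ x = 0) :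
    ∃ φ : ℝ → ℝ, ContDiff ℝ ∞ φ ∧ HasCompactSupport φ ∧ tsupport φ ⊆ Ioo (0 : ℝ) 1 ∧
      deriv φ = θ := by
  set K := tsupport θ ∪ {1 / 2} with hK
  have hKc : IsCompact K := IsCompact.union h2 isCompact_singleton
  have hKn : K.Nonempty := ⟨1 / 2, Or.inr rfl⟩
  have hK01 : K ⊆ Ioo 0 1 := by
    refine union_subset h3 ?_
    rintro _ rfl
    norm_num
  obtain ⟨a, haK, ha⟩ := hKc.exists_isLeast hKn
  obtain ⟨b, hbK, hb⟩ := hKc.exists_isGreatest hKn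
  have hzero : ∀ x, x ∉ Icc a b → θ x = 0 := fun x hx =>
    image_eq_zero_of_notMem_tsupport fun h => hx ⟨ha (Or.inl h), hb (Or.inl h)⟩
  have hint : ∀ c d, IntervalIntegrable θ volume c d := fun c d =>
    h1.continuous.intervalIntegrable c d
  set φ : ℝ → ℝ := fun x => ∫ t in (0 : ℝ)..x, θ t with hφ
  have hd : ∀ x, HasDerivAt φ (θ x) x := fun x =>
    h1.continuous.integral_hasStrictDerivAt 0 x |>.hasDerivAt
  have hderiv : deriv φ = θ := funext fun x => (hd x).deriv
  have hout : ∀ x, x ∉ Icc a b → φ x = 0 := by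
    intro x hx
    rcases lt_or_ge x a with hxa | hxa
    · refine intervalIntegral.integral_zero_ae (Eventually.of_forall fun t ht => hzero t ?_)
      intro htm
      have : t ≤ max 0 x := ht.2
      exact absurd (htm.1.trans this) (not_le.2 (max_lt (hK01 haK).1 hxa))
    · have hxb : b < x := not_le.1 fun h => hx ⟨hxa, h⟩
      have : φ x = (∫ t in (0 : ℝ)..1, θ t) + ∫ t in (1 : ℝ)..x, θ t :=
        (intervalIntegral.integral_add_adjacent_intervals (hint _ _) (hint _ _)).symm
      rw [this, h4, zero_add]
      refine intervalIntegral.integral_zero_ae (Eventually.of_forall fun t ht => hzero t ?_)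
      intro htm
      have h5 : min 1 x < t := ht.1
      exact absurd (h5.trans_le htm.2) (not_lt.2 (le_min (hK01 hbK).2.le hxb.le))
  have hsub : tsupport φ ⊆ Icc a b :=
    closure_minimal (fun x hx => by_contra fun h => hx (hout x h)) isClosed_Icc
  refine ⟨φ, ?_, HasCompactSupport.intro isCompact_Icc hout,
    hsub.trans (Icc_subset_Ioo (hK01 haK).1 (hK01 hbK).2), hderiv⟩
  rw [contDiff_infty_iff_deriv, hderiv]
  exact ⟨fun x => (hd x).differentiableAt, h1⟩

/-- The lemma of du Bois-Reymond. -/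
theorem eq_const_of_hasWeakDeriv_zero {f : L2} (h : HasWeakDeriv 1 f 0) :
    ∃ a : ℂ, f = a • polyL2 1 := by
  let b : ContDiffBump (1 / 2 : ℝ) := ⟨1 / 8, 1 / 4, by norm_num, by norm_num⟩
  set η : ℝ → ℝ := b.normed volume with hη
  have hη1 : ContDiff ℝ ∞ η := b.contDiff_normed
  have hη2 : HasCompactSupport η := b.hasCompactSupport_normed
  have hη3 : tsupport η ⊆ Ioo (0 : ℝ) 1 := by
    rw [hη, b.tsupport_normed_eq, Real.closedBall_eq_Icc]
    exact Icc_subset_Ioo (by norm_num [b]) (by norm_num [b])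
  have hη4 : ∫ x in (0 : ℝ)..1, η x = 1 := by
    rw [intervalIntegral.integral_of_le zero_le_one,
      setIntegral_eq_integral_of_forall_compl_eq_zero, b.integral_normed]
    exact fun x hx => image_eq_zero_of_notMem_tsupport fun hh =>
      hx (Ioo_subset_Ioc_self (hη3 hh))
  obtain ⟨ℓη, hℓη⟩ := exists_pairing hη1.continuous
  refine ⟨ℓη f, ?_⟩
  rw [← sub_eq_zero]
  refine (Lp.eq_zero_iff_ae_eq_zero).2 (eq_zero_of_integral_test_eq_zero (integrable_L2 _)
    fun ψ h1 h2 h3 => ?_)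
  set m := ∫ x in (0 : ℝ)..1, ψ x with hm
  obtain ⟨φ, hφ1, hφ2, hφ3, hφ4⟩ := exists_test_primitive (θ := fun x => ψ x - m * η x)
    (h1.sub (contDiff_const.mul hη1)) (h2.sub (hη2.mul_left))
    ((tsupport_sub _ _).trans (union_subset h3 ((tsupport_mul_subset_right).trans hη3)))
    (by
      have hc1 := h1.continuous
      have hc2 := hη1.continuous
      rw [intervalIntegral.integral_sub (Continuous.intervalIntegrable (by fun_prop) _ _)
        (Continuous.intervalIntegrable (by fun_prop) _ _), intervalIntegral.integral_const_mul,
        hη4, mul_one, sub_self])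
  obtain ⟨ℓψ, hℓψ⟩ := exists_pairing h1.continuous
  have h5 := h φ hφ1 hφ2 hφ3
  have h6 : ∫ x, (φ x : ℂ) * (0 : L2) x ∂μ01 = 0 := by
    obtain ⟨ℓφ, hℓφ⟩ := exists_pairing hφ1.continuous
    rw [← hℓφ, map_zero]
  rw [h6, mul_zero, iteratedDeriv_one, hφ4] at h5
  have h7 : ℓψ f - m * ℓη f = 0 := by
    rw [← h5, hℓψ, hℓη, ← integral_const_mul, ← integral_sub]
    · congr 1
      ext x
      push_cast
      ring
    · have := h1.continuous
      exact integrable_mul_L2 (by fun_prop) f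
    · have := hη1.continuous
      exact (integrable_mul_L2 (by fun_prop) f).const_mul _
  have h8 : ℓψ (polyL2 1) = m := by
    rw [hℓψ, hm, ← intervalIntegral.integral_ofReal,
      intervalIntegral.integral_of_le zero_le_one, integral_Ioc_eq_integral_Ioo]
    refine integral_congr_ae ?_
    filter_upwards [polyL2_coe 1] with x hx
    rw [hx]
    simp
  rw [← hℓψ, map_sub, map_smul, h8, smul_eq_mul, mul_comm, h7]

theorem exists_eq_primitive {f g : L2} (h : HasWeakDeriv 1 f g) :
    ∃ a : ℂ, f = volterra g + a • polyL2 1 := by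
  have h1 : HasWeakDeriv 1 (f - volterra g) 0 := by
    intro φ h1 h2 h3
    have hc : Continuous (iteratedDeriv 1 φ) := by
      rw [iteratedDeriv_one]
      exact (h1.of_le (by exact_mod_cast le_top) : ContDiff ℝ 1 φ).continuous_deriv le_rfl
    obtain ⟨ℓ, hℓ⟩ := exists_pairing hc
    obtain ⟨m, hm⟩ := exists_pairing h1.continuous
    have h4 := h φ h1 h2 h3
    have h5 : HasWeakDeriv 1 (volterra g + (0 : ℂ) • polyL2 1) g := by
      rw [hasWeakDeriv_succ_primitive]
      exact hasWeakDeriv_zero g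
    rw [zero_smul, add_zero] at h5
    have h6 := h5 φ h1 h2 h3
    rw [← hℓ] at h4 h6
    rw [← hℓ, ← hm, map_sub, h4, h6, sub_self, map_zero, mul_zero]
  obtain ⟨a, ha⟩ := eq_const_of_hasWeakDeriv_zero h1
  exact ⟨a, by rw [← ha]; abel⟩

theorem memSobolev_succ_iff {m : ℕ} {f : L2} : MemSobolev (m + 1) f ↔
    ∃ (g : L2) (a : ℂ), f = volterra g + a • polyL2 1 ∧ MemSobolev m g := by
  constructor
  · intro h
    obtain ⟨g, hg⟩ := h 1 (by omega)
    obtain ⟨a, rfl⟩ := exists_eq_primitive hg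
    refine ⟨g, a, rfl, fun n hn => ?_⟩
    obtain ⟨g', hg'⟩ := h (n + 1) (by omega)
    rw [hasWeakDeriv_succ_primitive] at hg'
    exact ⟨g', hg'⟩
  · rintro ⟨g, a, rfl, hg⟩ n hn
    rcases n with _ | n
    · exact ⟨_, hasWeakDeriv_zero _⟩
    · rw [hasWeakDeriv_succ_primitive]
      exact hg n (by omega)

theorem vanishesAtZero_primitive_iff (g : L2) (a : ℂ) :
    VanishesAtZero (volterra g + a • polyL2 1) ↔ a = 0 := by
  set G : ℝ → ℂ := fun ρ => (∫ ξ in (0 : ℝ)..ρ, g ξ) + a with hG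
  have hGc : ContinuousOn G (Icc 0 1) := by
    have hI := L2_intervalIntegrable g 1 (by simp)
    have := intervalIntegral.continuousOn_primitive_interval (μ := volume) (a := 0) (b := 1)
      (f := g) (by
        rw [uIcc_of_le zero_le_one, integrableOn_Icc_iff_integrableOn_Ioc]
        exact (intervalIntegrable_iff_integrableOn_Ioc_of_le zero_le_one).1 hI)
    rw [uIcc_of_le zero_le_one] at this
    exact this.add continuousOn_const
  have hGe : (volterra g + a • polyL2 1 : L2) =ᵐ[μ01] G := by
    filter_upwards [Lp.coeFn_add (volterra g) (a • polyL2 1), volterra_coe g,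
      Lp.coeFn_smul a (polyL2 1), polyL2_coe 1] with x h1 h2 h3 h4
    rw [h1, Pi.add_apply, h2, h3, Pi.smul_apply, h4]
    simp [hG]
  have hG0 : G 0 = a := by simp [hG]
  constructor
  · rintro ⟨F, hF, hFe, hF0⟩
    have h1 : EqOn F G (Ioo 0 1) := Measure.eqOn_open_of_ae_eq (hFe.symm.trans hGe) isOpen_Ioo
      (hF.mono Ioo_subset_Icc_self) (hGc.mono Ioo_subset_Icc_self)
    have h2 : EqOn F G (Icc 0 1) := h1.of_subset_closure hF hGc Ioo_subset_Icc_self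
      (by rw [closure_Ioo (zero_ne_one)])
    rw [← hG0, ← h2 ⟨le_rfl, zero_le_one⟩, hF0]
  · rintro rfl
    exact ⟨G, hGc, hGe, hG0⟩

/-! ### The structure of `𝓗^{2k}` -/

/-- The space of all pairs `(bρ, a)`, the kernel of `D²` in `𝓗²`. -/
def lowPairs : Submodule ℂ Energy := Submodule.span ℂ {parityPair 1, parityPair X}

theorem mem_lowPairs {u : Energy} :
    u ∈ lowPairs ↔ ∃ a b : ℂ, a • parityPair 1 + b • parityPair X = u :=
  Submodule.mem_span_pair

theorem one_comp_neg_X : (1 : Polynomial ℂ).comp (-X) = 1 := by simp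

theorem X_comp_neg_X : (X : Polynomial ℂ).comp (-X) = -X := by simp

theorem volterra_one : volterra (polyL2 1) = polyL2 X := by
  have := volterra_polyL2 X
  simpa using this

theorem add_lowPairs_fst (v : Energy) (a b : ℂ) :
    (twofold v + (a • parityPair 1 + b • parityPair X)).fst =
      volterra (volterra v.fst + b • polyL2 1) + (0 : ℂ) • polyL2 1 := by
  change (twofold v).fst + (a • (parityPair 1).fst + b • (parityPair X).fst) = _
  rw [twofold_fst, parityPair_fst, parityPair_fst, oddPart_of_even one_comp_neg_X,
    oddPart_of_odd X_comp_neg_X, map_add, map_smul, volterra_one]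
  simp

theorem add_lowPairs_snd (v : Energy) (a b : ℂ) :
    (twofold v + (a • parityPair 1 + b • parityPair X)).snd =
      volterra (volterra v.snd + (0 : ℂ) • polyL2 1) + a • polyL2 1 := by
  change (twofold v).snd + (a • (parityPair 1).snd + b • (parityPair X).snd) = _
  rw [twofold_snd, parityPair_snd, parityPair_snd, evenPart_of_even one_comp_neg_X,
    evenPart_of_odd X_comp_neg_X]
  simp

theorem H2k_zero (u : Energy) : u ∈ H2k 0 := by
  have h : ∀ f, MemSobolev (2 * 0) f := fun f n hn => by
    obtain rfl : n = 0 := by omega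
    exact ⟨f, hasWeakDeriv_zero f⟩
  exact ⟨h _, h _, fun j hj => absurd hj (by omega)⟩

theorem D2k_zero (u : Energy) : D2k 0 u = u :=
  Energy.ext (weakDeriv_zero _) (weakDeriv_zero _)

theorem D2k_succ (k : ℕ) (v : Energy) {n : Energy} (hn : n ∈ lowPairs) :
    D2k (k + 1) (twofold v + n) = D2k k v := by
  obtain ⟨a, b, rfl⟩ := mem_lowPairs.1 hn
  unfold D2k
  rw [add_lowPairs_fst, add_lowPairs_snd, show 2 * (k + 1) = 2 * k + 1 + 1 by ring]
  simp only [weakDeriv_succ_primitive]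

theorem mem_H2k_succ {k : ℕ} {u : Energy} : u ∈ H2k (k + 1) ↔
    ∃ v ∈ H2k k, ∃ n ∈ lowPairs, u = twofold v + n := by
  have h2 : 2 * (k + 1) = 2 * k + 1 + 1 := by ring
  constructor
  · rintro ⟨h1, h3, h4⟩
    rw [h2, memSobolev_succ_iff] at h1 h3
    obtain ⟨f₁, a₁, hf, hf₁⟩ := h1
    obtain ⟨g₁, b₁, hg, hg₁⟩ := h3
    rw [memSobolev_succ_iff] at hf₁ hg₁
    obtain ⟨f₂, a₂, rfl, hf₂⟩ := hf₁
    obtain ⟨g₂, b₂, rfl, hg₂⟩ := hg₁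
    rw [hf, hg] at h4
    have h5 := h4 0 (by omega)
    rw [Nat.mul_zero, weakDeriv_zero, vanishesAtZero_primitive_iff, weakDeriv_succ_primitive,
      weakDeriv_zero, vanishesAtZero_primitive_iff] at h5
    refine ⟨WithLp.toLp 2 (f₂, g₂), ⟨hf₂, hg₂, fun j hj => ?_⟩, b₁ • parityPair 1 +
      a₂ • parityPair X, mem_lowPairs.2 ⟨_, _, rfl⟩, Energy.ext ?_ ?_⟩
    · have h6 := h4 (j + 1) (by omega)
      rw [show 2 * (j + 1) = 2 * j + 1 + 1 by ring] at h6
      simp only [weakDeriv_succ_primitive] at h6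
      exact h6
    · rw [hf, add_lowPairs_fst, h5.1]
      rfl
    · rw [hg, add_lowPairs_snd, h5.2]
      rfl
  · rintro ⟨v, ⟨h1, h3, h4⟩, n, hn, rfl⟩
    obtain ⟨a, b, rfl⟩ := mem_lowPairs.1 hn
    refine ⟨?_, ?_, fun j hj => ?_⟩
    · rw [add_lowPairs_fst, h2, memSobolev_succ_iff]
      exact ⟨_, _, rfl, memSobolev_succ_iff.2 ⟨_, _, rfl, h1⟩⟩
    · rw [add_lowPairs_snd, h2, memSobolev_succ_iff]
      exact ⟨_, _, rfl, memSobolev_succ_iff.2 ⟨_, _, rfl, h3⟩⟩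
    · rw [add_lowPairs_fst, add_lowPairs_snd]
      rcases j with _ | j
      · rw [Nat.mul_zero, weakDeriv_zero, vanishesAtZero_primitive_iff, weakDeriv_succ_primitive,
          weakDeriv_zero, vanishesAtZero_primitive_iff]
        exact ⟨rfl, rfl⟩
      · rw [show 2 * (j + 1) = 2 * j + 1 + 1 by ring]
        simpa only [weakDeriv_succ_primitive] using h4 j (by omega)

/-! ### Linear structure and norms of `𝓗^{2k}` -/

theorem mem_H2k_one {u : Energy} : u ∈ H2k 1 ↔ ∃ v, ∃ n ∈ lowPairs, u = twofold v + n := by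
  rw [mem_H2k_succ]
  simp [H2k_zero]

theorem D2k_one_eq (v : Energy) {n : Energy} (hn : n ∈ lowPairs) :
    D2k 1 (twofold v + n) = v := by
  rw [D2k_succ 0 v hn, D2k_zero]

theorem H2k_succ_subset_one {k : ℕ} {u : Energy} (hu : u ∈ H2k (k + 1)) : u ∈ H2k 1 := by
  obtain ⟨v, -, n, hn, rfl⟩ := mem_H2k_succ.1 hu
  exact mem_H2k_one.2 ⟨v, n, hn, rfl⟩

theorem mem_H2k_succ_iff {k : ℕ} {u : Energy} :
    u ∈ H2k (k + 1) ↔ u ∈ H2k 1 ∧ D2k 1 u ∈ H2k k := by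
  constructor
  · intro hu
    refine ⟨H2k_succ_subset_one hu, ?_⟩
    obtain ⟨v, hv, n, hn, rfl⟩ := mem_H2k_succ.1 hu
    rwa [D2k_one_eq v hn]
  · rintro ⟨h1, h2⟩
    obtain ⟨v, n, hn, rfl⟩ := mem_H2k_one.1 h1
    rw [D2k_one_eq v hn] at h2
    exact mem_H2k_succ.2 ⟨v, h2, n, hn, rfl⟩

theorem sub_twofold_mem_lowPairs {u : Energy} (hu : u ∈ H2k 1) :
    u - twofold (D2k 1 u) ∈ lowPairs := by
  obtain ⟨v, n, hn, rfl⟩ := mem_H2k_one.1 hu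
  rw [D2k_one_eq v hn, add_sub_cancel_left]
  exact hn

theorem D2k_succ_eq (k : ℕ) {u : Energy} (hu : u ∈ H2k 1) :
    D2k (k + 1) u = D2k k (D2k 1 u) := by
  obtain ⟨v, n, hn, rfl⟩ := mem_H2k_one.1 hu
  rw [D2k_one_eq v hn, D2k_succ k v hn]

theorem H2k_one_combination {u v : Energy} (hu : u ∈ H2k 1) (hv : v ∈ H2k 1) (a b : ℂ) :
    a • u + b • v ∈ H2k 1 ∧ D2k 1 (a • u + b • v) = a • D2k 1 u + b • D2k 1 v := by
  obtain ⟨u', m, hm, rfl⟩ := mem_H2k_one.1 hu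
  obtain ⟨v', n, hn, rfl⟩ := mem_H2k_one.1 hv
  have e : a • (twofold u' + m) + b • (twofold v' + n) =
      twofold (a • u' + b • v') + (a • m + b • n) := by
    rw [map_add, map_smul, map_smul, smul_add, smul_add]
    abel
  have hmn : a • m + b • n ∈ lowPairs :=
    add_mem (lowPairs.smul_mem _ hm) (lowPairs.smul_mem _ hn)
  refine ⟨mem_H2k_one.2 ⟨_, _, hmn, e⟩, ?_⟩
  rw [e, D2k_one_eq _ hmn, D2k_one_eq _ hm, D2k_one_eq _ hn]

theorem H2k_combination {k : ℕ} {u v : Energy} (hu : u ∈ H2k k) (hv : v ∈ H2k k) (a b : ℂ) :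
    a • u + b • v ∈ H2k k ∧ D2k k (a • u + b • v) = a • D2k k u + b • D2k k v := by
  induction k generalizing u v with
  | zero => exact ⟨H2k_zero _, by simp only [D2k_zero]⟩
  | succ k ih =>
    rw [mem_H2k_succ_iff] at hu hv
    obtain ⟨h1, h2⟩ := H2k_one_combination hu.1 hv.1 a b
    obtain ⟨h3, h4⟩ := ih hu.2 hv.2
    exact ⟨mem_H2k_succ_iff.2 ⟨h1, by rwa [h2]⟩, by
      rw [D2k_succ_eq k h1, h2, h4, D2k_succ_eq k hu.1, D2k_succ_eq k hv.1]⟩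

theorem H2k_zero_mem (k : ℕ) : (0 : Energy) ∈ H2k k := by
  induction k with
  | zero => exact H2k_zero _
  | succ k ih => exact mem_H2k_succ.2 ⟨0, ih, 0, zero_mem _, by simp⟩

/-- The space `𝓗^{2k}` as a subspace of the energy space. -/
def sobolev (k : ℕ) : Submodule ℂ Energy where
  carrier := H2k k
  add_mem' {u v} hu hv := by simpa using (H2k_combination hu hv 1 1).1
  zero_mem' := H2k_zero_mem k
  smul_mem' c u hu := by simpa using (H2k_combination hu hu c 0).1

/-- `D^{2k}` as a linear map on `𝓗^{2k}`. -/
def D2kLinear (k : ℕ) : sobolev k →ₗ[ℂ] Energy where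
  toFun u := D2k k u
  map_add' u v := by simpa using (H2k_combination u.2 v.2 1 1).2
  map_smul' c u := by simpa using (H2k_combination u.2 u.2 c 0).2

theorem D2k_add {k : ℕ} {u v : Energy} (hu : u ∈ H2k k) (hv : v ∈ H2k k) :
    D2k k (u + v) = D2k k u + D2k k v := (D2kLinear k).map_add ⟨u, hu⟩ ⟨v, hv⟩

theorem D2k_sub {k : ℕ} {u v : Energy} (hu : u ∈ H2k k) (hv : v ∈ H2k k) :
    D2k k (u - v) = D2k k u - D2k k v := (D2kLinear k).map_sub ⟨u, hu⟩ ⟨v, hv⟩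

theorem D2k_smul {k : ℕ} {u : Energy} (c : ℂ) (hu : u ∈ H2k k) :
    D2k k (c • u) = c • D2k k u := (D2kLinear k).map_smul c ⟨u, hu⟩

theorem D2k_sum {k : ℕ} {ι : Type*} (s : Finset ι) {u : ι → Energy}
    (hu : ∀ i ∈ s, u i ∈ H2k k) : D2k k (∑ i ∈ s, u i) = ∑ i ∈ s, D2k k (u i) := by
  classical
  induction s using Finset.induction_on with
  | empty =>
    rw [Finset.sum_empty, Finset.sum_empty]
    exact (D2kLinear k).map_zero
  | insert i s hi ih =>
    rw [Finset.sum_insert hi, Finset.sum_insert hi, D2k_add (hu i (by simp))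
      ((sobolev k).sum_mem (t := s) fun j hj => hu j (Finset.mem_insert_of_mem hj)),
      ih fun j hj => hu j (by simp [hj])]

theorem H2k_succ_subset (k : ℕ) : H2k (k + 1) ⊆ H2k k := by
  induction k with
  | zero => exact fun u _ => H2k_zero u
  | succ k ih =>
    intro u hu
    rw [mem_H2k_succ_iff] at hu ⊢
    exact ⟨hu.1, ih hu.2⟩

theorem H2k_antitone : Antitone H2k := antitone_nat_of_succ_le H2k_succ_subset

theorem lowPairs_subset {n : Energy} (hn : n ∈ lowPairs) (k : ℕ) : n ∈ H2k (k + 1) :=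
  mem_H2k_succ.2 ⟨0, H2k_zero_mem k, n, hn, by simp⟩

theorem D2k_one_lowPairs {n : Energy} (hn : n ∈ lowPairs) : D2k 1 n = 0 := by
  have := D2k_one_eq 0 hn
  rwa [map_zero, zero_add] at this

/-- The sum of the energy norms of all even derivatives of order at most `2k`. -/
def fullNorm (k : ℕ) (u : Energy) : ℝ := ∑ i ∈ Finset.range (k + 1), ‖D2k i u‖

theorem fullNorm_nonneg (k : ℕ) (u : Energy) : 0 ≤ fullNorm k u :=
  Finset.sum_nonneg fun _ _ => norm_nonneg _

theorem fullNorm_zero (u : Energy) : fullNorm 0 u = ‖u‖ := by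
  rw [fullNorm, zero_add, Finset.sum_range_one, D2k_zero]

theorem fullNorm_succ (k : ℕ) {u : Energy} (hu : u ∈ H2k 1) :
    fullNorm (k + 1) u = ‖u‖ + fullNorm k (D2k 1 u) := by
  rw [fullNorm, Finset.sum_range_succ', D2k_zero, add_comm]
  exact congrArg (‖u‖ + ·) (Finset.sum_congr rfl fun i _ => by rw [D2k_succ_eq i hu])

theorem norm_le_fullNorm (k : ℕ) (u : Energy) : ‖u‖ ≤ fullNorm k u := by
  have := Finset.single_le_sum (f := fun i => ‖D2k i u‖) (fun _ _ => norm_nonneg _)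
    (Finset.mem_range.2 (Nat.succ_pos k))
  beta_reduce at this
  rw [D2k_zero] at this
  exact this

theorem fullNorm_add_le {k : ℕ} {u v : Energy} (hu : u ∈ H2k k) (hv : v ∈ H2k k) :
    fullNorm k (u + v) ≤ fullNorm k u + fullNorm k v := by
  rw [fullNorm, fullNorm, fullNorm, ← Finset.sum_add_distrib]
  refine Finset.sum_le_sum fun i hi => ?_
  have hik : i ≤ k := by simpa [Nat.lt_succ_iff] using hi
  rw [D2k_add (H2k_antitone hik hu) (H2k_antitone hik hv)]
  exact norm_add_le _ _

theorem fullNorm_smul {k : ℕ} {u : Energy} (c : ℂ) (hu : u ∈ H2k k) :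
    fullNorm k (c • u) = ‖c‖ * fullNorm k u := by
  rw [fullNorm, fullNorm, Finset.mul_sum]
  refine Finset.sum_congr rfl fun i hi => ?_
  have hik : i ≤ k := by simpa [Nat.lt_succ_iff] using hi
  rw [D2k_smul c (H2k_antitone hik hu), norm_smul]

theorem fullNorm_sum_le {k : ℕ} {ι : Type*} (s : Finset ι) {u : ι → Energy}
    (hu : ∀ i ∈ s, u i ∈ H2k k) : fullNorm k (∑ i ∈ s, u i) ≤ ∑ i ∈ s, fullNorm k (u i) := by
  classical
  induction s using Finset.induction_on with
  | empty =>
    have := fullNorm_smul 0 (H2k_zero_mem k)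
    simpa using this.le
  | insert i s hi ih =>
    rw [Finset.sum_insert hi, Finset.sum_insert hi]
    refine (fullNorm_add_le (hu i (by simp)) ((sobolev k).sum_mem (t := s)
      fun j hj => hu j (Finset.mem_insert_of_mem hj))).trans ?_
    gcongr
    exact ih fun j hj => hu j (by simp [hj])

theorem fullNorm_sub_le {k : ℕ} {u v : Energy} (hu : u ∈ H2k k) (hv : v ∈ H2k k) :
    fullNorm k (u - v) ≤ fullNorm k u + fullNorm k v := by
  have h1 := fullNorm_smul (-1) hv
  have h2 := fullNorm_add_le hu ((sobolev k).smul_mem (-1) hv)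
  rw [h1] at h2
  simpa [sub_eq_add_neg] using h2

theorem normH2k_nonneg (k : ℕ) (u : Energy) : 0 ≤ normH2k k u := Real.sqrt_nonneg _

theorem norm_le_normH2k (k : ℕ) (u : Energy) : ‖u‖ ≤ normH2k k u :=
  Real.le_sqrt_of_sq_le (le_add_of_nonneg_right (sq_nonneg _))

theorem norm_D2k_le_normH2k (k : ℕ) (u : Energy) : ‖D2k k u‖ ≤ normH2k k u :=
  Real.le_sqrt_of_sq_le (le_add_of_nonneg_left (sq_nonneg _))

theorem normH2k_smul {k : ℕ} {u : Energy} (c : ℂ) (hu : u ∈ H2k k) :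
    normH2k k (c • u) = ‖c‖ * normH2k k u := by
  rw [normH2k, normH2k, D2k_smul c hu, norm_smul, norm_smul, mul_pow, mul_pow, ← mul_add,
    Real.sqrt_mul (sq_nonneg _), Real.sqrt_sq (norm_nonneg _)]

theorem normH2k_le_fullNorm (k : ℕ) (u : Energy) : normH2k k u ≤ 2 * fullNorm k u := by
  have h1 := norm_le_fullNorm k u
  have h2 : ‖D2k k u‖ ≤ fullNorm k u :=
    Finset.single_le_sum (f := fun i => ‖D2k i u‖) (fun _ _ => norm_nonneg _)
      (Finset.mem_range.2 (Nat.lt_succ_self k))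
  refine Real.sqrt_le_iff.2 ⟨by linarith [fullNorm_nonneg k u], ?_⟩
  nlinarith [norm_nonneg u, norm_nonneg (D2k k u)]

/-- The kernel of `D^{2k}` in `𝓗^{2k}`. -/
def derivKernel (k : ℕ) : Submodule ℂ Energy :=
  (LinearMap.ker (D2kLinear k)).map (sobolev k).subtype

theorem mem_derivKernel {k : ℕ} {u : Energy} :
    u ∈ derivKernel k ↔ u ∈ H2k k ∧ D2k k u = 0 := by
  constructor
  · rintro ⟨v, hv, rfl⟩
    exact ⟨v.2, hv⟩
  · rintro ⟨h1, h2⟩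
    exact ⟨⟨u, h1⟩, h2, rfl⟩

instance finiteDimensional_lowPairs : FiniteDimensional ℂ lowPairs :=
  FiniteDimensional.span_of_finite ℂ (by simp)

instance finiteDimensional_derivKernel (k : ℕ) : FiniteDimensional ℂ (derivKernel k) := by
  induction k with
  | zero =>
    have : derivKernel 0 = ⊥ := by
      rw [Submodule.eq_bot_iff]
      intro u hu
      rw [mem_derivKernel, D2k_zero] at hu
      exact hu.2
    rw [this]
    infer_instance
  | succ k ih =>
    have h : derivKernel (k + 1) ≤ (derivKernel k).map twofold.toLinearMap ⊔ lowPairs := by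
      intro u hu
      rw [mem_derivKernel] at hu
      obtain ⟨hu1, hu2⟩ := hu
      obtain ⟨v, hv, n, hn, rfl⟩ := mem_H2k_succ.1 hu1
      rw [D2k_succ k v hn] at hu2
      exact Submodule.add_mem_sup ⟨v, mem_derivKernel.2 ⟨hv, hu2⟩, rfl⟩ hn
    exact Submodule.finiteDimensional_of_le h

theorem twofold_pow_mem (k : ℕ) (v : Energy) : (twofold ^ k) v ∈ H2k k := by
  induction k with
  | zero => exact H2k_zero _
  | succ k ih =>
    rw [pow_succ', mul_apply_eq_comp]
    exact mem_H2k_succ.2 ⟨_, ih, 0, zero_mem _, by simp⟩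

theorem D2k_twofold_pow {i k : ℕ} (hik : i ≤ k) (v : Energy) :
    D2k i ((twofold ^ k) v) = (twofold ^ (k - i)) v := by
  induction i generalizing k with
  | zero => rw [D2k_zero, Nat.sub_zero]
  | succ i ih =>
    obtain ⟨k, rfl⟩ : ∃ m, k = m + 1 := ⟨k - 1, by omega⟩
    rw [pow_succ', mul_apply_eq_comp]
    have := D2k_succ i ((twofold ^ k) v) (zero_mem lowPairs)
    rw [add_zero] at this
    rw [this, ih (by omega), Nat.add_sub_add_right]

theorem exists_fullNorm_le (k : ℕ) :
    ∃ K > 0, ∀ u ∈ H2k k, fullNorm k u ≤ K * normH2k k u := by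
  have h : ∀ i ≤ k, ∃ K ≥ 0, ∀ u ∈ H2k k, ‖D2k i u‖ ≤ K * normH2k k u := by
    intro i hik
    set Λ : derivKernel k →ₗ[ℂ] Energy := D2kLinear i ∘ₗ
      Submodule.inclusion (p := derivKernel k) (p' := sobolev i)
        (fun u hu => H2k_antitone hik (mem_derivKernel.1 hu).1) with hΛ
    set M := ‖LinearMap.toContinuousLinearMap Λ‖
    have hM : ∀ w ∈ derivKernel k, ‖D2k i w‖ ≤ M * ‖w‖ := fun w hw =>
      (LinearMap.toContinuousLinearMap Λ).le_opNorm ⟨w, hw⟩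
    refine ⟨M * (1 + ‖twofold ^ k‖) + ‖twofold ^ (k - i)‖, by positivity, fun u hu => ?_⟩
    set v := D2k k u with hv
    have hw : u - (twofold ^ k) v ∈ derivKernel k := by
      refine mem_derivKernel.2 ⟨(sobolev k).sub_mem hu (twofold_pow_mem k v), ?_⟩
      rw [D2k_sub hu (twofold_pow_mem k v), D2k_twofold_pow le_rfl, Nat.sub_self, pow_zero, ← hv]
      simp
    have e : D2k i u = D2k i (u - (twofold ^ k) v) + (twofold ^ (k - i)) v := by
      rw [← D2k_twofold_pow hik, ← D2k_add (H2k_antitone hik (mem_derivKernel.1 hw).1)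
        (H2k_antitone hik (twofold_pow_mem k v)), sub_add_cancel]
    have h1 := norm_le_normH2k k u
    have h2 : ‖v‖ ≤ normH2k k u := norm_D2k_le_normH2k k u
    have h3 : ‖u - (twofold ^ k) v‖ ≤ (1 + ‖twofold ^ k‖) * normH2k k u := by
      calc ‖u - (twofold ^ k) v‖ ≤ ‖u‖ + ‖twofold ^ k‖ * ‖v‖ :=
            (norm_sub_le _ _).trans (by gcongr; exact (twofold ^ k).le_opNorm v)
        _ ≤ normH2k k u + ‖twofold ^ k‖ * normH2k k u := by gcongr
        _ = _ := by ring
    calc ‖D2k i u‖ ≤ ‖D2k i (u - (twofold ^ k) v)‖ + ‖(twofold ^ (k - i)) v‖ := by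
          rw [e]; exact norm_add_le _ _
      _ ≤ M * ‖u - (twofold ^ k) v‖ + ‖twofold ^ (k - i)‖ * ‖v‖ :=
          add_le_add (hM _ hw) ((twofold ^ (k - i)).le_opNorm v)
      _ ≤ M * ((1 + ‖twofold ^ k‖) * normH2k k u) + ‖twofold ^ (k - i)‖ * normH2k k u := by
          gcongr
      _ = _ := by ring
  choose! K hK0 hK using h
  refine ⟨∑ i ∈ Finset.range (k + 1), K i + 1, ?_, fun u hu => ?_⟩
  · have : 0 ≤ ∑ i ∈ Finset.range (k + 1), K i :=
      Finset.sum_nonneg fun i hi => hK0 i (by simpa [Nat.lt_succ_iff] using hi)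
    linarith
  · rw [fullNorm, add_mul, Finset.sum_mul]
    have : ∑ i ∈ Finset.range (k + 1), ‖D2k i u‖ ≤
        ∑ i ∈ Finset.range (k + 1), K i * normH2k k u :=
      Finset.sum_le_sum fun i hi => hK i (by simpa [Nat.lt_succ_iff] using hi) u hu
    linarith [normH2k_nonneg k u]

/-! ### The eigenvalues and the lowest eigenfunctions -/

/-- The eigenvalues `λ_j^±`, with the sign given by a Boolean. -/
def modeRate (p : ℕ) (b : Bool) (j : ℕ) : ℝ := bif b then lamPlus p j else lamMinus p j

theorem modeRate_true (p j : ℕ) : modeRate p true j = lamPlus p j := rfl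

theorem modeRate_eq (p : ℕ) (b : Bool) (j : ℕ) : modeRate p b j = modeRate p b 0 - 2 * j := by
  cases b <;> simp [modeRate, lamPlus, lamMinus]

theorem modeRate_succ (p : ℕ) (b : Bool) (j : ℕ) :
    modeRate p b (j + 1) = modeRate p b j - 2 := by
  rw [modeRate_eq, modeRate_eq p b j]
  push_cast
  ring

theorem modeRate_char {p : ℕ} (hp : 1 < p) (b : Bool) :
    modeRate p b 0 ^ 2 + modeRate p b 0 = p * c0 p := by
  have h : (p : ℝ) - 1 ≠ 0 := by
    have : (1 : ℝ) < p := by exact_mod_cast hp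
    linarith
  cases b
  · simp only [modeRate, lamMinus, c0, cond_false, Nat.cast_zero]
    field_simp
    ring
  · simp only [modeRate, lamPlus, c0, cond_true, Nat.cast_zero]
    field_simp
    ring

theorem modeRate_not_lt {p : ℕ} (hp : 1 < p) : modeRate p false 0 + 2 < modeRate p true 0 := by
  have h : (0 : ℝ) < (p : ℝ) - 1 := by
    have : (1 : ℝ) < p := by exact_mod_cast hp
    linarith
  have h1 : modeRate p true 0 = 1 + 2 / ((p : ℝ) - 1) := by simp [modeRate, lamPlus]
  have h2 : modeRate p false 0 = -(2 + 2 / ((p : ℝ) - 1)) := by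
    simp only [modeRate, lamMinus, cond_false, Nat.cast_zero]
    field_simp
    ring
  have : 0 < 2 / ((p : ℝ) - 1) := by positivity
  rw [h1, h2]
  linarith

theorem coupling_pos {p : ℕ} (hp : 1 < p) : 0 < p * c0 p := by
  have h1 : (1 : ℝ) < p := by exact_mod_cast hp
  have : (0 : ℝ) < (p : ℝ) - 1 := by linarith
  rw [c0]
  positivity

/-- The eigenfunction `(λ ρ, 1)` for `λ = λ_0^±`. -/
def lowMode (lam : ℝ) : Energy := parityPair 1 + (lam : ℂ) • parityPair X

theorem lowMode_mem (lam : ℝ) : lowMode lam ∈ lowPairs :=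
  mem_lowPairs.2 ⟨1, lam, by rw [one_smul, lowMode]⟩

theorem lowMode_mem_L_graph {p : ℕ} {lam : ℝ} (h : lam ^ 2 + lam = p * c0 p) :
    (lowMode lam, (lam : ℂ) • lowMode lam) ∈ (L p).graph := by
  have e : lowMode lam = parityPair (modePoly lam X) := by
    rw [lowMode, modePoly, ← map_smul, ← map_add, Polynomial.derivative_X, mul_one, sub_smul,
      one_smul]
    congr 1
    abel
  rw [e]
  refine modePoly_mem_L_graph p lam X_comp_neg_X ?_
  have h' : (lam : ℂ) ^ 2 + lam = ((p * c0 p : ℝ) : ℂ) := by rw [← h]; push_cast; rfl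
  rw [← h', Polynomial.derivative_X, Polynomial.derivative_one, mul_zero, mul_one, zero_sub,
    ← neg_smul, ← sub_smul]
  convert zero_smul ℂ (X : Polynomial ℂ)
  ring

theorem IsWaveSemigroup.apply_eigenvector {p : ℕ} {S : ℝ≥0 → Energy →L[ℂ] Energy}
    (hS : IsWaveSemigroup p S) {u : Energy} {lam : ℝ} (h : (u, (lam : ℂ) • u) ∈ (L p).graph)
    (t : ℝ≥0) : S t u = ((Real.exp (lam * t) : ℝ) : ℂ) • u :=
  hS.isSemigroup.apply_eigenvector ((hS.generator _ _).1 h) t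

/-- The value at `0` of the second component of an element of `lowPairs`. -/
def height : Energy →L[ℂ] ℂ := (innerSL ℂ (polyL2 1)).comp (WithLp.sndL 2 ℂ L2 L2)

/-- The slope of the first component of an element of `lowPairs`. -/
def slope : Energy →L[ℂ] ℂ := (2 : ℂ) • (innerSL ℂ (polyL2 1)).comp (WithLp.fstL 2 ℂ L2 L2)

theorem inner_one_polyL2 (q r : Polynomial ℂ) (hr : r.derivative = q) :
    inner ℂ (polyL2 1) (polyL2 q) = r.eval 1 - r.eval 0 := by
  rw [inner_polyL2]
  have : ∫ x, (starRingEnd ℂ) ((1 : Polynomial ℂ).eval (x : ℂ)) * polyL2 q x ∂μ01 =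
      ∫ x, q.eval (x : ℂ) ∂μ01 := by
    refine integral_congr_ae ?_
    filter_upwards [polyL2_coe q] with x hx
    simp [hx]
  rw [this, ← integral_Ioc_eq_integral_Ioo, ← intervalIntegral.integral_of_le zero_le_one,
    intervalIntegral.integral_eq_sub_of_hasDerivAt (f := fun x : ℝ => r.eval (x : ℂ))]
  · simp
  · intro x _
    rw [← hr]
    exact hasDerivAt_poly r x
  · exact Continuous.intervalIntegrable (by fun_prop) _ _

theorem lowMode_fst (lam : ℝ) : (lowMode lam).fst = (lam : ℂ) • polyL2 X := by
  rw [lowMode, ← map_smul, ← map_add, parityPair_fst, map_add, map_smul,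
    oddPart_of_even one_comp_neg_X, oddPart_of_odd X_comp_neg_X, zero_add, map_smul]

theorem lowMode_snd (lam : ℝ) : (lowMode lam).snd = polyL2 1 := by
  rw [lowMode, ← map_smul, ← map_add, parityPair_snd, map_add, map_smul,
    evenPart_of_even one_comp_neg_X, evenPart_of_odd X_comp_neg_X, smul_zero, add_zero]

theorem height_lowMode (lam : ℝ) : height (lowMode lam) = 1 := by
  have h : inner ℂ (polyL2 1) (lowMode lam).snd = (1 : ℂ) := by
    rw [lowMode_snd, inner_one_polyL2 1 X Polynomial.derivative_X]; simp
  exact h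

theorem slope_lowMode (lam : ℝ) : slope (lowMode lam) = lam := by
  have h : inner ℂ (polyL2 1) (lowMode lam).fst = (lam / 2 : ℂ) := by
    rw [lowMode_fst, inner_smul_right, inner_one_polyL2 X (C (1 / 2) * X ^ 2)]
    · simp [div_eq_mul_inv]
    · simp only [Polynomial.derivative_C_mul, Polynomial.derivative_X_pow, Nat.cast_ofNat,
        Nat.add_one_sub_one, pow_one]
      rw [← mul_assoc, ← map_mul]
      norm_num
  have e : slope (lowMode lam) = 2 * inner ℂ (polyL2 1) (lowMode lam).fst := rfl
  rw [e, h]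
  ring

/-- The coordinates of an element of `lowPairs` with respect to the lowest modes. -/
def lowCoord (p : ℕ) (b : Bool) : Energy →L[ℂ] ℂ :=
  ((modeRate p b 0 - modeRate p (!b) 0 : ℝ) : ℂ)⁻¹ •
    (slope - ((modeRate p (!b) 0 : ℝ) : ℂ) • height)

theorem modeRate_zero_ne {p : ℕ} (hp : 1 < p) (b : Bool) :
    modeRate p b 0 - modeRate p (!b) 0 ≠ 0 := by
  have := modeRate_not_lt hp
  cases b <;> simp <;> intro h <;> linarith

theorem lowCoord_lowMode {p : ℕ} (hp : 1 < p) (b b' : Bool) :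
    lowCoord p b (lowMode (modeRate p b' 0)) = if b = b' then 1 else 0 := by
  have h : (((modeRate p b 0 - modeRate p (!b) 0 : ℝ)) : ℂ) ≠ 0 := by
    exact_mod_cast modeRate_zero_ne hp b
  have e : lowCoord p b (lowMode (modeRate p b' 0)) =
      ((modeRate p b 0 - modeRate p (!b) 0 : ℝ) : ℂ)⁻¹ *
        ((modeRate p b' 0 - modeRate p (!b) 0 : ℝ) : ℂ) := by
    simp [lowCoord, height_lowMode, slope_lowMode]
  rw [e]
  by_cases hb : b = b'
  · subst hb
    rw [inv_mul_cancel₀ h, if_pos rfl]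
  · obtain rfl : b' = !b := by cases b <;> cases b' <;> simp_all
    simp

theorem exists_eq_sum_lowMode {p : ℕ} (hp : 1 < p) {n : Energy} (hn : n ∈ lowPairs) :
    ∃ x : Bool → ℂ, n = ∑ b, x b • lowMode (modeRate p b 0) := by
  obtain ⟨x, y, rfl⟩ := mem_lowPairs.1 hn
  have h : ((modeRate p true 0 : ℝ) : ℂ) - (modeRate p false 0 : ℝ) ≠ 0 := by
    exact_mod_cast modeRate_zero_ne hp true
  set μ := modeRate p true 0
  set ν := modeRate p false 0
  refine ⟨fun b => bif b then (y - ν * x) / (μ - ν) else (μ * x - y) / (μ - ν), ?_⟩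
  rw [Fintype.sum_bool]
  simp only [lowMode, cond_true, cond_false, smul_add, smul_smul]
  rw [add_add_add_comm, ← add_smul, ← add_smul]
  congr 2
  · field_simp
    ring
  · field_simp
    ring

theorem eq_sum_lowMode {p : ℕ} (hp : 1 < p) {n : Energy} (hn : n ∈ lowPairs) :
    n = ∑ b, lowCoord p b n • lowMode (modeRate p b 0) := by
  obtain ⟨x, rfl⟩ := exists_eq_sum_lowMode hp hn
  simp [lowCoord_lowMode hp]

section

variable {p : ℕ} {S : ℝ≥0 → Energy →L[ℂ] Energy}

theorem IsWaveSemigroup.apply_lowMode (hS : IsWaveSemigroup p S) (hp : 1 < p) (b : Bool)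
    (t : ℝ≥0) : S t (lowMode (modeRate p b 0)) =
      ((Real.exp (modeRate p b 0 * t) : ℝ) : ℂ) • lowMode (modeRate p b 0) :=
  hS.apply_eigenvector (lowMode_mem_L_graph (modeRate_char hp b)) t

theorem IsWaveSemigroup.apply_lowPairs (hS : IsWaveSemigroup p S) (hp : 1 < p) {n : Energy}
    (hn : n ∈ lowPairs) (t : ℝ≥0) : S t n ∈ lowPairs := by
  rw [eq_sum_lowMode hp hn, map_sum]
  refine sum_mem fun b _ => ?_
  rw [map_smul, hS.apply_lowMode hp]
  exact lowPairs.smul_mem _ (lowPairs.smul_mem _ (lowMode_mem _))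

theorem IsWaveSemigroup.lowCoord_apply (hS : IsWaveSemigroup p S) (hp : 1 < p) {n : Energy}
    (hn : n ∈ lowPairs) (b : Bool) (t : ℝ≥0) :
    lowCoord p b (S t n) = ((Real.exp (modeRate p b 0 * t) : ℝ) : ℂ) * lowCoord p b n := by
  conv_lhs => rw [eq_sum_lowMode hp hn]
  cases b <;> simp [hS.apply_lowMode hp, lowCoord_lowMode hp, mul_comm]

/-! ### Commuting the semigroup with two derivatives -/

/-- The projection along `lowPairs`. -/
def modLow : Energy →L[ℂ] Energy := .id ℂ Energy - lowPairs.starProjection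

theorem modLow_eq_zero_iff {u : Energy} : modLow u = 0 ↔ u ∈ lowPairs := by
  rw [modLow, sub_apply, ContinuousLinearMap.id_apply, sub_eq_zero, eq_comm,
    Submodule.starProjection_eq_self_iff]

theorem IsWaveSemigroup.twofold_of_mem (hS : IsWaveSemigroup p S) (hp : 1 < p) (t : ℝ≥0)
    {v w : Energy} (h : (v, w) ∈ (L p).graph) :
    S t (twofold v) - (Real.exp (-2 * t)) • twofold (S t v) ∈ lowPairs := by
  have hgr : ∀ s : ℝ≥0, ∃ m : ℂ, (twofold (S s v),
      twofold (S s w) - (2 : ℂ) • twofold (S s v) + m • parityPair X) ∈ (L p).graph := fun s =>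
    twofold_mem_L_graph ((hS.generator _ _).2
      (hS.isSemigroup.inGenerator_apply ((hS.generator _ _).1 h) s))
  choose m hm using hgr
  have hX : parityPair X ∈ lowPairs := mem_lowPairs.2 ⟨0, 1, by simp⟩
  have key := hS.isSemigroup.duhamel modLow t
    (fun s => Real.exp (-2 * s) • twofold (S s.toNNReal v))
    (fun s => Real.exp (-2 * s) • (twofold (S s.toNNReal w) - (2 : ℂ) • twofold (S s.toNNReal v)))
    (fun s => Real.exp (-2 * s) • (twofold (S s.toNNReal w) - (2 : ℂ) • twofold (S s.toNNReal v)
      + m s.toNNReal • parityPair X)) ?_ ?_ ?_ ?_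
  · rw [← modLow_eq_zero_iff, map_sub, sub_eq_zero]
    simp only [Real.toNNReal_coe] at key
    rw [key]
    simp [hS.isSemigroup.apply_zero]
  · have h1 := hS.isSemigroup.continuous_apply v
    exact Continuous.continuousOn (by fun_prop)
  · intro s hs
    have h1 := hS.isSemigroup.hasDerivWithinAt ((hS.generator _ _).1 h) hs.1
    have h2 := (twofold.restrictScalars ℝ).hasFDerivAt.comp_hasDerivWithinAt s h1
    have h3 : HasDerivAt (fun s : ℝ => Real.exp (-2 * s)) (Real.exp (-2 * s) * (-2)) s := by
      simpa using ((hasDerivAt_id s).const_mul (-2)).exp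
    convert! h3.hasDerivWithinAt.smul h2 using 1
    simp only [ContinuousLinearMap.coe_restrictScalars', Function.comp_apply]
    rw [smul_sub, mul_smul, neg_smul, smul_neg, ← sub_eq_add_neg]
    congr 2
  · intro s _
    rw [← hS.generator]
    have := (L p).graph.smul_mem ((Real.exp (-2 * s) : ℝ) : ℂ) (hm s.toNNReal)
    rw [Prod.smul_mk, Complex.coe_smul, Complex.coe_smul] at this
    exact this
  · intro s _ r
    rw [modLow_eq_zero_iff]
    refine hS.apply_lowPairs hp ?_ r
    rw [← smul_sub, sub_add_cancel_left]
    exact Submodule.smul_of_tower_mem _ _ (neg_mem (lowPairs.smul_mem _ hX))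

theorem IsWaveSemigroup.twofold_apply (hS : IsWaveSemigroup p S) (hp : 1 < p) (t : ℝ≥0)
    (v : Energy) :
    S t (twofold v) - ((Real.exp (-2 * t) : ℝ) : ℂ) • twofold (S t v) ∈ lowPairs := by
  have : modLow.comp ((S t).comp twofold - ((Real.exp (-2 * t) : ℝ) : ℂ) • twofold.comp (S t)) =
      0 := by
    refine ext_on_corePair fun w => ?_
    have := hS.twofold_of_mem hp t (corePair_mem_L_graph p w)
    rw [← modLow_eq_zero_iff] at this
    exact this
  rw [← modLow_eq_zero_iff]
  exact congrArg (· v) this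

theorem IsWaveSemigroup.mem_H2k_one (hS : IsWaveSemigroup p S) (hp : 1 < p) (t : ℝ≥0)
    {u : Energy} (hu : u ∈ H2k 1) :
    S t u ∈ H2k 1 ∧ D2k 1 (S t u) = ((Real.exp (-2 * t) : ℝ) : ℂ) • S t (D2k 1 u) := by
  obtain ⟨v, n, hn, rfl⟩ := AnalyticModes.mem_H2k_one.1 hu
  rw [D2k_one_eq v hn]
  have h1 := hS.twofold_apply hp t v
  have h2 := add_mem h1 (hS.apply_lowPairs hp hn t)
  have e : S t (twofold v + n) = twofold (((Real.exp (-2 * t) : ℝ) : ℂ) • S t v) +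
      (S t (twofold v) - ((Real.exp (-2 * t) : ℝ) : ℂ) • twofold (S t v) + S t n) := by
    rw [map_add, map_smul]
    abel
  exact ⟨AnalyticModes.mem_H2k_one.2 ⟨_, _, h2, e⟩, by rw [e, D2k_one_eq _ h2]⟩

theorem IsWaveSemigroup.mem_H2k (hS : IsWaveSemigroup p S) (hp : 1 < p) (t : ℝ≥0) {k : ℕ}
    {u : Energy} (hu : u ∈ H2k k) : S t u ∈ H2k k := by
  induction k generalizing u with
  | zero => exact H2k_zero _
  | succ k ih =>
    rw [mem_H2k_succ_iff] at hu ⊢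
    obtain ⟨h1, h2⟩ := hS.mem_H2k_one hp t hu.1
    refine ⟨h1, ?_⟩
    rw [h2]
    exact (sobolev k).smul_mem _ (ih hu.2)

end

/-! ### The odd power series of the spectral equation -/

/-- The operator of the spectral ordinary differential equation. -/
def odeOp (lam c : ℂ) (q : Polynomial ℂ) : Polynomial ℂ :=
  (1 - X ^ 2) * q.derivative.derivative - (2 * lam) • (X * q.derivative) -
    (lam * (lam - 1) - c) • q

theorem odeOp_add (lam c : ℂ) (q r : Polynomial ℂ) :
    odeOp lam c (q + r) = odeOp lam c q + odeOp lam c r := by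
  simp only [odeOp, Polynomial.derivative_add, mul_add, smul_add]
  abel

theorem odeOp_monomial (lam c a : ℂ) (i : ℕ) :
    odeOp lam c (C a * X ^ (2 * i + 3)) =
      C (a * ((2 * i + 3) * (2 * i + 2))) * X ^ (2 * i + 1) -
      C (a * ((2 * i + 3 + lam) * (2 * i + 2 + lam) - c)) * X ^ (2 * i + 3) := by
  simp only [odeOp, Polynomial.smul_eq_C_mul,
    Polynomial.derivative_X_pow, map_mul, map_sub, map_add, Polynomial.C_ofNat,
    map_zero, show 2 * i + 3 - 1 = 2 * i + 2 from rfl,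
    show 2 * i + 2 - 1 = 2 * i + 1 from rfl, map_one, Polynomial.derivative_natCast,
    Polynomial.derivative_mul, Polynomial.derivative_C, map_natCast]
  push_cast
  ring

/-- The coefficients of the odd power series solution of the spectral equation. -/
def frobCoeff (lam c : ℂ) : ℕ → ℂ
  | 0 => 1
  | i + 1 => frobCoeff lam c i * ((2 * i + 1 + lam) * (2 * i + lam) - c) /
      ((2 * i + 3) * (2 * i + 2))

/-- The partial sums of the odd power series solution of the spectral equation. -/
def frobPoly (lam c : ℂ) : ℕ → Polynomial ℂ
  | 0 => X
  | j + 1 => frobPoly lam c j + C (frobCoeff lam c (j + 1)) * X ^ (2 * j + 3)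

theorem odeOp_frobPoly (lam c : ℂ) (j : ℕ) : odeOp lam c (frobPoly lam c j) =
    -(C (frobCoeff lam c j * ((2 * j + 1 + lam) * (2 * j + lam) - c)) * X ^ (2 * j + 1)) := by
  induction j with
  | zero =>
    simp only [frobPoly, frobCoeff, odeOp, Polynomial.derivative_X, Polynomial.derivative_one,
      Polynomial.smul_eq_C_mul, map_mul, map_sub, map_add, map_one, Nat.cast_zero,
      Polynomial.C_ofNat, mul_zero, zero_add]
    ring
  | succ j ih =>
    have h : ((2 * j + 3) * (2 * j + 2) : ℂ) ≠ 0 := by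
      exact_mod_cast (by positivity : (2 * j + 3) * (2 * j + 2) ≠ 0)
    rw [frobPoly, odeOp_add, ih, odeOp_monomial]
    have e : frobCoeff lam c (j + 1) * ((2 * j + 3) * (2 * j + 2)) =
        frobCoeff lam c j * ((2 * j + 1 + lam) * (2 * j + lam) - c) := by
      rw [frobCoeff, div_mul_cancel₀ _ h]
    rw [e, neg_add_eq_sub, sub_sub_cancel_left]
    congr 3
    push_cast
    ring

theorem frobPoly_odd (lam c : ℂ) (j : ℕ) :
    (frobPoly lam c j).comp (-X) = -frobPoly lam c j := by
  induction j with
  | zero => simp [frobPoly]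
  | succ j ih =>
    have : Odd (2 * j + 3) := ⟨j + 1, by ring⟩
    rw [frobPoly, Polynomial.add_comp, ih]
    simp only [Polynomial.mul_comp, Polynomial.C_comp, Polynomial.X_pow_comp, this.neg_pow]
    ring

theorem frobPoly_derivative_zero (lam c : ℂ) (j : ℕ) :
    (frobPoly lam c j).derivative.eval 0 = 1 := by
  induction j with
  | zero => simp [frobPoly]
  | succ j ih =>
    rw [frobPoly, Polynomial.derivative_add, Polynomial.eval_add, ih]
    simp

theorem parityPair_mem_H2k (w : Polynomial ℂ) (k : ℕ) : parityPair w ∈ H2k k := by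
  induction k generalizing w with
  | zero => exact H2k_zero _
  | succ k ih =>
    refine mem_H2k_succ.2 ⟨_, ih w.derivative.derivative, w.eval 0 • parityPair 1 +
      w.derivative.eval 0 • parityPair X, mem_lowPairs.2 ⟨_, _, rfl⟩, ?_⟩
    rw [twofold_parityPair, ← map_smul, ← map_smul, ← map_add, ← map_add]
    congr 1
    simp only [Polynomial.smul_eq_C_mul]
    ring

theorem analyticOnNhd_poly (q : Polynomial ℂ) :
    AnalyticOnNhd ℝ (fun ρ : ℝ => q.eval (ρ : ℂ)) (Icc 0 1) := by
  have : AnalyticOnNhd ℝ (fun ρ : ℝ => Polynomial.aeval (ρ : ℂ) q) (Icc 0 1) :=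
    AnalyticOnNhd.aeval_polynomial (Complex.ofRealCLM.analyticOnNhd _) q
  simpa only [Polynomial.coe_aeval_eq_eval] using this

theorem exists_analyticMode {p : ℕ} (hp : 1 < p) (k : ℕ) (b : Bool) (j : ℕ) :
    ∃ e, IsAnalyticMode p k (modeRate p b j) e ∧ IsOddPolynomialMode (modeRate p b j) e := by
  set lam : ℂ := ((modeRate p b j : ℝ) : ℂ) with hlam
  set c : ℂ := ((p * c0 p : ℝ) : ℂ) with hc
  set q := frobPoly lam c j with hq
  have hodd : q.comp (-X) = -q := frobPoly_odd lam c j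
  have hode : odeOp lam c q = 0 := by
    rw [hq, odeOp_frobPoly]
    have e : (2 * j + 1 + lam) * (2 * j + lam) - c = 0 := by
      rw [hlam, hc, ← modeRate_char hp b, modeRate_eq]
      push_cast
      ring
    rw [e]
    simp
  have hgr := modePoly_mem_L_graph p lam hodd hode
  set w := modePoly lam q with hw
  have hw0 : w ≠ 0 := by
    intro h
    have h1 : w.eval 0 = 1 := by
      have h2 : q.derivative.eval 0 = 1 := frobPoly_derivative_zero lam c j
      simp [hw, modePoly, eval_zero_of_odd hodd, h2]
    rw [h] at h1
    simp at h1
  have hpos : 0 < normH2k k (parityPair w) :=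
    (norm_pos_iff.2 fun h => hw0 (parityPair_injective (h.trans (map_zero _).symm))).trans_le
      (norm_le_normH2k k _)
  set a : ℂ := ((normH2k k (parityPair w) : ℝ) : ℂ)⁻¹ with ha
  have e : a • parityPair w = parityPair (modePoly lam (a • q)) := by
    rw [← map_smul, hw]
    congr 1
    simp only [modePoly, Polynomial.derivative_smul, smul_add, mul_smul_comm]
    rw [smul_comm a (lam - 1)]
  have hodd' : (a • q).comp (-X) = -(a • q) := by
    rw [Polynomial.smul_comp, hodd, smul_neg]
  refine ⟨a • parityPair w, ⟨(sobolev k).smul_mem _ (parityPair_mem_H2k w k), ?_, ?_, ?_⟩, ?_⟩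
  · rw [normH2k_smul _ (parityPair_mem_H2k w k), ha, norm_inv, Complex.norm_real,
      Real.norm_of_nonneg hpos.le, inv_mul_cancel₀ hpos.ne']
  · have := (L p).graph.smul_mem a hgr
    rwa [Prod.smul_mk, smul_comm a lam] at this
  · rw [e]
    exact ⟨_, _, analyticOnNhd_poly _, analyticOnNhd_poly _, polyL2_coe _, polyL2_coe _⟩
  · refine ⟨a • q, hodd', ?_, ?_⟩
    · rw [e, parityPair_fst, oddPart_modePoly lam hodd']
      filter_upwards [polyL2_coe (X * (a • q).derivative + (lam - 1) • (a • q))] with x hx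
      rw [hx, hlam]
      simp
      ring
    · rw [e, parityPair_snd, evenPart_modePoly lam hodd']
      exact polyL2_coe _

/-! ### Scalar functions that are exponential up to a small error -/

theorem exists_nat_add (t : ℝ≥0) : ∃ (n : ℕ) (r : ℝ≥0), r ≤ 1 ∧ t = n + r := by
  refine ⟨⌊t⌋₊, t - ⌊t⌋₊, ?_, ?_⟩
  · rw [tsub_le_iff_left, add_comm]
    rw [add_comm]
    exact (Nat.lt_floor_add_one t).le
  · rw [add_tsub_cancel_of_le (Nat.floor_le (by positivity))]

/-- The norm of `f (t + s) - e^{λ s} f t` is at most `M e^{σ t}` for `s ≤ 1`. -/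
def AlmostExp (lam σ M : ℝ) (f : ℝ≥0 → ℂ) : Prop :=
  ∀ t s : ℝ≥0, s ≤ 1 →
    ‖f (t + s) - ((Real.exp (lam * s) : ℝ) : ℂ) * f t‖ ≤ M * Real.exp (σ * t)

theorem AlmostExp.nonneg {lam σ M : ℝ} {f : ℝ≥0 → ℂ} (h : AlmostExp lam σ M f) : 0 ≤ M := by
  have := (norm_nonneg _).trans (h 0 0 zero_le_one)
  simpa using this

theorem norm_ofReal_exp (x : ℝ) : ‖((Real.exp x : ℝ) : ℂ)‖ = Real.exp x := by
  rw [Complex.norm_real, Real.norm_of_nonneg (Real.exp_nonneg _)]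

theorem AlmostExp.norm_le {lam σ M : ℝ} {f : ℝ≥0 → ℂ} (h : AlmostExp lam σ M f) (t s : ℝ≥0)
    (hs : s ≤ 1) : ‖f (t + s)‖ ≤ Real.exp (lam * s) * ‖f t‖ + M * Real.exp (σ * t) := by
  have h1 := h t s hs
  have h2 := norm_sub_norm_le (f (t + s)) (((Real.exp (lam * s) : ℝ) : ℂ) * f t)
  rw [norm_mul, norm_ofReal_exp] at h2
  linarith

theorem exp_mul_le_exp_abs (a : ℝ) {r : ℝ≥0} (hr : r ≤ 1) : Real.exp (a * r) ≤ Real.exp |a| := by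
  have hr' : (r : ℝ) ≤ 1 := by exact_mod_cast hr
  refine Real.exp_le_exp.2 ?_
  nlinarith [le_abs_self a, abs_nonneg a, r.coe_nonneg]

theorem exists_norm_le_exp {lam σ : ℝ} (hlt : lam < σ) : ∃ C ≥ 0, ∀ (f : ℝ≥0 → ℂ) (M : ℝ),
    AlmostExp lam σ M f → ∀ t : ℝ≥0, ‖f t‖ ≤ C * (‖f 0‖ + M) * Real.exp (σ * t) := by
  have hd : 0 < Real.exp σ - Real.exp lam := sub_pos.2 (Real.exp_lt_exp.2 hlt)
  set C := Real.exp |σ| * Real.exp |lam| + (Real.exp σ - Real.exp lam)⁻¹ with hC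
  have h1 : 1 ≤ Real.exp |σ| := Real.one_le_exp (abs_nonneg _)
  have h2 : 1 ≤ Real.exp |lam| := Real.one_le_exp (abs_nonneg _)
  have hC0 : 0 ≤ C := by positivity
  refine ⟨C, hC0, fun f M h => ?_⟩
  have hM := h.nonneg
  have key : ∀ (n : ℕ) (r : ℝ≥0), r ≤ 1 →
      ‖f (n + r)‖ ≤ C * (‖f 0‖ + M) * Real.exp (σ * ((n : ℝ) + r)) := by
    intro n r hr
    induction n with
    | zero =>
      have h3 := h.norm_le 0 r hr
      simp only [NNReal.coe_zero, mul_zero, Real.exp_zero, mul_one, zero_add] at h3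
      have h4 := exp_mul_le_exp_abs lam hr
      have h5 : 1 ≤ Real.exp |σ| * Real.exp (σ * r) := by
        rw [← Real.exp_add]
        refine Real.one_le_exp ?_
        have := exp_mul_le_exp_abs (-σ) hr
        rw [Real.exp_le_exp, abs_neg] at this
        linarith
      simp only [Nat.cast_zero, zero_add]
      calc ‖f r‖ ≤ Real.exp |lam| * ‖f 0‖ + Real.exp |lam| * M := by
            nlinarith [norm_nonneg (f 0)]
        _ = Real.exp |lam| * (‖f 0‖ + M) * 1 := by ring
        _ ≤ Real.exp |lam| * (‖f 0‖ + M) * (Real.exp |σ| * Real.exp (σ * r)) := by gcongr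
        _ = Real.exp |σ| * Real.exp |lam| * (‖f 0‖ + M) * Real.exp (σ * r) := by ring
        _ ≤ C * (‖f 0‖ + M) * Real.exp (σ * r) := by
            gcongr
            rw [hC]
            linarith [inv_pos.2 hd]
    | succ n ih =>
      have h3 := h.norm_le (n + r) 1 le_rfl
      have e : ((n + 1 : ℕ) : ℝ≥0) + r = n + r + 1 := by push_cast; ring
      rw [e]
      simp only [NNReal.coe_add, NNReal.coe_natCast, NNReal.coe_one, mul_one] at h3
      set E := Real.exp (σ * ((n : ℝ) + r)) with hE
      have e2 : Real.exp (σ * (((n + 1 : ℕ) : ℝ) + r)) = Real.exp σ * E := by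
        rw [hE, ← Real.exp_add]
        push_cast
        ring_nf
      rw [e2]
      have h4 : 1 ≤ C * (Real.exp σ - Real.exp lam) := by
        rw [hC, add_mul, inv_mul_cancel₀ hd.ne']
        have : 0 ≤ Real.exp |σ| * Real.exp |lam| * (Real.exp σ - Real.exp lam) := by positivity
        linarith
      have hE0 : 0 < E := Real.exp_pos _
      calc _ ≤ Real.exp lam * (C * (‖f 0‖ + M) * E) + M * E := by
            refine h3.trans ?_
            gcongr
        _ ≤ Real.exp lam * (C * (‖f 0‖ + M) * E) +
            C * (Real.exp σ - Real.exp lam) * (‖f 0‖ + M) * E := by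
            gcongr
            nlinarith [norm_nonneg (f 0)]
        _ = _ := by ring
  intro t
  obtain ⟨n, r, hr, rfl⟩ := exists_nat_add t
  simpa using key n r hr

theorem exists_norm_sub_le_exp {lam σ : ℝ} (hlt : σ < lam) :
    ∃ C ≥ 0, ∀ (f : ℝ≥0 → ℂ) (M : ℝ), AlmostExp lam σ M f → ∃ c : ℂ,
      ‖c‖ ≤ C * (‖f 0‖ + M) ∧
      ∀ t : ℝ≥0, ‖f t - ((Real.exp (lam * t) : ℝ) : ℂ) * c‖ ≤
        C * (‖f 0‖ + M) * Real.exp (σ * t) := by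
  set δ := lam - σ with hδ
  have hδ0 : 0 < δ := sub_pos.2 hlt
  have hq : Real.exp (-δ) < 1 := Real.exp_lt_one_iff.2 (by linarith)
  set K := Real.exp |lam| * Real.exp δ * (1 + (1 - Real.exp (-δ))⁻¹) with hK
  have hq' : 0 < 1 - Real.exp (-δ) := by linarith
  have hK0 : 0 ≤ K := by positivity
  refine ⟨K + 1, by positivity, fun f M h => ?_⟩
  have hM := h.nonneg
  set a : ℝ≥0 → ℂ := fun t => ((Real.exp (-(lam * t)) : ℝ) : ℂ) * f t with ha
  have hstep : ∀ t s : ℝ≥0, s ≤ 1 → ‖a (t + s) - a t‖ ≤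
      M * Real.exp |lam| * Real.exp (-δ * t) := by
    intro t s hs
    have e : a (t + s) - a t = ((Real.exp (-(lam * (t + s))) : ℝ) : ℂ) *
        (f (t + s) - ((Real.exp (lam * s) : ℝ) : ℂ) * f t) := by
      rw [mul_sub, ← mul_assoc, ← Complex.ofReal_mul, ← Real.exp_add]
      simp only [ha, NNReal.coe_add]
      ring_nf
    rw [e, norm_mul, norm_ofReal_exp]
    have h1 := exp_mul_le_exp_abs (-lam) hs
    rw [abs_neg] at h1
    calc Real.exp (-(lam * (t + s))) * ‖f (t + s) - ((Real.exp (lam * s) : ℝ) : ℂ) * f t‖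
        ≤ Real.exp (-(lam * (t + s))) * (M * Real.exp (σ * t)) := by
          gcongr
          exact h t s hs
      _ = M * Real.exp (-lam * s) * Real.exp (-δ * t) := by
          rw [mul_assoc M, ← Real.exp_add, mul_left_comm, ← Real.exp_add]
          congr 2
          rw [hδ]
          ring
      _ ≤ _ := by gcongr
  set A := M * Real.exp |lam| with hA
  have hA0 : 0 ≤ A := by positivity
  have hgeo : ∀ n : ℕ, dist (a n) (a (n + 1 : ℕ)) ≤ A * Real.exp (-δ) ^ n := by
    intro n
    have h1 := hstep n 1 le_rfl
    rw [dist_comm, dist_eq_norm, ← Real.exp_nat_mul]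
    push_cast
    refine h1.trans (le_of_eq ?_)
    rw [mul_comm (-δ)]
    simp
  obtain ⟨c, hc⟩ := cauchySeq_tendsto_of_complete
    (cauchySeq_of_le_geometric (Real.exp (-δ)) A hq (f := fun n : ℕ => a n) hgeo)
  have hdist : ∀ n : ℕ, ‖a n - c‖ ≤ A * Real.exp (-δ * n) * (1 - Real.exp (-δ))⁻¹ := by
    intro n
    have h1 := dist_le_of_le_geometric_of_tendsto (Real.exp (-δ)) A hq hgeo hc n
    rw [dist_eq_norm, ← Real.exp_nat_mul, mul_comm (n : ℝ), div_eq_mul_inv] at h1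
    exact h1
  have hac : ∀ t : ℝ≥0, ‖a t - c‖ ≤ K * M * Real.exp (-δ * t) := by
    intro t
    obtain ⟨n, r, hr, rfl⟩ := exists_nat_add t
    have h1 := hstep n r hr
    have h2 := hdist n
    have h3 := norm_add_le (a (n + r) - a n) (a n - c)
    rw [sub_add_sub_cancel] at h3
    have hr' : (r : ℝ) ≤ 1 := by exact_mod_cast hr
    have h4 : Real.exp (-δ * n) ≤ Real.exp δ * Real.exp (-δ * ((n : ℝ) + r)) := by
      rw [← Real.exp_add, Real.exp_le_exp]
      nlinarith
    simp only [NNReal.coe_natCast, NNReal.coe_add] at h1 ⊢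
    calc ‖a (n + r) - c‖ ≤ A * (1 + (1 - Real.exp (-δ))⁻¹) * Real.exp (-δ * n) := by linarith
      _ ≤ A * (1 + (1 - Real.exp (-δ))⁻¹) * (Real.exp δ * Real.exp (-δ * ((n : ℝ) + r))) := by
          gcongr
      _ = _ := by rw [hK, hA]; ring
  refine ⟨c, ?_, fun t => ?_⟩
  · have h1 := hac 0
    have h2 : a 0 = f 0 := by simp [ha]
    simp only [h2, NNReal.coe_zero, mul_zero, Real.exp_zero, mul_one] at h1
    have h3 := norm_sub_norm_le c (f 0)
    rw [norm_sub_rev] at h3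
    nlinarith [norm_nonneg (f 0)]
  · have e : f t - ((Real.exp (lam * t) : ℝ) : ℂ) * c =
        ((Real.exp (lam * t) : ℝ) : ℂ) * (a t - c) := by
      simp only [ha]
      rw [mul_sub, ← mul_assoc, ← Complex.ofReal_mul, ← Real.exp_add]
      simp
    rw [e, norm_mul, norm_ofReal_exp]
    calc Real.exp (lam * t) * ‖a t - c‖ ≤ Real.exp (lam * t) * (K * M * Real.exp (-δ * t)) := by
          gcongr
          exact hac t
      _ = K * M * Real.exp (σ * t) := by
          rw [mul_left_comm, ← Real.exp_add]
          congr 2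
          rw [hδ]
          ring
      _ ≤ _ := by
          gcongr <;> linarith [norm_nonneg (f 0)]

/-- A function that is almost exponential with rate `λ` differs from an exponential function by
a term of order `e^{σ t}`. -/
theorem exists_exponential_part {lam σ : ℝ} (hne : lam ≠ σ) :
    ∃ C ≥ 0, ∀ (f : ℝ≥0 → ℂ) (M : ℝ), AlmostExp lam σ M f → ∃ c : ℂ, (lam < σ → c = 0) ∧
      ‖c‖ ≤ C * (‖f 0‖ + M) ∧
      ∀ t : ℝ≥0, ‖f t - ((Real.exp (lam * t) : ℝ) : ℂ) * c‖ ≤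
        C * (‖f 0‖ + M) * Real.exp (σ * t) := by
  rcases hne.lt_or_gt with hlt | hlt
  · obtain ⟨C, hC0, hC⟩ := exists_norm_le_exp hlt
    refine ⟨C, hC0, fun f M h => ⟨0, fun _ => rfl, ?_, fun t => ?_⟩⟩
    · have := h.nonneg
      rw [norm_zero]
      positivity
    · simpa using hC f M h t
  · obtain ⟨C, hC0, hC⟩ := exists_norm_sub_le_exp hlt
    refine ⟨C, hC0, fun f M h => ?_⟩
    obtain ⟨c, hc⟩ := hC f M h
    exact ⟨c, fun h' => absurd h' hlt.not_gt, hc⟩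

theorem eq_zero_of_exp_le {lam σ K : ℝ} (hlt : σ < lam) {c : ℝ} (hc : 0 ≤ c)
    (h : ∀ t : ℝ≥0, Real.exp (lam * t) * c ≤ K * Real.exp (σ * t)) : c = 0 := by
  have h1 : ∀ n : ℕ, c ≤ K * Real.exp (-(lam - σ)) ^ n := by
    intro n
    have h2 := h n
    rw [← Real.exp_nat_mul]
    simp only [NNReal.coe_natCast] at h2
    have h3 : Real.exp ((n : ℝ) * -(lam - σ)) = Real.exp (σ * n) * Real.exp (-(lam * n)) := by
      rw [← Real.exp_add]
      ring_nf
    calc c = Real.exp (lam * n) * c * Real.exp (-(lam * n)) := by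
          rw [mul_right_comm, ← Real.exp_add]
          simp
      _ ≤ K * Real.exp (σ * n) * Real.exp (-(lam * n)) := by gcongr
      _ = _ := by rw [h3]; ring
  have h2 := (tendsto_pow_atTop_nhds_zero_of_lt_one (Real.exp_nonneg (-(lam - σ)))
    (Real.exp_lt_one_iff.2 (by linarith))).const_mul K
  rw [mul_zero] at h2
  exact le_antisymm (ge_of_tendsto' h2 h1) hc

/-! ### Growth of the semigroup on `𝓗^{2k}` -/

section

variable {p : ℕ} {S : ℝ≥0 → Energy →L[ℂ] Energy}

theorem norm_D2k_one_le {u : Energy} (k : ℕ) (hu : u ∈ H2k 1) :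
    fullNorm k (D2k 1 u) ≤ fullNorm (k + 1) u := by
  rw [fullNorm_succ k hu]
  linarith [norm_nonneg u]

theorem IsWaveSemigroup.norm_le_of_le_one (hS : IsWaveSemigroup p S) (hp : 1 < p) :
    ∃ M ≥ 0, ∀ s : ℝ≥0, s ≤ 1 → ‖S s‖ ≤ M := by
  obtain ⟨M, hM⟩ := hS.bound
  have hM0 : 0 ≤ M := by
    have := (norm_nonneg _).trans (hM 0)
    simpa using this
  have hβ : 0 < 1 / 2 + p * c0 p := by linarith [coupling_pos hp]
  refine ⟨M * Real.exp (1 / 2 + p * c0 p), by positivity, fun s hs => (hM s).trans ?_⟩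
  have hs' : (s : ℝ) ≤ 1 := by exact_mod_cast hs
  gcongr
  nlinarith

theorem IsWaveSemigroup.fullNorm_succ_apply (hS : IsWaveSemigroup p S) (hp : 1 < p) (k : ℕ)
    {u : Energy} (hu : u ∈ H2k (k + 1)) (t : ℝ≥0) : fullNorm (k + 1) (S t u) =
      ‖S t u‖ + Real.exp (-2 * t) * fullNorm k (S t (D2k 1 u)) := by
  obtain ⟨h1, h2⟩ := mem_H2k_succ_iff.1 hu
  obtain ⟨h3, h4⟩ := hS.mem_H2k_one hp t h1
  rw [fullNorm_succ k h3, h4, fullNorm_smul _ (hS.mem_H2k hp t h2), norm_ofReal_exp]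

theorem IsWaveSemigroup.almostExp_lowCoord (hS : IsWaveSemigroup p S) (hp : 1 < p) :
    ∃ K ≥ 0, ∀ u ∈ H2k 1, ∀ B σ : ℝ,
      (∀ t : ℝ≥0, ‖S t (D2k 1 u)‖ ≤ B * Real.exp ((σ + 2) * t)) → ∀ b,
      AlmostExp (modeRate p b 0) σ (K * B)
        (fun t => lowCoord p b (S t u - twofold (D2k 1 (S t u)))) := by
  obtain ⟨M, hM0, hM⟩ := hS.norm_le_of_le_one hp
  set F := ‖lowCoord p true‖ + ‖lowCoord p false‖ with hF
  have hFb : ∀ b, ‖lowCoord p b‖ ≤ F := by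
    intro b
    cases b <;> simp [hF]
  refine ⟨F * (2 * M * ‖twofold‖), by positivity, fun u hu B σ hB b t s hs => ?_⟩
  set v := D2k 1 u with hv
  set x := S t v with hx
  have hn : S t u - twofold (D2k 1 (S t u)) ∈ lowPairs :=
    sub_twofold_mem_lowPairs (hS.mem_H2k_one hp t hu).1
  rw [← hS.lowCoord_apply hp hn, ← map_sub, (hS.mem_H2k_one hp _ hu).2,
    (hS.mem_H2k_one hp _ hu).2]
  have e : S (t + s) u - twofold (((Real.exp (-2 * (t + s : ℝ≥0)) : ℝ) : ℂ) • S (t + s) v) -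
      S s (S t u - twofold (((Real.exp (-2 * t) : ℝ) : ℂ) • S t v)) =
      ((Real.exp (-2 * t) : ℝ) : ℂ) • (S s (twofold x) -
        ((Real.exp (-2 * s) : ℝ) : ℂ) • twofold (S s x)) := by
    rw [add_comm t s, hS.isSemigroup.apply_add, hS.isSemigroup.apply_add, ← hx, map_sub, map_smul,
      map_smul, map_smul, smul_sub, smul_smul, ← Complex.ofReal_mul, ← Real.exp_add]
    push_cast
    rw [mul_add, add_comm (-2 * (s : ℂ))]
    abel
  rw [e]
  have hs1 : Real.exp (-2 * s) ≤ 1 := by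
    rw [Real.exp_le_one_iff]
    linarith [s.coe_nonneg]
  have h1 : ‖S s (twofold x) - ((Real.exp (-2 * s) : ℝ) : ℂ) • twofold (S s x)‖ ≤
      2 * M * ‖twofold‖ * ‖x‖ := by
    calc _ ≤ ‖S s (twofold x)‖ + 1 * ‖twofold (S s x)‖ := by
          refine (norm_sub_le _ _).trans ?_
          rw [norm_smul, norm_ofReal_exp]
          gcongr
      _ ≤ M * (‖twofold‖ * ‖x‖) + 1 * (‖twofold‖ * (M * ‖x‖)) := by
          gcongr
          · exact ((S s).le_of_opNorm_le (hM s hs) _).trans (by gcongr; exact twofold.le_opNorm x)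
          · exact (twofold.le_opNorm _).trans (by gcongr; exact (S s).le_of_opNorm_le (hM s hs) _)
      _ = _ := by ring
  calc _ ≤ F * (Real.exp (-2 * t) * (2 * M * ‖twofold‖ * ‖x‖)) := by
        refine ((lowCoord p b).le_of_opNorm_le (hFb b) _).trans ?_
        rw [norm_smul, norm_ofReal_exp]
        gcongr
    _ ≤ F * (Real.exp (-2 * t) * (2 * M * ‖twofold‖ * (B * Real.exp ((σ + 2) * t)))) := by
        gcongr
        exact hB t
    _ = F * (2 * M * ‖twofold‖) * B * (Real.exp (-2 * t) * Real.exp ((σ + 2) * t)) := by ring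
    _ = _ := by
        rw [← Real.exp_add]
        ring_nf

/-- If `D² u` grows with rate at most `σ + 2`, then `u` grows with rate at most `σ`, up to a
combination of the lowest modes. -/
theorem IsWaveSemigroup.exists_lowest_part (hS : IsWaveSemigroup p S) (hp : 1 < p) (k : ℕ)
    {σ : ℝ} (hσ : ∀ b, modeRate p b 0 ≠ σ) :
    ∃ C ≥ 0, ∀ u ∈ H2k (k + 1), ∀ B : ℝ,
      (∀ t : ℝ≥0, fullNorm k (S t (D2k 1 u)) ≤ B * Real.exp ((σ + 2) * t)) →
      ∃ a : Bool → ℂ, (∀ b, modeRate p b 0 < σ → a b = 0) ∧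
        (∀ b, ‖a b‖ ≤ C * (fullNorm (k + 1) u + B)) ∧
        ∀ t : ℝ≥0, fullNorm (k + 1) (S t (u - ∑ b, a b • lowMode (modeRate p b 0))) ≤
          C * (fullNorm (k + 1) u + B) * Real.exp (σ * t) := by
  obtain ⟨K, hK0, hK⟩ := hS.almostExp_lowCoord hp
  choose A hA0 hA using fun b => exists_exponential_part (hσ b)
  set w := ‖twofold‖ with hw
  set H : Bool → ℝ := fun b => A b * (‖lowCoord p b‖ * (1 + w) + K) with hH
  have hH0 : ∀ b, 0 ≤ H b := fun b => mul_nonneg (hA0 b) (by positivity)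
  set G : Bool → ℝ := fun b => ‖lowMode (modeRate p b 0)‖ with hG
  have hsum : 0 ≤ ∑ b, H b * (G b + 1) :=
    Finset.sum_nonneg fun b _ => mul_nonneg (hH0 b) (by positivity)
  refine ⟨w + 1 + ∑ b, H b * (G b + 1), by positivity, fun u hu B hB => ?_⟩
  obtain ⟨hu1, hv⟩ := mem_H2k_succ_iff.1 hu
  set v := D2k 1 u with hv'
  set N := fullNorm (k + 1) u with hN
  have hN0 : 0 ≤ N := fullNorm_nonneg _ _
  have hB0 : 0 ≤ B := by
    have := (fullNorm_nonneg _ _).trans (hB 0)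
    simpa using this
  have hSv : ∀ t : ℝ≥0, ‖S t v‖ ≤ B * Real.exp ((σ + 2) * t) := fun t =>
    (norm_le_fullNorm k _).trans (hB t)
  set f : Bool → ℝ≥0 → ℂ := fun b t => lowCoord p b (S t u - twofold (D2k 1 (S t u))) with hf
  have hf0 : ∀ b, ‖f b 0‖ ≤ ‖lowCoord p b‖ * (1 + w) * N := by
    intro b
    have h1 : ‖u‖ ≤ N := norm_le_fullNorm _ _
    have h2 : ‖v‖ ≤ N := (norm_le_fullNorm k _).trans (norm_D2k_one_le k hu1)
    simp only [hf, hS.isSemigroup.apply_zero]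
    calc _ ≤ ‖lowCoord p b‖ * (‖u‖ + w * ‖v‖) :=
          ((lowCoord p b).le_opNorm _).trans (by
            gcongr; exact (norm_sub_le _ _).trans (by gcongr; exact twofold.le_opNorm _))
      _ ≤ ‖lowCoord p b‖ * (N + w * N) := by gcongr
      _ = _ := by ring
  choose a ha0 ha1 ha2 using fun b => hA b (f b) (K * B) (hK u hu1 B σ hSv b)
  have hAX : ∀ b, A b * (‖f b 0‖ + K * B) ≤ H b * (N + B) := by
    intro b
    have h1 := hf0 b
    have h2 : 0 ≤ ‖lowCoord p b‖ * (1 + w) := by positivity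
    simp only [hH]
    rw [mul_assoc]
    refine mul_le_mul_of_nonneg_left ?_ (hA0 b)
    nlinarith
  have hHX : ∀ b, 0 ≤ H b * (N + B) := fun b => mul_nonneg (hH0 b) (by positivity)
  refine ⟨a, ha0, fun b => ?_, fun t => ?_⟩
  · refine ((ha1 b).trans (hAX b)).trans ?_
    gcongr
    have h1 := Finset.single_le_sum (f := fun b => H b * (G b + 1))
      (fun b _ => mul_nonneg (hH0 b) (by positivity)) (Finset.mem_univ b)
    have h2 : 0 ≤ H b * G b := mul_nonneg (hH0 b) (norm_nonneg _)
    have h3 : 0 ≤ w := norm_nonneg _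
    linarith
  · set z := ∑ b, a b • lowMode (modeRate p b 0) with hz
    have hzl : z ∈ lowPairs := sum_mem fun b _ => lowPairs.smul_mem _ (lowMode_mem _)
    have hzk : z ∈ H2k (k + 1) := lowPairs_subset hzl k
    have hD : D2k 1 (u - z) = v := by
      rw [D2k_sub hu1 (lowPairs_subset hzl 0), D2k_one_lowPairs hzl, sub_zero]
    rw [hS.fullNorm_succ_apply hp k ((sobolev (k + 1)).sub_mem hu hzk), hD]
    have hlow := eq_sum_lowMode hp (sub_twofold_mem_lowPairs (hS.mem_H2k_one hp t hu1).1)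
    have e : S t (u - z) = ((Real.exp (-2 * t) : ℝ) : ℂ) • twofold (S t v) +
        ∑ b, (f b t - ((Real.exp (modeRate p b 0 * t) : ℝ) : ℂ) * a b) •
          lowMode (modeRate p b 0) := by
      have h1 : S t z = ∑ b, (((Real.exp (modeRate p b 0 * t) : ℝ) : ℂ) * a b) •
          lowMode (modeRate p b 0) := by
        rw [hz, map_sum]
        refine Finset.sum_congr rfl fun b _ => ?_
        rw [map_smul, hS.apply_lowMode hp, smul_smul, mul_comm]
      have h2 : S t u = twofold (D2k 1 (S t u)) + ∑ b, f b t • lowMode (modeRate p b 0) :=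
        eq_add_of_sub_eq' hlow
      rw [map_sub, h1, h2, (hS.mem_H2k_one hp t hu1).2, ← hv', map_smul, add_sub_assoc,
        ← Finset.sum_sub_distrib]
      simp only [sub_smul]
    have hexp : Real.exp (-2 * t) * Real.exp ((σ + 2) * t) = Real.exp (σ * t) := by
      rw [← Real.exp_add]
      ring_nf
    have h1 : ‖S t (u - z)‖ ≤ w * B * Real.exp (σ * t) +
        ∑ b, H b * (N + B) * Real.exp (σ * t) * G b := by
      rw [e]
      refine (norm_add_le _ _).trans (add_le_add ?_ ((norm_sum_le _ _).trans
        (Finset.sum_le_sum fun b _ => ?_)))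
      · rw [norm_smul, norm_ofReal_exp, ← hexp]
        calc _ ≤ Real.exp (-2 * t) * (w * (B * Real.exp ((σ + 2) * t))) := by
              gcongr
              exact (twofold.le_opNorm _).trans (by gcongr; exact hSv t)
          _ = _ := by ring
      · rw [norm_smul]
        gcongr
        exact (ha2 b t).trans (mul_le_mul_of_nonneg_right (hAX b) (Real.exp_nonneg _))
    have h2 : Real.exp (-2 * t) * fullNorm k (S t v) ≤ B * Real.exp (σ * t) := by
      rw [← hexp]
      calc _ ≤ Real.exp (-2 * t) * (B * Real.exp ((σ + 2) * t)) := by gcongr; exact hB t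
        _ = _ := by ring
    have h3 : ∑ b, H b * (N + B) * Real.exp (σ * t) * G b ≤
        (∑ b, H b * (G b + 1)) * ((N + B) * Real.exp (σ * t)) := by
      rw [Finset.sum_mul]
      refine Finset.sum_le_sum fun b _ => ?_
      have : 0 ≤ H b * (N + B) * Real.exp (σ * t) := mul_nonneg (hHX b) (Real.exp_nonneg _)
      calc _ ≤ H b * (N + B) * Real.exp (σ * t) * G b + H b * (N + B) * Real.exp (σ * t) := by
            linarith
        _ = _ := by ring
    have h4 : (w + 1) * B * Real.exp (σ * t) ≤ (w + 1) * (N + B) * Real.exp (σ * t) := by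
      gcongr
      linarith
    calc _ ≤ (w + 1) * (N + B) * Real.exp (σ * t) +
          (∑ b, H b * (G b + 1)) * ((N + B) * Real.exp (σ * t)) := by linarith
      _ = _ := by ring

/-- `u` grows at most with rate `σ` in `𝓗^{2k}`. -/
def GrowsAtMost (S : ℝ≥0 → Energy →L[ℂ] Energy) (k : ℕ) (σ : ℝ) (u : Energy) : Prop :=
  ∃ B, ∀ t : ℝ≥0, fullNorm k (S t u) ≤ B * Real.exp (σ * t)

/-- The exponent `r - 2k` differs from the eigenvalues `λ_j^±`, `j < k`. -/
def NonResonant (p k : ℕ) (r : ℝ) : Prop := ∀ j < k, ∀ b, modeRate p b j ≠ r - 2 * k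

theorem NonResonant.pred {k : ℕ} {r : ℝ} (h : NonResonant p (k + 1) r) : NonResonant p k r := by
  intro j hj b e
  refine h (j + 1) (by omega) b ?_
  rw [modeRate_succ, e]
  push_cast
  ring

theorem rate_succ (r : ℝ) (k : ℕ) : r - 2 * ((k + 1 : ℕ) : ℝ) + 2 = r - 2 * k := by
  push_cast
  ring

theorem IsWaveSemigroup.growsAtMost_deriv (hS : IsWaveSemigroup p S) (hp : 1 < p) {k : ℕ}
    {σ : ℝ} {u : Energy} (hu : u ∈ H2k (k + 1)) (h : GrowsAtMost S (k + 1) σ u) :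
    GrowsAtMost S k (σ + 2) (D2k 1 u) := by
  obtain ⟨B, hB⟩ := h
  refine ⟨B, fun t => ?_⟩
  have h1 := hB t
  rw [hS.fullNorm_succ_apply hp k hu] at h1
  have h2 : Real.exp (-2 * t) * fullNorm k (S t (D2k 1 u)) ≤ B * Real.exp (σ * t) := by
    linarith [norm_nonneg (S t u)]
  calc fullNorm k (S t (D2k 1 u)) =
        Real.exp (2 * t) * (Real.exp (-2 * t) * fullNorm k (S t (D2k 1 u))) := by
        rw [← mul_assoc, ← Real.exp_add]
        simp
    _ ≤ Real.exp (2 * t) * (B * Real.exp (σ * t)) := by gcongr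
    _ = _ := by
        rw [mul_left_comm, ← Real.exp_add]
        ring_nf

theorem IsWaveSemigroup.eq_zero_of_growsAtMost_sum (hS : IsWaveSemigroup p S) (hp : 1 < p)
    {σ K : ℝ} (hσ : ∀ b, modeRate p b 0 ≠ σ) {a : Bool → ℂ}
    (ha : ∀ b, modeRate p b 0 < σ → a b = 0)
    (h : ∀ t : ℝ≥0, ‖S t (∑ b, a b • lowMode (modeRate p b 0))‖ ≤ K * Real.exp (σ * t)) :
    a = 0 := by
  funext b
  rcases (hσ b).lt_or_gt with hlt | hlt
  · exact ha b hlt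
  · refine norm_eq_zero.1 (eq_zero_of_exp_le (K := ‖lowCoord p b‖ * K) hlt (norm_nonneg _)
      fun t => ?_)
    have hz : ∑ b, a b • lowMode (modeRate p b 0) ∈ lowPairs :=
      sum_mem fun b _ => lowPairs.smul_mem _ (lowMode_mem _)
    have h1 := hS.lowCoord_apply hp hz b t
    have h2 : lowCoord p b (∑ b, a b • lowMode (modeRate p b 0)) = a b := by
      cases b <;> simp [lowCoord_lowMode hp]
    rw [h2] at h1
    rw [← norm_ofReal_exp, ← norm_mul, ← h1, mul_assoc]
    exact ((lowCoord p b).le_opNorm _).trans (by gcongr; exact h t)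

/-- Elements of `𝓗^{2k}` that grow at most with rate `r - 2k` do so uniformly. -/
theorem IsWaveSemigroup.uniform_growth (hS : IsWaveSemigroup p S) (hp : 1 < p) {r : ℝ}
    (hr : 1 / 2 + p * c0 p ≤ r) (k : ℕ) (hres : NonResonant p k r) :
    ∃ C ≥ 0, ∀ u ∈ H2k k, GrowsAtMost S k (r - 2 * k) u → ∀ t : ℝ≥0,
      fullNorm k (S t u) ≤ C * fullNorm k u * Real.exp ((r - 2 * k) * t) := by
  induction k with
  | zero =>
    obtain ⟨M, hM⟩ := hS.bound
    have hM0 : 0 ≤ M := by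
      have := (norm_nonneg _).trans (hM 0)
      simpa using this
    refine ⟨M, hM0, fun u _ _ t => ?_⟩
    rw [fullNorm_zero, fullNorm_zero, Nat.cast_zero, mul_zero, sub_zero, mul_right_comm]
    refine (S t).le_of_opNorm_le ((hM t).trans ?_) u
    gcongr
  | succ k ih =>
    obtain ⟨C₁, hC₁0, hC₁⟩ := ih hres.pred
    have hσ := hres 0 (Nat.succ_pos k)
    obtain ⟨C₂, hC₂0, hC₂⟩ := hS.exists_lowest_part hp k hσ
    refine ⟨C₂ * (1 + C₁), by positivity, fun u hu hgrow t => ?_⟩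
    obtain ⟨hu1, hv⟩ := mem_H2k_succ_iff.1 hu
    have hgv := hS.growsAtMost_deriv hp hu hgrow
    have hgv' := hgv
    rw [rate_succ] at hgv
    have hunif := hC₁ _ hv hgv
    rw [← rate_succ] at hunif
    obtain ⟨a, ha1, -, ha3⟩ := hC₂ u hu _ hunif
    have ha : a = 0 := by
      obtain ⟨B, hB⟩ := hgrow
      refine hS.eq_zero_of_growsAtMost_sum hp (K := B + C₂ * (fullNorm (k + 1) u +
        C₁ * fullNorm k (D2k 1 u))) hσ ha1 fun t => ?_
      have e : S t (∑ b, a b • lowMode (modeRate p b 0)) = S t u -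
          S t (u - ∑ b, a b • lowMode (modeRate p b 0)) := by
        rw [map_sub (S t), sub_sub_cancel]
      rw [e, add_mul]
      exact (norm_sub_le _ _).trans (add_le_add ((norm_le_fullNorm _ _).trans (hB t))
        ((norm_le_fullNorm _ _).trans (ha3 t)))
    have h1 := ha3 t
    simp only [ha, Pi.zero_apply, zero_smul, Finset.sum_const_zero, sub_zero] at h1
    refine h1.trans (mul_le_mul_of_nonneg_right ?_ (Real.exp_nonneg _))
    have h2 : C₁ * fullNorm k (D2k 1 u) ≤ C₁ * fullNorm (k + 1) u := by
      gcongr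
      exact norm_D2k_one_le k hu1
    rw [mul_assoc]
    gcongr
    linarith

end

/-! ### Expansions into eigenfunctions -/

theorem eq_of_modeRate_succ_eq {p : ℕ} (hp : 1 < p) {b b' : Bool} {j : ℕ}
    (h : modeRate p b (j + 1) = modeRate p b' 0) :
    b = true ∧ b' = false ∧ p = 5 ∧ j = 1 := by
  have h1 := modeRate_not_lt hp
  rw [modeRate_eq] at h
  push_cast at h
  have hj : (0 : ℝ) ≤ j := j.cast_nonneg
  cases b <;> cases b'
  · linarith
  · linarith
  · refine ⟨rfl, rfl, ?_⟩
    obtain ⟨m, rfl⟩ : ∃ m, p = m + 1 := ⟨p - 1, by omega⟩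
    have hm : (m : ℝ) ≠ 0 := by
      have : m ≠ 0 := by omega
      exact_mod_cast this
    simp only [modeRate, lamPlus, lamMinus, cond_true, cond_false, Nat.cast_zero, Nat.cast_add,
      Nat.cast_one, add_sub_cancel_right] at h
    have h2 : (2 * (j : ℝ) - 1) * m = 4 := by
      field_simp at h
      linarith
    have h3 : (2 * (j : ℤ) - 1) * m = 4 := by exact_mod_cast h2
    have h4 : (m : ℤ) ∣ 4 := ⟨_, by rw [← h3, mul_comm]⟩
    have h5 : m ≤ 4 := by exact_mod_cast Int.le_of_dvd (by norm_num) h4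
    interval_cases m <;> omega
  · linarith

section

variable {p : ℕ} {S : ℝ≥0 → Energy →L[ℂ] Energy}

/-- `u` is an eigenfunction of the semigroup, or zero. -/
def IsEigen (S : ℝ≥0 → Energy →L[ℂ] Energy) (lam : ℝ) (u : Energy) : Prop :=
  ∀ t : ℝ≥0, S t u = ((Real.exp (lam * t) : ℝ) : ℂ) • u

theorem IsWaveSemigroup.isEigen_deriv (hS : IsWaveSemigroup p S) (hp : 1 < p) {lam : ℝ}
    {u : Energy} (hu : u ∈ H2k 1) (h : IsEigen S lam u) : IsEigen S (lam + 2) (D2k 1 u) := by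
  intro t
  have h1 := (hS.mem_H2k_one hp t hu).2
  rw [h t, D2k_smul _ hu] at h1
  have h2 := congrArg (((Real.exp (2 * t) : ℝ) : ℂ) • ·) h1
  simp only [smul_smul, ← Complex.ofReal_mul, ← Real.exp_add] at h2
  rw [neg_mul, add_neg_cancel, Real.exp_zero, Complex.ofReal_one, one_smul] at h2
  rw [← h2]
  ring_nf

theorem IsWaveSemigroup.lowCoord_eq_zero (hS : IsWaveSemigroup p S) (hp : 1 < p) {lam : ℝ}
    {u : Energy} (hu : u ∈ lowPairs) (h : IsEigen S lam u) {b : Bool}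
    (hb : lam ≠ modeRate p b 0) : lowCoord p b u = 0 := by
  have h1 := hS.lowCoord_apply hp hu b 1
  rw [h 1, map_smul, smul_eq_mul] at h1
  by_contra h0
  have h2 := mul_right_cancel₀ h0 h1
  simp only [Complex.ofReal_inj, Real.exp_eq_exp, NNReal.coe_one, mul_one] at h2
  exact hb h2

theorem IsWaveSemigroup.eq_zero_of_lowPairs (hS : IsWaveSemigroup p S) (hp : 1 < p) {lam : ℝ}
    {u : Energy} (hu : u ∈ lowPairs) (h : IsEigen S lam u) (hb : ∀ b, lam ≠ modeRate p b 0) :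
    u = 0 := by
  rw [eq_sum_lowMode hp hu]
  exact Finset.sum_eq_zero fun b _ => by rw [hS.lowCoord_eq_zero hp hu h (hb b), zero_smul]

/-- There are no eigenfunctions in `𝓗^{2k}` to the right of `1/2 + p c₀ - 2k` other than those
with an eigenvalue `λ_0^± - 2i`. -/
theorem IsWaveSemigroup.eq_zero_of_isEigen (hS : IsWaveSemigroup p S) (hp : 1 < p) (k : ℕ)
    {lam : ℝ} (hlam : 1 / 2 + p * c0 p - 2 * k < lam)
    (hne : ∀ i < k, ∀ b, modeRate p b i ≠ lam) {u : Energy} (hu : u ∈ H2k k)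
    (h : IsEigen S lam u) : u = 0 := by
  induction k generalizing lam u with
  | zero =>
    obtain ⟨M, hM⟩ := hS.bound
    rw [Nat.cast_zero, mul_zero, sub_zero] at hlam
    refine norm_eq_zero.1 (eq_zero_of_exp_le (K := M * ‖u‖) hlam (norm_nonneg _) fun t => ?_)
    rw [← norm_ofReal_exp, ← norm_smul, ← h t, mul_right_comm]
    exact (S t).le_of_opNorm_le (hM t) u
  | succ k ih =>
    obtain ⟨h1, h2⟩ := mem_H2k_succ_iff.1 hu
    have h3 : D2k 1 u = 0 := by
      refine ih ?_ ?_ h2 (hS.isEigen_deriv hp h1 h)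
      · push_cast at hlam
        linarith
      · intro i hi b e
        refine hne (i + 1) (by omega) b ?_
        rw [modeRate_succ, e]
        ring
    have h4 := sub_twofold_mem_lowPairs h1
    rw [h3, map_zero, sub_zero] at h4
    exact hS.eq_zero_of_lowPairs hp h4 h fun b e => hne 0 (Nat.succ_pos k) b e.symm

end

section

variable {p : ℕ} {S : ℝ≥0 → Energy →L[ℂ] Energy}

/-- A family of eigenfunctions in `𝓗^{2k}` with the eigenvalues `λ_j^±`, `j < k`, nonzero if the
eigenvalue is at least `σ`. -/
structure IsModeFamily (p : ℕ) (S : ℝ≥0 → Energy →L[ℂ] Energy) (k : ℕ) (σ : ℝ)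
    (e : Bool → ℕ → Energy) : Prop where
  mem : ∀ b, ∀ j < k, e b j ∈ H2k k
  eigen : ∀ b, ∀ j < k, IsEigen S (modeRate p b j) (e b j)
  ne_zero : ∀ b, ∀ j < k, σ ≤ modeRate p b j → e b j ≠ 0

/-- The eigenvalue `λ_2^+`, which coincides with `λ_0^-` for `p = 5`, lies below `r - 2k` in this
case. -/
def NonDegenerate (p k : ℕ) (r : ℝ) : Prop := p ≠ 5 ∨ lamPlus p 2 < r - 2 * k

theorem NonDegenerate.pred {k : ℕ} {r : ℝ} (h : NonDegenerate p (k + 1) r) :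
    NonDegenerate p k r := by
  refine h.imp id fun h => ?_
  rw [← rate_succ]
  linarith

theorem NonDegenerate.ne {k : ℕ} {r : ℝ} (h : NonDegenerate p k r) (hp : 1 < p) {b b' : Bool}
    {j : ℕ} (hb : r - 2 * k ≤ modeRate p b' 0) :
    modeRate p b (j + 1) ≠ modeRate p b' 0 := by
  intro e
  obtain ⟨rfl, rfl, rfl, rfl⟩ := eq_of_modeRate_succ_eq hp e
  rcases h with h | h
  · exact h rfl
  · rw [← e] at hb
    exact hb.not_gt h

theorem IsModeFamily.deriv {k : ℕ} {r : ℝ} {e : Bool → ℕ → Energy} (hS : IsWaveSemigroup p S)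
    (hp : 1 < p) (h : IsModeFamily p S (k + 1) (r - 2 * (k + 1 : ℕ)) e)
    (hdeg : NonDegenerate p (k + 1) r) :
    IsModeFamily p S k (r - 2 * k) fun b j => D2k 1 (e b (j + 1)) where
  mem b j hj := (mem_H2k_succ_iff.1 (h.mem b (j + 1) (by omega))).2
  eigen b j hj := by
    have := hS.isEigen_deriv hp (mem_H2k_succ_iff.1 (h.mem b (j + 1) (by omega))).1
      (h.eigen b (j + 1) (by omega))
    rwa [modeRate_succ, sub_add_cancel] at this
  ne_zero b j hj hσ h0 := by
    have hσ' : r - 2 * ((k + 1 : ℕ) : ℝ) ≤ modeRate p b (j + 1) := by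
      rw [modeRate_succ]
      linarith [rate_succ r k]
    refine h.ne_zero b (j + 1) (by omega) hσ' ?_
    have h4 := sub_twofold_mem_lowPairs (mem_H2k_succ_iff.1 (h.mem b (j + 1) (by omega))).1
    rw [h0, map_zero, sub_zero] at h4
    refine hS.eq_zero_of_lowPairs hp h4 (h.eigen b (j + 1) (by omega)) fun b' e => ?_
    exact hdeg.ne hp (hσ'.trans e.le) e

/-- The first pair of a family of eigenfunctions consists of multiples of the lowest modes. -/
theorem IsModeFamily.exists_smul_eq {k : ℕ} {r : ℝ} {e : Bool → ℕ → Energy}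
    (hS : IsWaveSemigroup p S) (hp : 1 < p) (hr : 1 / 2 + p * c0 p ≤ r)
    (hres : NonResonant p (k + 1) r)
    (h : IsModeFamily p S (k + 1) (r - 2 * (k + 1 : ℕ)) e) (hdeg : NonDegenerate p (k + 1) r)
    (b : Bool) (hb : r - 2 * (k + 1 : ℕ) ≤ modeRate p b 0) :
    ∃ y : ℂ, y • e b 0 = lowMode (modeRate p b 0) := by
  obtain ⟨h1, h2⟩ := mem_H2k_succ_iff.1 (h.mem b 0 (Nat.succ_pos k))
  have hei := h.eigen b 0 (Nat.succ_pos k)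
  have hlt : r - 2 * ((k + 1 : ℕ) : ℝ) < modeRate p b 0 :=
    lt_of_le_of_ne hb (hres 0 (Nat.succ_pos k) b).symm
  have h3 : D2k 1 (e b 0) = 0 := by
    refine hS.eq_zero_of_isEigen hp k ?_ (fun i hi b' e' => ?_) h2 (hS.isEigen_deriv hp h1 hei)
    · linarith [rate_succ r k]
    · refine hdeg.ne hp (b := b') (j := i) hb ?_
      rw [modeRate_succ, e']
      ring
  have h4 := sub_twofold_mem_lowPairs h1
  rw [h3, map_zero, sub_zero] at h4
  have h5 := eq_sum_lowMode hp h4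
  have h6 : lowCoord p (!b) (e b 0) = 0 := by
    refine hS.lowCoord_eq_zero hp h4 hei fun e' => modeRate_zero_ne hp b (sub_eq_zero.2 e')
  set x := lowCoord p b (e b 0) with hx
  have h7 : e b 0 = x • lowMode (modeRate p b 0) := by
    rw [Fintype.sum_bool] at h5
    cases b
    · rw [Bool.not_false] at h6
      rwa [h6, zero_smul, zero_add] at h5
    · rw [Bool.not_true] at h6
      rwa [h6, zero_smul, add_zero] at h5
  have h8 : x ≠ 0 := by
    intro h0
    rw [h0, zero_smul] at h7
    exact h.ne_zero b 0 (Nat.succ_pos k) hb h7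
  exact ⟨x⁻¹, (congrArg (x⁻¹ • ·) h7).trans (inv_smul_smul₀ h8 _)⟩

theorem IsWaveSemigroup.exists_expansion (hS : IsWaveSemigroup p S) (hp : 1 < p) {r : ℝ}
    (hr : 1 / 2 + p * c0 p ≤ r) (k : ℕ) (hres : NonResonant p k r) (hdeg : NonDegenerate p k r)
    {e : Bool → ℕ → Energy} (he : IsModeFamily p S k (r - 2 * k) e) :
    ∃ C ≥ 0, ∀ u ∈ H2k k, ∃ c : Bool → ℕ → ℂ,
      (∀ b, ∀ j < k, ‖c b j‖ ≤ C * fullNorm k u) ∧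
      (∀ b, ∀ j < k, modeRate p b j < r - 2 * k → c b j = 0) ∧
      ∀ t : ℝ≥0, fullNorm k (S t (u - ∑ j ∈ Finset.range k, ∑ b, c b j • e b j)) ≤
        C * fullNorm k u * Real.exp ((r - 2 * k) * t) := by
  induction k generalizing e with
  | zero =>
    obtain ⟨M, hM⟩ := hS.bound
    have hM0 : 0 ≤ M := by
      have := (norm_nonneg _).trans (hM 0)
      simpa using this
    refine ⟨M, hM0, fun u _ => ⟨0, by simp, by simp, fun t => ?_⟩⟩
    rw [Finset.sum_range_zero, sub_zero, fullNorm_zero, fullNorm_zero, Nat.cast_zero, mul_zero,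
      sub_zero, mul_right_comm]
    refine (S t).le_of_opNorm_le ((hM t).trans ?_) u
    gcongr
  | succ k ih =>
    obtain ⟨C₁, hC₁0, hC₁⟩ := ih hres.pred hdeg.pred (he.deriv hS hp hdeg)
    obtain ⟨C₂, hC₂0, hC₂⟩ := hS.exists_lowest_part hp k (hres 0 (Nat.succ_pos k))
    have hy : ∀ b, ∃ y : ℂ, r - 2 * ((k + 1 : ℕ) : ℝ) ≤ modeRate p b 0 →
        y • e b 0 = lowMode (modeRate p b 0) := by
      intro b
      by_cases hb : r - 2 * ((k + 1 : ℕ) : ℝ) ≤ modeRate p b 0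
      · obtain ⟨y, hy⟩ := he.exists_smul_eq hS hp hr hres hdeg b hb
        exact ⟨y, fun _ => hy⟩
      · exact ⟨0, fun h => absurd h hb⟩
    choose y hy using hy
    set E := ∑ j ∈ Finset.range k, ∑ b, fullNorm (k + 1) (e b (j + 1)) with hE
    have hE0 : 0 ≤ E := Finset.sum_nonneg fun j _ => Finset.sum_nonneg fun b _ =>
      fullNorm_nonneg _ _
    set Y := ‖y true‖ + ‖y false‖ with hY
    have hYb : ∀ b, ‖y b‖ ≤ Y := by
      intro b
      cases b <;> simp [hY]
    have hY0 : 0 ≤ Y := by positivity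
    set C₃ := C₂ * (1 + C₁ * E + C₁) with hC₃
    have hC₃0 : 0 ≤ C₃ := by positivity
    refine ⟨C₃ * (1 + Y) + C₁, by positivity, fun u hu => ?_⟩
    obtain ⟨hu1, hv⟩ := mem_H2k_succ_iff.1 hu
    set N := fullNorm (k + 1) u with hN
    have hN0 : 0 ≤ N := fullNorm_nonneg _ _
    obtain ⟨c, hc1, hc2, hc3⟩ := hC₁ _ hv
    have hvN : fullNorm k (D2k 1 u) ≤ N := norm_D2k_one_le k hu1
    have hmem : ∀ b, ∀ j ∈ Finset.range k, e b (j + 1) ∈ H2k (k + 1) := fun b j hj =>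
      he.mem b (j + 1) (by simpa using hj)
    set z := ∑ j ∈ Finset.range k, ∑ b, c b j • e b (j + 1) with hz
    have hzj : ∀ j ∈ Finset.range k, ∑ b, c b j • e b (j + 1) ∈ H2k (k + 1) := fun j hj =>
      (sobolev (k + 1)).sum_mem fun b _ => (sobolev (k + 1)).smul_mem _ (hmem b j hj)
    have hzk : z ∈ H2k (k + 1) := (sobolev (k + 1)).sum_mem hzj
    have hDz : D2k 1 z = ∑ j ∈ Finset.range k, ∑ b, c b j • D2k 1 (e b (j + 1)) := by
      rw [hz, D2k_sum _ fun j hj => H2k_succ_subset_one (hzj j hj)]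
      refine Finset.sum_congr rfl fun j hj => ?_
      rw [D2k_sum _ fun b _ => (sobolev 1).smul_mem _ (H2k_succ_subset_one (hmem b j hj))]
      exact Finset.sum_congr rfl fun b _ => D2k_smul _ (H2k_succ_subset_one (hmem b j hj))
    have hz_le : fullNorm (k + 1) z ≤ C₁ * N * E := by
      rw [hE, Finset.mul_sum]
      refine (fullNorm_sum_le _ hzj).trans (Finset.sum_le_sum fun j hj => ?_)
      rw [Finset.mul_sum]
      refine (fullNorm_sum_le _ fun b _ =>
        (sobolev (k + 1)).smul_mem _ (hmem b j hj)).trans (Finset.sum_le_sum fun b _ => ?_)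
      rw [fullNorm_smul _ (hmem b j hj)]
      refine mul_le_mul_of_nonneg_right ?_ (fullNorm_nonneg _ _)
      exact (hc1 b j (Finset.mem_range.1 hj)).trans (by gcongr)
    have hu' : u - z ∈ H2k (k + 1) := (sobolev (k + 1)).sub_mem hu hzk
    have hu'N : fullNorm (k + 1) (u - z) ≤ (1 + C₁ * E) * N := by
      refine (fullNorm_sub_le hu hzk).trans ?_
      linarith
    have hD : D2k 1 (u - z) =
        D2k 1 u - ∑ j ∈ Finset.range k, ∑ b, c b j • D2k 1 (e b (j + 1)) := by
      rw [D2k_sub hu1 (H2k_succ_subset_one hzk), hDz]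
    rw [← rate_succ, ← hD] at hc3
    obtain ⟨a, ha1, ha2, ha3⟩ := hC₂ _ hu' _ hc3
    have hbound : C₂ * (fullNorm (k + 1) (u - z) + C₁ * fullNorm k (D2k 1 u)) ≤ C₃ * N := by
      rw [hC₃, mul_assoc]
      gcongr
      nlinarith [mul_le_mul_of_nonneg_left hvN hC₁0]
    have hsum : ∑ b, a b • lowMode (modeRate p b 0) = ∑ b, (a b * y b) • e b 0 := by
      refine Finset.sum_congr rfl fun b _ => ?_
      rcases lt_or_ge (modeRate p b 0) (r - 2 * ((k + 1 : ℕ) : ℝ)) with hb | hb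
      · rw [ha1 b hb, zero_mul, zero_smul, zero_smul]
      · rw [mul_smul, hy b hb]
    obtain ⟨c', h0, hs⟩ : ∃ c' : Bool → ℕ → ℂ, (∀ b, c' b 0 = a b * y b) ∧
        ∀ b j, c' b (j + 1) = c b j :=
      ⟨fun b j => Nat.casesOn j (a b * y b) (c b), fun _ => rfl, fun _ _ => rfl⟩
    have hC₃N : 0 ≤ C₃ * N := mul_nonneg hC₃0 hN0
    have hC₁N : 0 ≤ C₁ * N := mul_nonneg hC₁0 hN0
    have hC₃Y : 0 ≤ C₃ * N * Y := mul_nonneg hC₃N hY0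
    refine ⟨c', fun b j hj => ?_, fun b j hj hb => ?_, fun t => ?_⟩
    · cases j with
      | zero =>
        have h1 : ‖a b * y b‖ ≤ C₃ * N * Y := by
          rw [norm_mul]
          exact mul_le_mul ((ha2 b).trans hbound) (hYb b) (norm_nonneg _) hC₃N
        rw [h0]
        linarith
      | succ j =>
        have h1 := hc1 b j (by omega)
        have h2 := mul_le_mul_of_nonneg_left hvN hC₁0
        rw [hs]
        linarith
    · cases j with
      | zero => rw [h0, ha1 b hb, zero_mul]
      | succ j =>
        rw [hs]
        refine hc2 b j (by omega) ?_
        rw [modeRate_succ] at hb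
        linarith [rate_succ r k]
    · rw [Finset.sum_range_succ']
      simp only [h0, hs]
      rw [← hz, ← hsum, ← sub_sub]
      refine (ha3 t).trans (mul_le_mul_of_nonneg_right (hbound.trans ?_) (Real.exp_nonneg _))
      linarith

end

/-! ### Absence of resonances -/

theorem mul_sq_add_ne {a n b K : ℤ} (ha : Odd a) :
    a * n ^ 2 + 4 * (b * n) + 2 ≠ 4 * (K * n ^ 2) := by
  intro h
  rcases Int.even_or_odd n with ⟨i, rfl⟩ | hn
  · have : 4 * (a * i ^ 2 + 2 * (b * i) - 4 * (K * i ^ 2)) = -2 := by linear_combination h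
    omega
  · have h1 : Odd (a * n ^ 2) := ha.mul hn.pow
    obtain ⟨x, hx⟩ := h1
    omega

theorem remainderRate_eq {m : ℝ} {p : ℕ} (hm : (p : ℝ) = m + 1) (k : ℕ) :
    1 / 2 + p * c0 p - 2 * k = 1 / 2 + (m + 1) * (2 * (m + 2) / m ^ 2) - 2 * k := by
  rw [c0, hm]
  ring

theorem nonResonant_of_odd {p : ℕ} (hp : Odd p) (hp1 : 1 < p) (k : ℕ) :
    NonResonant p k (1 / 2 + p * c0 p) := by
  intro j _ b h
  obtain ⟨n, rfl⟩ := hp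
  have hn : (n : ℝ) ≠ 0 := by
    have : n ≠ 0 := by omega
    exact_mod_cast this
  rw [remainderRate_eq (m := 2 * n) (by push_cast; ring)] at h
  cases b
  · refine mul_sq_add_ne (a := 9) (n := n) (b := 2) (K := (k : ℤ) - j) (by decide) ?_
    have : (9 * (n : ℝ) ^ 2 + 4 * (2 * n) + 2) = 4 * (((k : ℝ) - j) * n ^ 2) := by
      simp only [modeRate, lamMinus, cond_false] at h
      push_cast at h
      rw [add_sub_cancel_right] at h
      field_simp at h
      linarith
    exact_mod_cast this
  · refine mul_sq_add_ne (a := 3) (n := n) (b := 1) (K := (k : ℤ) - j) (by decide) ?_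
    have : (3 * (n : ℝ) ^ 2 + 4 * (1 * n) + 2) = 4 * (((k : ℝ) - j) * n ^ 2) := by
      simp only [modeRate, lamPlus, cond_true] at h
      push_cast at h
      rw [add_sub_cancel_right] at h
      field_simp at h
      linarith
    exact_mod_cast this

theorem nonDegenerate_of_le_three {p k : ℕ} (h : p ≠ 5 ∨ k ≤ 3) :
    NonDegenerate p k (1 / 2 + p * c0 p) := by
  by_cases hp : p = 5
  · have hk : (k : ℝ) ≤ 3 := by exact_mod_cast h.resolve_left (not_not_intro hp)
    right
    subst hp
    norm_num [lamPlus, c0]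
    linarith
  · exact Or.inl hp

section

variable {p : ℕ} {S : ℝ≥0 → Energy →L[ℂ] Energy} {k : ℕ} {e : Bool → ℕ → Energy}

theorem isModeFamily_of_isAnalyticMode (hS : IsWaveSemigroup p S)
    (he : ∀ b, ∀ j < k, IsAnalyticMode p k (modeRate p b j) (e b j)) (σ : ℝ) :
    IsModeFamily p S k σ e where
  mem b j hj := (he b j hj).mem
  eigen b j hj := hS.apply_eigenvector (he b j hj).eigen
  ne_zero b j hj _ h := by
    have h1 := normH2k_smul (k := k) 0 (he b j hj).mem
    rw [zero_smul, ← h, (he b j hj).normalized] at h1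
    simp at h1

theorem IsWaveSemigroup.decomposition (hS : IsWaveSemigroup p S) (hp1 : 1 < p) (hp : Odd p)
    (hk : p ≠ 5 ∨ k ≤ 3)
    (he : ∀ b, ∀ j < k, IsAnalyticMode p k (modeRate p b j) (e b j)) :
    ∃ C > 0, ∀ u ∈ H2k k, ∃ (c : Bool → ℕ → ℂ) (g : Energy), g ∈ H2k k ∧
      u = ∑ j ∈ Finset.range k, ∑ b, c b j • e b j + g ∧
      (∀ τ : ℝ≥0, normH2k k (S τ g) ≤
        C * Real.exp (remainderRate p k * τ) * normH2k k g) ∧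
      ∀ τ : ℝ≥0, normH2k k (S τ u) ≤ C * (∑ j ∈ Finset.range k,
          ∑ b, ‖c b j‖ * Real.exp (modeRate p b j * τ) +
        Real.exp (remainderRate p k * τ) * normH2k k u) := by
  have hres := nonResonant_of_odd hp hp1 k
  have hfam := isModeFamily_of_isAnalyticMode hS he (1 / 2 + p * c0 p - 2 * k)
  obtain ⟨C₀, hC₀0, hC₀⟩ := hS.exists_expansion hp1 le_rfl k hres
    (nonDegenerate_of_le_three hk) hfam
  obtain ⟨C₁, hC₁0, hC₁⟩ := hS.uniform_growth hp1 le_rfl k hres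
  obtain ⟨K, hK0, hK⟩ := exists_fullNorm_le k
  refine ⟨2 * K * (1 + C₀ + C₁), by positivity, fun u hu => ?_⟩
  obtain ⟨c, hc1, -, hc3⟩ := hC₀ u hu
  set z := ∑ j ∈ Finset.range k, ∑ b, c b j • e b j with hz
  have hzj : ∀ j ∈ Finset.range k, ∀ b ∈ Finset.univ, c b j • e b j ∈ H2k k := fun j hj b _ =>
    (sobolev k).smul_mem _ (he b j (by simpa using hj)).mem
  have hzk : z ∈ H2k k := (sobolev k).sum_mem fun j hj => (sobolev k).sum_mem (hzj j hj)
  have hg : u - z ∈ H2k k := (sobolev k).sub_mem hu hzk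
  refine ⟨c, u - z, hg, (add_sub_cancel z u).symm, fun τ => ?_, fun τ => ?_⟩
  · have h1 := hC₁ _ hg ⟨_, hc3⟩ τ
    have h2 := hK _ hg
    have h3 : 0 ≤ normH2k k (u - z) := normH2k_nonneg _ _
    calc normH2k k (S τ (u - z)) ≤ 2 * (C₁ * fullNorm k (u - z) *
          Real.exp (remainderRate p k * τ)) :=
          (normH2k_le_fullNorm _ _).trans (mul_le_mul_of_nonneg_left h1 zero_le_two)
      _ ≤ 2 * (C₁ * (K * normH2k k (u - z)) * Real.exp (remainderRate p k * τ)) := by gcongr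
      _ = 2 * K * C₁ * Real.exp (remainderRate p k * τ) * normH2k k (u - z) := by ring
      _ ≤ _ := by
          gcongr
          linarith
  · have hSz : S τ z = ∑ j ∈ Finset.range k, ∑ b,
        (((Real.exp (modeRate p b j * τ) : ℝ) : ℂ) * c b j) • e b j := by
      rw [hz, map_sum]
      refine Finset.sum_congr rfl fun j hj => ?_
      rw [map_sum]
      refine Finset.sum_congr rfl fun b _ => ?_
      rw [map_smul, hfam.eigen b j (by simpa using hj) τ, smul_smul, mul_comm]
    have hSzj : ∀ j ∈ Finset.range k, ∀ b ∈ Finset.univ,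
        (((Real.exp (modeRate p b j * τ) : ℝ) : ℂ) * c b j) • e b j ∈ H2k k := fun j hj b _ =>
      (sobolev k).smul_mem _ (he b j (by simpa using hj)).mem
    have h1 : fullNorm k (S τ z) ≤ K * ∑ j ∈ Finset.range k,
        ∑ b, ‖c b j‖ * Real.exp (modeRate p b j * τ) := by
      rw [hSz, Finset.mul_sum]
      refine (fullNorm_sum_le _ fun j hj => (sobolev k).sum_mem (hSzj j hj)).trans
        (Finset.sum_le_sum fun j hj => ?_)
      rw [Finset.mul_sum]
      refine (fullNorm_sum_le _ (hSzj j hj)).trans (Finset.sum_le_sum fun b _ => ?_)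
      have hej := he b j (by simpa using hj)
      rw [fullNorm_smul _ hej.mem, norm_mul, norm_ofReal_exp]
      have h2 := hK _ hej.mem
      rw [hej.normalized, mul_one] at h2
      calc _ ≤ Real.exp (modeRate p b j * τ) * ‖c b j‖ * K := by gcongr
        _ = _ := by ring
    set W := ∑ j ∈ Finset.range k, ∑ b, ‖c b j‖ * Real.exp (modeRate p b j * τ)
    have hW : 0 ≤ W := Finset.sum_nonneg fun j _ => Finset.sum_nonneg fun b _ => by positivity
    have h2 : fullNorm k (S τ u) ≤ fullNorm k (S τ z) + fullNorm k (S τ (u - z)) := by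
      have := fullNorm_add_le (hS.mem_H2k hp1 τ hzk) (hS.mem_H2k hp1 τ hg)
      rwa [← map_add, add_sub_cancel] at this
    have h3 : fullNorm k (S τ (u - z)) ≤
        C₀ * (K * normH2k k u) * Real.exp (remainderRate p k * τ) := by
      refine (hc3 τ).trans ?_
      rw [remainderRate]
      gcongr
      exact hK u hu
    have h4 : 0 ≤ Real.exp (remainderRate p k * τ) * normH2k k u :=
      mul_nonneg (Real.exp_nonneg _) (normH2k_nonneg _ _)
    calc normH2k k (S τ u) ≤ 2 * (K * W +
          C₀ * (K * normH2k k u) * Real.exp (remainderRate p k * τ)) :=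
          (normH2k_le_fullNorm _ _).trans (by linarith)
      _ = 2 * K * 1 * W + 2 * K * C₀ * (Real.exp (remainderRate p k * τ) * normH2k k u) := by
          ring
      _ ≤ 2 * K * (1 + C₀ + C₁) * W +
          2 * K * (1 + C₀ + C₁) * (Real.exp (remainderRate p k * τ) * normH2k k u) := by
          gcongr <;> linarith
      _ = _ := by ring

theorem gauge_gap {p : ℕ} (hp1 : 1 < p) :
    modeRate p false 0 < modeRate p true 1 ∧ modeRate p true 1 < modeRate p true 0 := by
  rw [modeRate_eq p true 1]
  have := modeRate_not_lt hp1
  push_cast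
  constructor <;> linarith

theorem modeRate_le_zero (p : ℕ) (b : Bool) (j : ℕ) : modeRate p b j ≤ modeRate p b 0 := by
  rw [modeRate_eq]
  have : (0 : ℝ) ≤ j := j.cast_nonneg
  linarith

theorem modeRate_le_of_le (p : ℕ) (b : Bool) {i j : ℕ} (h : i ≤ j) :
    modeRate p b j ≤ modeRate p b i := by
  rw [modeRate_eq, modeRate_eq p b i]
  have : (i : ℝ) ≤ j := by exact_mod_cast h
  linarith

theorem two_le_of_remainderRate_le {p k : ℕ} (hp1 : 1 < p)
    (h : remainderRate p k ≤ modeRate p true 1) : 2 ≤ k := by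
  have h1 : (1 : ℝ) < p := by exact_mod_cast hp1
  have h2 : 0 < 2 / ((p : ℝ) - 1) := div_pos two_pos (by linarith)
  set y := 2 / ((p : ℝ) - 1) with hy
  have h3 : modeRate p true 0 = 1 + y := by simp [modeRate, lamPlus, hy]
  have h4 := modeRate_char hp1 true
  rw [remainderRate, modeRate_eq, ← h4, h3] at h
  by_contra hk
  have hk' : (k : ℝ) ≤ 1 := by exact_mod_cast (by omega : k ≤ 1)
  push_cast at h
  nlinarith

/-- Linear stability modulo the gauge mode. -/
theorem IsWaveSemigroup.gauge_decay (hS : IsWaveSemigroup p S) (hp1 : 1 < p) (hp : Odd p)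
    (hk : remainderRate p k ≤ modeRate p true 1)
    (he : ∀ b, ∀ j < k, IsAnalyticMode p k (modeRate p b j) (e b j)) :
    ∃ C > 0, ∀ u ∈ H2k k, ∃ c : ℂ, ∀ τ : ℝ≥0, normH2k k (S τ (u - c • e true 0)) ≤
      C * Real.exp (modeRate p true 1 * τ) * normH2k k u := by
  have hk2 := two_le_of_remainderRate_le hp1 hk
  obtain ⟨hgap, -⟩ := gauge_gap hp1
  have hlt : remainderRate p k < modeRate p true 1 :=
    lt_of_le_of_ne hk (nonResonant_of_odd hp hp1 k 1 (by omega) true).symm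
  have hlt2 : modeRate p true 2 < modeRate p true 1 := by
    rw [modeRate_succ]
    linarith
  obtain ⟨s, hs1, hs2⟩ := exists_between (max_lt hlt (max_lt hlt2 hgap))
  obtain ⟨hs3, hs4⟩ := max_lt_iff.1 hs1
  obtain ⟨hs4, hs5⟩ := max_lt_iff.1 hs4
  have hrs : s + 2 * k - 2 * k = s := add_sub_cancel_right _ _
  have hr : 1 / 2 + p * c0 p ≤ s + 2 * k := by
    rw [remainderRate] at hs3
    linarith
  have hzero : ∀ b j, (b = true → 2 ≤ j) → modeRate p b j < s := by
    intro b j hbj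
    cases b
    · exact (modeRate_le_zero p false j).trans_lt hs5
    · exact (modeRate_le_of_le p true (hbj rfl)).trans_lt hs4
  have hres : NonResonant p k (s + 2 * k) := by
    intro j _ b
    rw [hrs]
    by_cases hbj : b = true → 2 ≤ j
    · exact (hzero b j hbj).ne
    · push Not at hbj
      obtain ⟨rfl, hj⟩ := hbj
      exact (hs2.trans_le (modeRate_le_of_le p true (by omega))).ne'
  have hdeg : NonDegenerate p k (s + 2 * k) := by
    right
    rw [hrs]
    exact hs4
  have hfam := isModeFamily_of_isAnalyticMode hS he (s + 2 * k - 2 * k)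
  obtain ⟨C₀, hC₀0, hC₀⟩ := hS.exists_expansion hp1 hr k hres hdeg hfam
  obtain ⟨K, hK0, hK⟩ := exists_fullNorm_le k
  have he1 := he true 1 (by omega)
  refine ⟨2 * (C₀ * (1 + K) * K) + 1, by positivity, fun u hu => ?_⟩
  obtain ⟨c, hc1, hc2, hc3⟩ := hC₀ u hu
  rw [hrs] at hc2 hc3
  have hsum : ∑ j ∈ Finset.range k, ∑ b, c b j • e b j =
      c true 0 • e true 0 + c true 1 • e true 1 := by
    obtain ⟨m, rfl⟩ : ∃ m, k = m + 2 := ⟨k - 2, by omega⟩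
    have hz : ∀ b j, j < m + 2 → (b = true → 2 ≤ j) → c b j • e b j = 0 := fun b j hj hbj => by
      rw [hc2 b j hj (hzero b j hbj), zero_smul]
    rw [Finset.sum_range_succ', Finset.sum_range_succ', Finset.sum_eq_zero, Fintype.sum_bool,
      Fintype.sum_bool, hz false 0 (by omega) (by simp), hz false (0 + 1) (by omega) (by simp)]
    · simp [add_comm]
    · intro j hj
      rw [Finset.mem_range] at hj
      exact Finset.sum_eq_zero fun b _ => hz b _ (by omega) fun _ => by omega
  refine ⟨c true 0, fun τ => ?_⟩
  have h1 := hc3 τ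
  rw [hsum] at h1
  set x := u - c true 0 • e true 0 with hx
  set y := c true 1 • e true 1 with hy
  have hyk : y ∈ H2k k := (sobolev k).smul_mem _ he1.mem
  have hxk : x ∈ H2k k := (sobolev k).sub_mem hu ((sobolev k).smul_mem _ (he true 0 (by omega)).mem)
  rw [← sub_sub, ← hx] at h1
  have h2 : fullNorm k (S τ y) ≤ C₀ * fullNorm k u * K * Real.exp (modeRate p true 1 * τ) := by
    have h3 := hK _ he1.mem
    rw [he1.normalized, mul_one] at h3
    rw [hy, map_smul, hfam.eigen true 1 (by omega) τ, smul_smul, fullNorm_smul _ he1.mem, norm_mul,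
      norm_ofReal_exp]
    have h4 := hc1 true 1 (by omega)
    have h5 : 0 ≤ C₀ * fullNorm k u := mul_nonneg hC₀0 (fullNorm_nonneg _ _)
    calc _ ≤ C₀ * fullNorm k u * Real.exp (modeRate p true 1 * τ) * K :=
          mul_le_mul (mul_le_mul_of_nonneg_right h4 (Real.exp_nonneg _)) h3 (fullNorm_nonneg _ _)
            (mul_nonneg h5 (Real.exp_nonneg _))
      _ = _ := by ring
  have h3 : fullNorm k (S τ x) ≤ fullNorm k (S τ (x - y)) + fullNorm k (S τ y) := by
    have := fullNorm_add_le (hS.mem_H2k hp1 τ ((sobolev k).sub_mem hxk hyk))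
      (hS.mem_H2k hp1 τ hyk)
    rwa [← map_add, sub_add_cancel] at this
  have h4 : Real.exp (s * τ) ≤ Real.exp (modeRate p true 1 * τ) := by
    gcongr
  have h5 : fullNorm k (S τ (x - y)) ≤
      C₀ * fullNorm k u * Real.exp (modeRate p true 1 * τ) :=
    h1.trans (mul_le_mul_of_nonneg_left h4 (mul_nonneg hC₀0 (fullNorm_nonneg _ _)))
  have h6 := hK u hu
  have h7 : 0 ≤ Real.exp (modeRate p true 1 * τ) * normH2k k u :=
    mul_nonneg (Real.exp_nonneg _) (normH2k_nonneg _ _)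
  calc normH2k k (S τ x) ≤ 2 * (C₀ * (1 + K) * Real.exp (modeRate p true 1 * τ) *
        fullNorm k u) := (normH2k_le_fullNorm _ _).trans (by linarith)
    _ ≤ 2 * (C₀ * (1 + K) * Real.exp (modeRate p true 1 * τ) * (K * normH2k k u)) := by
        gcongr
    _ = 2 * (C₀ * (1 + K) * K) * (Real.exp (modeRate p true 1 * τ) * normH2k k u) := by ring
    _ ≤ (2 * (C₀ * (1 + K) * K) + 1) * (Real.exp (modeRate p true 1 * τ) * normH2k k u) := by
        gcongr
        linarith
    _ = _ := by ring

/-- If `S(τ) u` decays with the rate `λ_1^+`, then no gauge mode has to be removed. -/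
theorem IsWaveSemigroup.eq_zero_of_gauge_decay (hS : IsWaveSemigroup p S) (hp1 : 1 < p)
    {e₀ : Energy} (he : IsAnalyticMode p k (modeRate p true 0) e₀) {u : Energy} {c : ℂ} {A B : ℝ}
    (h1 : ∀ τ : ℝ≥0, ‖S τ (u - c • e₀)‖ ≤ A * Real.exp (modeRate p true 1 * τ))
    (h2 : ∀ τ : ℝ≥0, ‖S τ u‖ ≤ B * Real.exp (modeRate p true 1 * τ)) : c • e₀ = 0 := by
  refine norm_eq_zero.1 (eq_zero_of_exp_le (K := B + A) (gauge_gap hp1).2 (norm_nonneg _)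
    fun τ => ?_)
  have e : ((Real.exp (modeRate p true 0 * τ) : ℝ) : ℂ) • c • e₀ = S τ u - S τ (u - c • e₀) := by
    rw [map_sub (S τ), sub_sub_cancel, map_smul, hS.apply_eigenvector he.eigen, smul_comm]
  rw [← norm_ofReal_exp, ← norm_smul, e, add_mul]
  exact (norm_sub_le _ _).trans (add_le_add (h2 τ) (h1 τ))

theorem IsWaveSemigroup.norm_le_of_no_gauge (hS : IsWaveSemigroup p S) (hp1 : 1 < p)
    (hk : remainderRate p k ≤ modeRate p true 1) {eP eM : ℕ → Energy}
    (he : ∀ j < k, IsAnalyticMode p k (lamPlus p j) (eP j) ∧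
      IsAnalyticMode p k (lamMinus p j) (eM j))
    {C : ℝ} {u g : Energy} {cP cM : ℕ → ℂ} (hu : IsModeExpansion p k S eP eM C u cP cM g)
    (h0 : cP 0 = 0) :
    ∃ B, ∀ τ : ℝ≥0, ‖S τ u‖ ≤ B * Real.exp (modeRate p true 1 * τ) := by
  refine ⟨∑ j ∈ Finset.range k, (‖cP j • eP j‖ + ‖cM j • eM j‖) + |C| * normH2k k g, fun τ => ?_⟩
  set E := Real.exp (modeRate p true 1 * τ) with hE
  have hexp : ∀ x, x ≤ modeRate p true 1 → Real.exp (x * τ) ≤ E := by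
    intro x hx
    rw [hE]
    gcongr
  conv_lhs => rw [hu.eq]
  rw [map_add, map_sum, add_mul, Finset.sum_mul]
  refine (norm_add_le _ _).trans (add_le_add ((norm_sum_le _ _).trans
    (Finset.sum_le_sum fun j hj => ?_)) ?_)
  · obtain ⟨hP, hM⟩ := he j (Finset.mem_range.1 hj)
    rw [map_add, map_smul, map_smul, hS.apply_eigenvector hP.eigen, hS.apply_eigenvector hM.eigen,
      smul_comm (cP j), smul_comm (cM j), add_mul]
    refine (norm_add_le _ _).trans (add_le_add ?_ ?_)
    · rcases Nat.eq_zero_or_pos j with rfl | hj0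
      · simp [h0]
      · rw [norm_smul, norm_ofReal_exp, mul_comm]
        exact mul_le_mul_of_nonneg_left (hexp _ (modeRate_le_of_le p true hj0)) (norm_nonneg _)
    · rw [norm_smul, norm_ofReal_exp, mul_comm]
      exact mul_le_mul_of_nonneg_left
        (hexp _ ((modeRate_le_zero p false j).trans (gauge_gap hp1).1.le)) (norm_nonneg _)
  · refine ((norm_le_normH2k k _).trans (hu.decay τ)).trans ?_
    have h1 := hexp _ hk
    calc C * Real.exp (remainderRate p k * τ) * normH2k k g
        ≤ |C| * E * normH2k k g := by
          have h2 := normH2k_nonneg k g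
          gcongr
          exact le_abs_self C
      _ = _ := by ring

end

end AnalyticModes

end

open AnalyticModes in
theorem theorem4p4 (p k : ℕ) (hp : Odd p) (hp1 : 1 < p) (hk : 1 ≤ k) :
    -- the closure defining `L₀` is a genuine closure, and `L` generates a unique semigroup
    Ltilde0.IsClosable ∧
    (∃! S : ℝ≥0 → Energy →L[ℂ] Energy, Generates (L p) S) ∧
    ∀ S : ℝ≥0 → Energy →L[ℂ] Energy, Generates (L p) S →
      -- `S` acts on `𝓗^{2k}`
      (∀ τ : ℝ≥0, ∀ u ∈ H2k k, S τ u ∈ H2k k) ∧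
      -- the normalized analytic eigenfunctions exist and come from odd polynomials
      (∀ j < k, (∃ e, IsAnalyticMode p k (lamPlus p j) e ∧ IsOddPolynomialMode (lamPlus p j) e) ∧
        ∃ e, IsAnalyticMode p k (lamMinus p j) e ∧ IsOddPolynomialMode (lamMinus p j) e) ∧
      -- for every choice `e^±_j` of them:
      ∀ eP eM : ℕ → Energy,
        (∀ j < k, IsAnalyticMode p k (lamPlus p j) (eP j) ∧
          IsAnalyticMode p k (lamMinus p j) (eM j)) →
        -- decomposition, estimate of the remainder and estimate of the evolution
        ((p ≠ 5 ∨ k ≤ 3) → ∃ C > 0, ∀ u ∈ H2k k, ∃ (cP cM : ℕ → ℂ) (g : Energy),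
          IsModeExpansion p k S eP eM C u cP cM g ∧
          ∀ τ : ℝ≥0, normH2k k (S τ u) ≤
            C * (∑ j ∈ Finset.range k, (‖cP j‖ * Real.exp (lamPlus p j * τ) +
                ‖cM j‖ * Real.exp (lamMinus p j * τ)) +
              Real.exp (remainderRate p k * τ) * normH2k k u)) ∧
        -- linear stability modulo the gauge mode, for sufficiently regular perturbations
        (remainderRate p k ≤ -((p : ℝ) - 3) / ((p : ℝ) - 1) →
          -- removing a multiple of the gauge mode yields decay
          (∃ C > 0, ∀ u ∈ H2k k, ∃ c : ℂ, ∀ τ : ℝ≥0, normH2k k (S τ (u - c • eP 0)) ≤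
            C * Real.exp (-((p : ℝ) - 3) / ((p : ℝ) - 1) * τ) * normH2k k u) ∧
          -- perturbations whose expansion does not contain the gauge mode decay
          (∃ C > 0, ∀ (C' : ℝ) (u : Energy) (cP cM : ℕ → ℂ) (g : Energy), u ∈ H2k k →
            IsModeExpansion p k S eP eM C' u cP cM g → cP 0 = 0 →
            ∀ τ : ℝ≥0, normH2k k (S τ u) ≤
              C * Real.exp (-((p : ℝ) - 3) / ((p : ℝ) - 1) * τ) * normH2k k u) ∧
          -- the rate is sharp
          ∃ (C' : ℝ) (u : Energy) (cP cM : ℕ → ℂ) (g : Energy), u ∈ H2k k ∧ u ≠ 0 ∧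
            IsModeExpansion p k S eP eM C' u cP cM g ∧ cP 0 = 0 ∧
            ∀ τ : ℝ≥0, normH2k k (S τ u) =
              Real.exp (-((p : ℝ) - 3) / ((p : ℝ) - 1) * τ) * normH2k k u) := by
  have hc := coupling_pos hp1
  refine ⟨Ltilde0_isClosable, ?_, fun S hgen => ?_⟩
  · obtain ⟨S, hS⟩ := exists_isWaveSemigroup hc
    exact ⟨S, hS.generates, fun T hT => hS.eq_of_generates hT⟩
  have hS := isWaveSemigroup_of_generates hc hgen
  refine ⟨fun τ u hu => hS.mem_H2k hp1 τ hu, fun j _ => ⟨exists_analyticMode hp1 k true j,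
    exists_analyticMode hp1 k false j⟩, fun eP eM heig => ?_⟩
  set e : Bool → ℕ → Energy := fun b j => bif b then eP j else eM j with he_def
  have he : ∀ b, ∀ j < k, IsAnalyticMode p k (modeRate p b j) (e b j) := by
    intro b j hj
    cases b
    · exact (heig j hj).2
    · exact (heig j hj).1
  have hrate : -((p : ℝ) - 3) / ((p : ℝ) - 1) = modeRate p true 1 := by
    have h : (p : ℝ) - 1 ≠ 0 := by
      have : (1 : ℝ) < p := by exact_mod_cast hp1
      linarith
    rw [modeRate_true, lamPlus]
    push_cast
    field_simp
    ring
  rw [hrate]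
  refine ⟨fun h5 => ?_, fun hrem => ?_⟩
  · obtain ⟨C, hC0, hC⟩ := hS.decomposition hp1 hp h5 he
    refine ⟨C, hC0, fun u hu => ?_⟩
    obtain ⟨c, g, hg, hug, h1, h2⟩ := hC u hu
    simp only [Fintype.sum_bool] at hug h2
    exact ⟨c true, c false, g, ⟨hg, hug, h1⟩, h2⟩
  · obtain ⟨C, hC0, hC⟩ := hS.gauge_decay hp1 hp hrem he
    have hk2 := two_le_of_remainderRate_le hp1 hrem
    have he1 := (heig 1 hk2).1
    refine ⟨⟨C, hC0, hC⟩, ⟨C, hC0, fun C' u cP cM g hu hexp h0 τ => ?_⟩, ?_⟩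
    · obtain ⟨c, hcτ⟩ := hC u hu
      obtain ⟨B, hB⟩ := hS.norm_le_of_no_gauge hp1 hrem heig hexp h0
      have hz : c • e true 0 = 0 := by
        refine hS.eq_zero_of_gauge_decay hp1 (he true 0 hk) (A := C * normH2k k u)
          (fun τ => ?_) hB
        refine (norm_le_normH2k k _).trans ((hcτ τ).trans (le_of_eq ?_))
        ring
      have h1 := hcτ τ
      rwa [hz, sub_zero] at h1
    · have hz : normH2k k (0 : Energy) = 0 := by
        have := normH2k_smul (k := k) 0 he1.mem
        rwa [zero_smul, norm_zero, zero_mul] at this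
      refine ⟨0, eP 1, fun j => if j = 1 then 1 else 0, 0, 0, he1.mem, fun h => ?_,
        ⟨H2k_zero_mem k, ?_, fun τ => ?_⟩, rfl, fun τ => ?_⟩
      · have h1 := he1.normalized
        rw [h, hz] at h1
        exact zero_ne_one h1
      · have : 1 < k := hk2
        simp [Finset.sum_ite_eq', this]
      · rw [map_zero, hz]
        simp
      · rw [hS.apply_eigenvector he1.eigen, normH2k_smul _ he1.mem, norm_ofReal_exp]
        rfl
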